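/- **Setting.** Let $(\Omega,\mathcal F,\mathbb P)$ be a probability space, $m,d\ge1$, $X$ an $\mathbb R^d$-valued random variable, $f:\mathbb R^d\times\mathbb R^m\to\mathbb R$ with $f(X,\theta)\in L^1(\mathbb P)$ and $F(\theta)=\mathbb E[f(X,\theta)]$ for all $\theta\in\mathbb R^m$. Let $g:\mathbb R^d\times\mathbb R^m\to\mathbb R^m$ be measurable with $g(X,\theta)\in L^2(\mathbb P)$, and $b(\theta)=\mathbb E[g(X,\theta)]$. Let $(X_n)_{n\ge1}$ be i.i.d. copies of $X$, $\theta_0\in L^2(\mathbb P)$ independent of $(X_n)_{n\ge1}$, and $$\theta_n=\theta_{n-1}-\gamma_n\,g(X_n,\theta_{n-1}),\qquad n\ge1. \tag{SGD}$$ Assume: 1. $F$ is bounded below and differentiable, and $\|\nabla F(\theta')-\nabla F(\theta)\|\le L\|\theta'-\theta\|^\alpha$ for all $\theta,\theta'$, with $L>0$, $\alpha\in(0,1]$. 2. There are $C_0>0$ and $0<\kappa\le c$ with $\mathbb E\|g(X,\theta)\|^2\le C_0(F(\theta)-\inf F+1)$, $b(\theta)^\top\nabla F(\theta)\ge\kappa\|\nabla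 F(\theta)\|^2$ and $\|b(\theta)\|\le c\|\nabla F(\theta)\|$ for all $\theta$. 3. $\gamma_n>0$, $\sum_n\gamma_n=\infty$, $\sum_n\gamma_n^{1+\alpha}<\infty$. 4. $F(\theta)\to\infty$ as $\|\theta\|\to\infty$. 5. $F$ is Łojasiewicz: it is $C^1$ and every $\theta_\star$ with $\nabla F(\theta_\star)=0$ has an open neighbourhood $V$, $\beta\in(0,1)$ and $\zeta>0$ with $|F(\theta)-F(\theta_\star)|^\beta\le\zeta\|\nabla F(\theta)\|$ on $V$. ($F$ is *globally* Łojasiewicz if one can always take $V=\mathbb R^m$.) Some results below also assume, for some $\rho>1/\alpha$: 6. Either (a) $\ln(\gamma_{n-1}/\gamma_n)=o(\gamma_n)$, or (b) $\ln(\gamma_{n-1}/\gamma_n)\sim\gamma_n/\gamma_\star$ for some $\gamma_\star>0$; moreover $\sum_n\gamma_n/\sum_{k\le n}\gamma_k=\infty$ and $\gamma_n=O\big((\sum_{k\le n}\gamma_k)^{-\rho}\big)$. **Notation.** Let $\mathcal A$ be the random set of accumulation points of $(\theta_n)$ and $\mathcal L_\ell=\{F\le\ell\}$. For $K\subset\mathbb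 R^m$ say that $\mathrm{Ł}(K,\beta,\zeta)$ holds if every $\theta_\star\in K$ with $\nabla F(\theta_\star)=0$ has an open neighbourhood on which $|F-F(\theta_\star)|^\beta\le\zeta\|\nabla F\|$. Say that $\mathrm{Ł}_{\inf}(\beta,\zeta)$ holds if $(F-\inf F)^\beta\le\zeta\|\nabla F\|$ on $\mathbb R^m$. Put, for $t>0$, $$\gamma^{-1}(t)=\inf\{n\ge1:\gamma_n\le t\},\qquad \Sigma^{-1}(t)=\inf\Big\{n\ge1:\sum_{k=1}^{n+1}\gamma_k\ge t\Big\}.$$ "For $n\propto\Sigma^{-1}(t)$" means: for every integer $n\ge\Sigma^{-1}(t)$ (in particular $n=\Sigma^{-1}(t)$ and $n=\lceil q\,\Sigma^{-1}(t)\rceil$, $q\ge1$). "For $n\propto\gamma^{-1}(t)$" means: for $n=\gamma^{-1}(t)$ and, if $(\gamma_n)_{n\geq 1}$ is nonincreasing, for every $n\ge\gamma^{-1}(t)$. **Statement.** Under 1–5, the sets defining $\gamma^{-1}(t)$ and $\Sigma^{-1}(t)$ are nonempty for all $t>0$, and there is $F_\star\in L^1(\mathbb P)$ with $F(\theta_n)\to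 F_\star$ almost surely, such that the following hold. **(i) Best iterate** (under 1–5). * **a.** For every $\delta\in(0,1)$ there is $\ell_\delta>\inf F$ with $\mathbb P(\mathcal A\subset\mathcal L_{\ell_\delta})\ge1-\delta$ such that $\mathrm{Ł}(\mathcal L_{\ell_\delta},\beta,\zeta)$ holds for some $\beta\in(0,1)$, $\zeta>0$, and also holds with $\zeta=1$ for some $\beta\in(0,1)$. For all $\beta_\delta\in(0,1)$, $\zeta_\delta>0$ such that $\mathrm{Ł}(\mathcal L_{\ell_\delta},\beta_\delta,\zeta_\delta)$ holds, there is $C_\delta>0$ such that for all $\varepsilon>0$ and $n\propto\Sigma^{-1}(\varepsilon^{-(1\vee2\beta_\delta)})$, $$\inf_{0\le k\le n}F(\theta_k)-F_\star\le C_\delta\,\varepsilon\quad\text{with probability at least }1-\delta.$$ * **b.** $\mathrm{Ł}(\mathbb R^m,\beta,1)$ holds for some $\beta\in(0,1]$. For each such $\beta$ and every $\delta\in(0,1)$ there is $C_\delta>0$ such that for all $\varepsilon>0$ and $n\propto\Sigma^{-1}(\varepsilon^{-(1\vee2\beta)})$, $\inf_{0\le k\le n}F(\theta_k)-F_\star\le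 C_\delta\,\varepsilon$ with probability at least $1-\delta$. * **c.** If $F$ is globally Łojasiewicz, then $F_\star=\inf F$ a.s., and $\mathrm{Ł}_{\inf}(\beta,\zeta)$ holds for some $\beta\in[\frac\alpha{1+\alpha},1)$, $\zeta>0$. For each such $(\beta,\zeta)$ there is $C>0$ such that for all $\delta\in(0,1)$, $\varepsilon>0$ and $n\propto\Sigma^{-1}(\varepsilon^{-2\beta})$, $\inf_{0\le k\le n}F(\theta_k)-\inf F\le C\delta^{-1/\beta}\varepsilon$ with probability at least $1-\delta$. **(ii) Last iterate** (under 1–6). In the conditions on $\gamma_\star$ below, nothing is required in case 6(a). * **a.** For every $\delta\in(0,1)$ there is $\ell_\delta$ as in the first sentence of (i)a such that, for all $\beta_\delta\in(0,1)$, $\zeta_\delta>0$ for which $\mathrm{Ł}(\mathcal L_{\ell_\delta},\beta_\delta,\zeta_\delta)$ holds, there is $C_\delta>0$ such that for all $\varepsilon>0$, $F(\theta_n)-F_\star\le C_\delta\,\varepsilon$ with probability at least $1-\delta$ for $$n\propto\begin{cases}\gamma^{-1}(\varepsilon^{2\vee\frac1\alpha}),&\text{if }\beta_\delta\le\frac12\text{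 and, in case 6(b), }\kappa\gamma_\star>\zeta_\delta^{1/\beta_\delta}(\alpha\vee\tfrac12),\\ \Sigma^{-1}(\varepsilon^{-1/r_\delta}),&\text{if }\beta_\delta>\frac12,\ \text{with } r_\delta=\frac1{2\beta_\delta-1}\wedge(\alpha\rho-1)\wedge\frac{\rho-1}2>0.\end{cases}$$ In particular, for $\zeta_\delta=1$ the condition on $\gamma_\star$ is $\kappa\gamma_\star>\alpha\vee\frac12$. * **b.** For every $\beta\in(0,1]$ such that $\mathrm{Ł}(\mathbb R^m,\beta,1)$ holds and every $\delta\in(0,1)$, there is $C_\delta>0$ such that for all $\varepsilon>0$, $F(\theta_n)-F_\star\le C_\delta\,\varepsilon$ with probability at least $1-\delta$ for $n\propto\gamma^{-1}(\varepsilon^{2\vee\frac1\alpha})$ if $\beta\le\frac12$ and, in case 6(b), $\kappa\gamma_\star>\alpha\vee\frac12$; and for $n\propto\Sigma^{-1}(\varepsilon^{-1/r})$ if $\beta>\frac12$, with $r=\frac1{2\beta-1}\wedge(\alpha\rho-1)\wedge\frac{\rho-1}2>0$. * **c.** Suppose $F$ is globally Łojasiewicz and $\mathrm{Ł}_{\inf}(\beta,\zeta)$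 holds with $\beta\in(\frac\alpha{1+\alpha},1)\cup\{\frac12\}$, $\zeta>0$. Then there is $C>0$ such that for all $\delta\in(0,1)$ and $\varepsilon>0$, $F(\theta_n)-F_\star\le\frac C\delta\,\varepsilon$ with probability at least $1-\delta$ for $$n\propto\begin{cases}\gamma^{-1}(\varepsilon^{\frac1\alpha}),&\text{if }\beta\le\frac12\text{ and, in case 6(b), }\kappa\gamma_\star>\zeta^{2+\lambda\frac{1+\alpha}\alpha}\Big(\frac{(1+\alpha)L^{1/\alpha}}\alpha\Big)^{\lambda}\alpha,\\ \Sigma^{-1}(\varepsilon^{-1/r}),&\text{if }\beta>\frac12,\ \text{with } r=\frac1{2\beta-1}\wedge(\alpha\rho-1)>0,\end{cases}$$ where $\lambda=\frac{1-2\beta}{\frac{1+\alpha}\alpha\beta-1}$ if $\beta<\frac12$ and $\lambda=0$ if $\beta=\frac12$. **Cost.** Fix the costs of producing $\theta_0$, of drawing one innovation, of one call to $g$, of evaluating one learning rate and of one real arithmetic operation. Then there is a constant $C>0$ such that, for every $n\ge1$ (in particular for each count above), computing $\theta_n$ by running (SGD) costs at most $Cn$. -/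

import Mathlib

open MeasureTheory ProbabilityTheory Filter Topology Asymptotics

noncomputable section

namespace SGD

/-! ### The loss landscape -/

/-- `F` is bounded below, differentiable, and `∇F` is `(L, α)`-Hölder continuous. -/
structure HolderSmooth {m : ℕ} (F : EuclideanSpace ℝ (Fin m) → ℝ) (L α : ℝ) : Prop where
  bddBelow : BddBelow (Set.range F)
  differentiable : Differentiable ℝ F
  L_pos : 0 < L
  α_pos : 0 < α
  α_le_one : α ≤ 1
  holder : ∀ θ θ', ‖gradient F θ' - gradient F θ‖ ≤ L * ‖θ' - θ‖ ^ α

/-- `F` tends to infinity at infinity. -/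
def Coercive {m : ℕ} (F : EuclideanSpace ℝ (Fin m) → ℝ) : Prop :=
  Tendsto F (cocompact (EuclideanSpace ℝ (Fin m))) atTop

/-- `F` is Łojasiewicz: continuously differentiable, with a local Łojasiewicz inequality around
each stationary point (exponent and constant may depend on the point). -/
def Lojasiewicz {m : ℕ} (F : EuclideanSpace ℝ (Fin m) → ℝ) : Prop :=
  ContDiff ℝ 1 F ∧
    ∀ θs, gradient F θs = 0 →
      ∃ V : Set (EuclideanSpace ℝ (Fin m)), IsOpen V ∧ θs ∈ V ∧
        ∃ β ζ : ℝ, 0 < β ∧ β < 1 ∧ 0 < ζ ∧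
          ∀ θ ∈ V, |F θ - F θs| ^ β ≤ ζ * ‖gradient F θ‖

/-- `F` is globally Łojasiewicz: the neighbourhoods above can be taken to be the whole space. -/
def GloballyLojasiewicz {m : ℕ} (F : EuclideanSpace ℝ (Fin m) → ℝ) : Prop :=
  ContDiff ℝ 1 F ∧
    ∀ θs, gradient F θs = 0 →
      ∃ β ζ : ℝ, 0 < β ∧ β < 1 ∧ 0 < ζ ∧
        ∀ θ, |F θ - F θs| ^ β ≤ ζ * ‖gradient F θ‖

/-- The Łojasiewicz inequality with common exponent `β` and constant `ζ` around every stationary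
point of `F` lying in `K`. -/
def LojasiewiczOn {m : ℕ} (F : EuclideanSpace ℝ (Fin m) → ℝ)
    (K : Set (EuclideanSpace ℝ (Fin m))) (β ζ : ℝ) : Prop :=
  ∀ θs ∈ K, gradient F θs = 0 →
    ∃ V : Set (EuclideanSpace ℝ (Fin m)), IsOpen V ∧ θs ∈ V ∧
      ∀ θ ∈ V, |F θ - F θs| ^ β ≤ ζ * ‖gradient F θ‖

/-- The Łojasiewicz inequality on the whole space, relative to the level `inf F`. -/
def LojasiewiczInf {m : ℕ} (F : EuclideanSpace ℝ (Fin m) → ℝ) (β ζ : ℝ) : Prop :=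
  ∀ θ, (F θ - ⨅ x, F x) ^ β ≤ ζ * ‖gradient F θ‖

/-- The sublevel set `{F ≤ ℓ}`. -/
def sublevel {m : ℕ} (F : EuclideanSpace ℝ (Fin m) → ℝ) (ℓ : ℝ) :
    Set (EuclideanSpace ℝ (Fin m)) :=
  {θ | F θ ≤ ℓ}

/-! ### The stochastic oracle -/

/-- The mean `b(θ) = E[g(X, θ)]` of the oracle. -/
def meanOracle {Ω : Type*} [MeasurableSpace Ω] (μ : Measure Ω) {m d : ℕ}
    (X : Ω → EuclideanSpace ℝ (Fin d))
    (g : EuclideanSpace ℝ (Fin d) → EuclideanSpace ℝ (Fin m) → EuclideanSpace ℝ (Fin m))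
    (θ : EuclideanSpace ℝ (Fin m)) : EuclideanSpace ℝ (Fin m) :=
  ∫ ω, g (X ω) θ ∂μ

/-- Second moment, alignment and growth conditions on the oracle. -/
structure OracleBounds {Ω : Type*} [MeasurableSpace Ω] (μ : Measure Ω) {m d : ℕ}
    (F : EuclideanSpace ℝ (Fin m) → ℝ) (X : Ω → EuclideanSpace ℝ (Fin d))
    (g : EuclideanSpace ℝ (Fin d) → EuclideanSpace ℝ (Fin m) → EuclideanSpace ℝ (Fin m))
    (C κ c : ℝ) : Prop where
  C_pos : 0 < C
  κ_pos : 0 < κ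
  κ_le : κ ≤ c
  memLp : ∀ θ, MemLp (fun ω => g (X ω) θ) 2 μ
  second_moment : ∀ θ, ∫ ω, ‖g (X ω) θ‖ ^ 2 ∂μ ≤ C * ((F θ - ⨅ x, F x) + 1)
  align : ∀ θ, κ * ‖gradient F θ‖ ^ 2 ≤ inner ℝ (meanOracle μ X g θ) (gradient F θ)
  growth : ∀ θ, ‖meanOracle μ X g θ‖ ≤ c * ‖gradient F θ‖

/-! ### Learning rates

A learning rate sequence is `γ 1, γ 2, …`; the value `γ 0` is never used. -/

/-- `γ_1 + ⋯ + γ_n`. -/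
def partialSum (γ : ℕ → ℝ) (n : ℕ) : ℝ := ∑ k ∈ Finset.Icc 1 n, γ k

/-- Positive, with divergent sum and convergent sum of the powers of order `1 + α`. -/
structure StepSizes (γ : ℕ → ℝ) (α : ℝ) : Prop where
  pos : ∀ n, 1 ≤ n → 0 < γ n
  diverges : Tendsto (partialSum γ) atTop atTop
  summable : Summable fun n : ℕ => γ (n + 1) ^ (1 + α)

/-- `ln (γ_{n-1} / γ_n) = o(γ_n)`. -/
def SlowDecay (γ : ℕ → ℝ) : Prop :=
  (fun n : ℕ => Real.log (γ n / γ (n + 1))) =o[atTop] fun n => γ (n + 1)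

/-- `ln (γ_{n-1} / γ_n) ∼ γ_n / γ_⋆`. -/
def CriticalDecay (γ : ℕ → ℝ) (γs : ℝ) : Prop :=
  (fun n : ℕ => Real.log (γ n / γ (n + 1))) ~[atTop] fun n => γ (n + 1) / γs

/-- The finer description of the learning rates, with exponent `ρ`. -/
structure RefinedStepSizes (γ : ℕ → ℝ) (α ρ : ℝ) : Prop where
  decay : SlowDecay γ ∨ ∃ γs : ℝ, 0 < γs ∧ CriticalDecay γ γs
  ratio_diverges :
    Tendsto (fun n => ∑ k ∈ Finset.Icc 1 n, γ k / partialSum γ k) atTop atTop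
  ρ_gt : 1 / α < ρ
  bigO : γ =O[atTop] fun n => partialSum γ n ^ (-ρ)

/-- `κ γ_⋆ > B` whenever `γ` is in the critical regime with parameter `γ_⋆` (no condition in the
slow regime). -/
def CriticalCondition (γ : ℕ → ℝ) (κ B : ℝ) : Prop :=
  ∀ γs : ℝ, 0 < γs → CriticalDecay γ γs → B < κ * γs

/-- `γ⁻¹(t) = inf {n ≥ 1 : γ_n ≤ t}`. -/
def rateInv (γ : ℕ → ℝ) (t : ℝ) : ℕ := sInf {n : ℕ | 1 ≤ n ∧ γ n ≤ t}

/-- `Σ⁻¹(t) = inf {n ≥ 1 : Σ_n ≥ t}`, where `Σ_n = γ_1 + ⋯ + γ_{n+1}`. -/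
def sumInv (γ : ℕ → ℝ) (t : ℝ) : ℕ := sInf {n : ℕ | 1 ≤ n ∧ t ≤ partialSum γ (n + 1)}

/-- The iteration counts `n ∝ γ⁻¹(t)`: `n = γ⁻¹(t)` itself and, when the learning rates are
nonincreasing, every larger `n`. -/
def RateCount (γ : ℕ → ℝ) (t : ℝ) (n : ℕ) : Prop :=
  n = rateInv γ t ∨ (AntitoneOn γ (Set.Ici 1) ∧ rateInv γ t ≤ n)

/-! ### Probability and accumulation points -/

/-- The event `p` has probability at least `1 - δ`. -/
def WithProb {Ω : Type*} [MeasurableSpace Ω] (μ : Measure Ω) (δ : ℝ) (p : Ω → Prop) : Prop :=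
  ENNReal.ofReal (1 - δ) ≤ μ {ω | p ω}

/-- The accumulation points of a sequence. -/
def accPoints {m : ℕ} (u : ℕ → EuclideanSpace ℝ (Fin m)) : Set (EuclideanSpace ℝ (Fin m)) :=
  {x | MapClusterPt x atTop u}

/-! ### Iteration counts for the last iterate -/

/-- The exponent `r = 1/(2β-1) ∧ (αρ-1) ∧ (ρ-1)/2`. -/
def localExponent (α ρ β : ℝ) : ℝ :=
  min (1 / (2 * β - 1)) (min (α * ρ - 1) ((ρ - 1) / 2))

/-- The exponent `r = 1/(2β-1) ∧ (αρ-1)`. -/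
def globalExponent (α ρ β : ℝ) : ℝ :=
  min (1 / (2 * β - 1)) (α * ρ - 1)

/-- The complexity of the last iterate, at confidence level `1 - δ`, for the Łojasiewicz exponent
`β`: the tolerance `ε` is reached, up to a factor `C` that does not depend on `ε`,
* for `n ∝ γ⁻¹(ε ^ (2 ∨ 1/α))` if `β ≤ 1/2` and, in the critical regime, `κ γ_⋆ > B`;
* for `n ∝ Σ⁻¹(ε ^ (-1/r))` if `β > 1/2`. -/
def LastIterateCount {Ω : Type*} [MeasurableSpace Ω] (μ : Measure Ω) {m : ℕ}
    (F : EuclideanSpace ℝ (Fin m) → ℝ) (γ : ℕ → ℝ) (θ : ℕ → Ω → EuclideanSpace ℝ (Fin m))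
    (Fs : Ω → ℝ) (α ρ κ δ β B : ℝ) : Prop :=
  (β ≤ 1 / 2 → CriticalCondition γ κ B →
    ∃ C : ℝ, 0 < C ∧ ∀ ε : ℝ, 0 < ε → ∀ n : ℕ, RateCount γ (ε ^ (max 2 (1 / α))) n →
      WithProb μ δ fun ω => F (θ n ω) - Fs ω ≤ C * ε) ∧
  (1 / 2 < β →
    0 < localExponent α ρ β ∧
    ∃ C : ℝ, 0 < C ∧ ∀ ε : ℝ, 0 < ε →
      ∀ n : ℕ, sumInv γ (ε ^ (-(1 / localExponent α ρ β))) ≤ n →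
        WithProb μ δ fun ω => F (θ n ω) - Fs ω ≤ C * ε)

/-- The exponent `λ` of the globally Łojasiewicz case. -/
def globalLambda (α β : ℝ) : ℝ :=
  if β < 1 / 2 then (1 - 2 * β) / ((1 + α) / α * β - 1) else 0

/-! ### The cost of running the algorithm -/

/-- A value together with the cost of the operations that produced it. -/
structure Timed (A : Type*) where
  val : A
  cost : ℕ

/-- One primitive operation of cost `k` returning `a`. -/
def Timed.op {A : Type*} (k : ℕ) (a : A) : Timed A := ⟨a, k⟩

/-- Sequential composition; costs add up. -/
def Timed.bind {A B : Type*} (x : Timed A) (f : A → Timed B) : Timed B :=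
  ⟨(f x.val).val, x.cost + (f x.val).cost⟩

/-- A loop over the coordinates that produces a vector; costs add up. -/
def Timed.forCoords {m : ℕ} (f : Fin m → Timed ℝ) : Timed (EuclideanSpace ℝ (Fin m)) :=
  ⟨WithLp.toLp 2 fun i => (f i).val, ∑ i, (f i).cost⟩

/-- Costs of the primitive operations: producing the initial point, drawing one innovation,
one call to the oracle `g`, evaluating one learning rate, one arithmetic operation on reals. -/
structure OpCosts where
  init : ℕ
  draw : ℕ
  oracle : ℕ
  rate : ℕ
  arith : ℕ

/-- One step `θ - s • g(x, θ)`, where `s` is the learning rate and `x` the drawn innovation. -/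
def timedStep {m d : ℕ} (w : OpCosts)
    (g : EuclideanSpace ℝ (Fin d) → EuclideanSpace ℝ (Fin m) → EuclideanSpace ℝ (Fin m))
    (s : ℝ) (x : EuclideanSpace ℝ (Fin d)) (θ : EuclideanSpace ℝ (Fin m)) :
    Timed (EuclideanSpace ℝ (Fin m)) :=
  (Timed.op w.draw x).bind fun x' =>
    (Timed.op w.oracle (g x' θ)).bind fun v =>
      (Timed.op w.rate s).bind fun s' =>
        Timed.forCoords fun i =>
          (Timed.op w.arith (s' * v i)).bind fun p => Timed.op w.arith (θ i - p)

/-- The algorithm run for `n` iterations from `θ₀` with innovations `x 1, x 2, …`. -/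
def timedRun {m d : ℕ} (w : OpCosts)
    (g : EuclideanSpace ℝ (Fin d) → EuclideanSpace ℝ (Fin m) → EuclideanSpace ℝ (Fin m))
    (γ : ℕ → ℝ) (x : ℕ → EuclideanSpace ℝ (Fin d)) (θ₀ : EuclideanSpace ℝ (Fin m)) :
    ℕ → Timed (EuclideanSpace ℝ (Fin m))
  | 0 => Timed.op w.init θ₀
  | n + 1 => (timedRun w g γ x θ₀ n).bind fun θ => timedStep w g (γ (n + 1)) (x (n + 1)) θ

end SGD

end

open SGD

/-! The Hölder descent inequality `descent_le`, averaged over the fresh innovation, gives in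
expectation over past events `gap_{n+1} ≤ gap_n - κ γ ‖∇F‖² + const γ^(1+α) (gap_n + 1)`. As `∑
γ^(1+α)` converges, this is a Robbins–Siegmund situation (`supermartingale_lyapunov`): the values
converge almost surely, and `∑ γ ‖∇F(θ)‖²` is finite, almost surely and in mean. The centred noise,
weighted by the rates, is an `L²`-bounded martingale in each direction, so up to a convergent
perturbation the iterates follow the mean field; since `∑ γ` diverges, they accumulate only at
critical points (`gradient_eq_zero_of_mapClusterPt`). Coercivity then makes the limit a critical
value and drives the trajectory into every open neighbourhood of the critical points at that level.

Compactness makes the Łojasiewicz exponents uniform and the critical values finite in number on each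
sublevel set. For the best iterate, the energy bound becomes `∑ γ |F(θ) - F⋆|^(2β) < ∞`, and the
smallest term is at most the total divided by `∑ γ`. The resulting constant is random;
`exists_withProb_of_cover` makes it deterministic at a fixed confidence level. In the global case
the mean energy is bounded, so Markov's inequality gives the dependence on `δ`.

For the last iterate, fix a critical level `v`, a bounded neighbourhood `U` of its critical points
and an entrance time `N`. The quantity `E[1_{stay in U} ((F - v)₊)²]` satisfies a closed recursion
(`exists_localError_succ_le`). Squaring is essential: `v` need not be a minimum, the positive part
cannot be differentiated through the noise, while its square is bounded by the square of the descent
bound and costs only a term of order `γ²`. In the global case the gap is already nonnegative, so its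
mean is used directly.

Both recursions are solved by the comparison principle `eventually_le_of_recursion`: a source of
relative size `u` produces an error `O(u)` as long as `u` decays more slowly than the contraction.
For `β ≤ 1/2` the drift is linear and `u` is a power of `γ`. For `β > 1/2` the superlinear drift is
replaced by a tangent line of slope `b / ∑ γ` (`exists_linear_le_rpow`), and `u` is a power of `∑
γ`. -/

/-! ### Deterministic properties of the landscape -/

/-- The optimality gap `F θ - inf F`. -/
noncomputable def gap {m : ℕ} (F : EuclideanSpace ℝ (Fin m) → ℝ) (x : EuclideanSpace ℝ (Fin m)) :
    ℝ := F x - ⨅ y, F y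

section Landscape

variable {m : ℕ} {F : EuclideanSpace ℝ (Fin m) → ℝ} {L α : ℝ}

theorem gap_nonneg (hF : HolderSmooth F L α) (x : EuclideanSpace ℝ (Fin m)) : 0 ≤ gap F x :=
  sub_nonneg.2 (ciInf_le hF.bddBelow x)

theorem continuous_gradient_of_holder (hF : HolderSmooth F L α) : Continuous (gradient F) := by
  rw [continuous_iff_continuousAt]
  intro x
  unfold ContinuousAt
  rw [tendsto_iff_norm_sub_tendsto_zero]
  refine squeeze_zero (fun _ => norm_nonneg _) (fun y => hF.holder x y) ?_
  have h1 : Tendsto (fun y : EuclideanSpace ℝ (Fin m) => ‖y - x‖) (𝓝 x) (𝓝 0) :=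
    tendsto_iff_norm_sub_tendsto_zero.1 tendsto_id
  have h2 := (h1.rpow_const (p := α) (Or.inr hF.α_pos.le)).const_mul L
  simpa [Real.zero_rpow hF.α_pos.ne'] using h2

/-- Along the segment from `x` to `y`, the derivative of `F` differs from its initial value by at
most `L t^α ‖y - x‖^(1+α)`; subtracting the primitive of this bound leaves an antitone function on
`[0, 1]`. -/
theorem descent_le (hF : HolderSmooth F L α) (x y : EuclideanSpace ℝ (Fin m)) :
    F y ≤ F x + inner ℝ (gradient F x) (y - x) + L / (1 + α) * ‖y - x‖ ^ (1 + α) := by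
  have hα := hF.α_pos
  set v := y - x with hv
  set c := inner ℝ (gradient F x) v with hc
  have hline : ∀ t : ℝ, HasDerivAt (fun t : ℝ => F (x + t • v))
      (inner ℝ (gradient F (x + t • v)) v) t := by
    intro t
    have h1 := (hF.differentiable (x + t • v)).hasGradientAt.hasFDerivAt
    have h2 : HasDerivAt (fun t : ℝ => x + t • v) v t := by
      simpa using ((hasDerivAt_id t).smul_const v).const_add x
    have h3 := h1.comp_hasDerivAt t h2
    rw [InnerProductSpace.toDual_apply_apply] at h3
    exact h3
  have hder : ∀ t : ℝ, HasDerivAt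
      (fun t : ℝ => F (x + t • v) - t * c - L / (1 + α) * ‖v‖ ^ (1 + α) * t ^ (1 + α))
      (inner ℝ (gradient F (x + t • v)) v - c
        - L / (1 + α) * ‖v‖ ^ (1 + α) * ((1 + α) * t ^ α)) t := by
    intro t
    have h3 : HasDerivAt (fun t : ℝ => t ^ (1 + α)) ((1 + α) * t ^ α) t := by
      simpa using Real.hasDerivAt_rpow_const (x := t) (p := 1 + α) (Or.inr (by linarith))
    have h4 : HasDerivAt (fun t : ℝ => t * c) c t := by
      simpa using (hasDerivAt_id t).mul_const c
    exact ((hline t).sub h4).sub (h3.const_mul _)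
  have hanti : AntitoneOn
      (fun t : ℝ => F (x + t • v) - t * c - L / (1 + α) * ‖v‖ ^ (1 + α) * t ^ (1 + α))
      (Set.Icc 0 1) := by
    refine antitoneOn_of_deriv_nonpos (convex_Icc 0 1)
      (fun t _ => (hder t).continuousAt.continuousWithinAt)
      (fun t _ => (hder t).differentiableAt.differentiableWithinAt) ?_
    intro t ht
    rw [interior_Icc] at ht
    rw [(hder t).deriv, hc, ← inner_sub_left]
    have h5 := real_inner_le_norm (gradient F (x + t • v) - gradient F x) v
    have h6 := hF.holder x (x + t • v)
    have h7 : ‖x + t • v - x‖ ^ α = t ^ α * ‖v‖ ^ α := by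
      rw [add_sub_cancel_left, norm_smul, Real.norm_of_nonneg ht.1.le,
        Real.mul_rpow ht.1.le (norm_nonneg _)]
    rw [h7] at h6
    have h8 : ‖v‖ ^ (1 + α) = ‖v‖ * ‖v‖ ^ α := by
      rw [Real.rpow_add_of_nonneg (norm_nonneg _) zero_le_one hα.le, Real.rpow_one]
    have h9 := mul_le_mul_of_nonneg_right h6 (norm_nonneg v)
    have h10 : L / (1 + α) * ‖v‖ ^ (1 + α) * ((1 + α) * t ^ α)
        = L * (t ^ α * ‖v‖ ^ α) * ‖v‖ := by
      rw [h8]; field_simp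
    linarith
  have h := hanti (Set.left_mem_Icc.2 zero_le_one) (Set.right_mem_Icc.2 zero_le_one) zero_le_one
  simp only [one_smul, zero_smul, add_zero, Real.one_rpow, mul_one, one_mul, zero_mul, sub_zero,
    Real.zero_rpow (by linarith : (1 + α) ≠ 0), mul_zero] at h
  have hy : x + v = y := by rw [hv]; abel
  rw [hy] at h
  linarith

/-- One gradient step cannot go below the infimum, so the decrease it guarantees is at most the gap.
-/
theorem gradient_rpow_le_gap (hF : HolderSmooth F L α) (x : EuclideanSpace ℝ (Fin m)) :
    ‖gradient F x‖ ^ ((1 + α) / α) ≤ (1 + α) * L ^ (1 / α) / α * gap F x := by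
  have hα := hF.α_pos
  have hL := hF.L_pos
  rcases (norm_nonneg (gradient F x)).eq_or_lt with h0 | h0
  · rw [← h0, Real.zero_rpow (by positivity)]
    have := gap_nonneg hF x
    positivity
  set G := ‖gradient F x‖ with hG
  -- The step length that minimises the descent bound along the negative gradient: it solves `L h^α
  -- G^(1+α) = G²`.
  set h := (G ^ (1 - α) / L) ^ (1 / α) with hh
  have hhpos : 0 < h := by positivity
  have h1 := descent_le hF x (x - h • gradient F x)
  have h2 : (⨅ y, F y) ≤ F (x - h • gradient F x) := ciInf_le hF.bddBelow _
  have h3 : inner ℝ (gradient F x) (x - h • gradient F x - x) = - (h * G ^ 2) := by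
    rw [sub_sub_cancel_left, inner_neg_right, inner_smul_right, real_inner_self_eq_norm_sq]
  have h4 : ‖x - h • gradient F x - x‖ = h * G := by
    rw [sub_sub_cancel_left, norm_neg, norm_smul, Real.norm_of_nonneg hhpos.le]
  have h5 : h ^ α = G ^ (1 - α) / L := by
    rw [hh, ← Real.rpow_mul (by positivity), one_div_mul_cancel hα.ne', Real.rpow_one]
  have h6 : L * (h * G) ^ (1 + α) = h * G ^ 2 := by
    rw [Real.mul_rpow hhpos.le h0.le, Real.rpow_add hhpos, h5, Real.rpow_one]
    have : G ^ (1 - α) * G ^ (1 + α) = G ^ 2 := by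
      rw [← Real.rpow_add h0, ← Real.rpow_natCast]; norm_num
    calc L * (h * (G ^ (1 - α) / L) * G ^ (1 + α)) = h * (G ^ (1 - α) * G ^ (1 + α)) := by
          field_simp
      _ = h * G ^ 2 := by rw [this]
  have h7 : h * G ^ 2 = G ^ ((1 + α) / α) / L ^ (1 / α) := by
    rw [hh, Real.div_rpow (by positivity) hL.le, ← Real.rpow_mul h0.le, div_mul_eq_mul_div,
      ← Real.rpow_natCast G 2, ← Real.rpow_add h0]
    congr 2
    push_cast
    field_simp
    ring
  rw [h3, h4, div_mul_eq_mul_div, h6] at h1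
  have h8 : h * G ^ 2 * (α / (1 + α)) ≤ gap F x := by
    have : h * G ^ 2 * (α / (1 + α)) = h * G ^ 2 - h * G ^ 2 / (1 + α) := by field_simp; ring
    unfold gap
    linarith
  rw [h7] at h8
  calc G ^ ((1 + α) / α)
      = (1 + α) * L ^ (1 / α) / α * (G ^ ((1 + α) / α) / L ^ (1 / α) * (α / (1 + α))) := by
        field_simp
    _ ≤ _ := by gcongr

/-- As `α ≤ 1`, the exponent `(1 + α) / α` is at least `2`; the added `1` takes care of small
gradients. It makes integrability of the gap enough for square integrability of the gradient. -/
theorem exists_gradient_sq_le (hF : HolderSmooth F L α) :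
    ∃ A : ℝ, 0 < A ∧ ∀ x, ‖gradient F x‖ ^ 2 ≤ A * (gap F x + 1) := by
  have hα := hF.α_pos
  have hL := hF.L_pos
  refine ⟨(1 + α) * L ^ (1 / α) / α + 1, by positivity, fun x => ?_⟩
  have h1 := gradient_rpow_le_gap hF x
  have h2 := gap_nonneg hF x
  have h3 : ‖gradient F x‖ ^ 2 ≤ 1 + ‖gradient F x‖ ^ ((1 + α) / α) := by
    rcases le_total ‖gradient F x‖ 1 with h | h
    · have : ‖gradient F x‖ ^ 2 ≤ 1 := pow_le_one₀ (norm_nonneg _) h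
      have : 0 ≤ ‖gradient F x‖ ^ ((1 + α) / α) := by positivity
      linarith
    · have : ‖gradient F x‖ ^ (2 : ℝ) ≤ ‖gradient F x‖ ^ ((1 + α) / α) := by
        apply Real.rpow_le_rpow_of_exponent_le h
        rw [le_div_iff₀ hα]
        linarith [hF.α_le_one]
      rw [Real.rpow_two] at this
      linarith
  have : 0 < (1 + α) * L ^ (1 / α) / α := by positivity
  nlinarith

theorem rpow_one_add_le_one_add_sq {α t : ℝ} (hα : α ≤ 1) (ht : 0 ≤ t) (hα0 : 0 < α) :
    t ^ (1 + α) ≤ 1 + t ^ 2 := by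
  rcases le_total t 1 with h | h
  · have : t ^ (1 + α) ≤ 1 := Real.rpow_le_one ht h (by linarith)
    nlinarith
  · have : t ^ (1 + α) ≤ t ^ (2 : ℝ) := Real.rpow_le_rpow_of_exponent_le h (by linarith)
    rw [Real.rpow_two] at this
    linarith

theorem exists_gap_le_one_add_sq (hF : HolderSmooth F L α) :
    ∃ A : ℝ, ∀ x, gap F x ≤ A * (1 + ‖x‖ ^ 2) := by
  have hα := hF.α_pos
  have hL := hF.L_pos
  refine ⟨gap F 0 + ‖gradient F 0‖ + L / (1 + α), fun x => ?_⟩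
  have h1 := descent_le hF 0 x
  have h2 := real_inner_le_norm (gradient F 0) (x - 0)
  rw [sub_zero] at h1 h2
  have h3 := rpow_one_add_le_one_add_sq hF.α_le_one (norm_nonneg x) hα
  have h4 : ‖x‖ ≤ 1 + ‖x‖ ^ 2 := by nlinarith [sq_nonneg (‖x‖ - 1)]
  have h5 : L / (1 + α) * ‖x‖ ^ (1 + α) ≤ L / (1 + α) * (1 + ‖x‖ ^ 2) := by gcongr
  have h6 : ‖gradient F 0‖ * ‖x‖ ≤ ‖gradient F 0‖ * (1 + ‖x‖ ^ 2) := by gcongr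
  have h7 := mul_nonneg (gap_nonneg hF 0) (sq_nonneg ‖x‖)
  unfold gap at *
  nlinarith

theorem isCompact_sublevel (hF : HolderSmooth F L α) (hc : Coercive F) (l : ℝ) :
    IsCompact (sublevel F l) := by
  have h := hc.eventually (eventually_gt_atTop l)
  obtain ⟨t, ht, hsub⟩ := mem_cocompact.1 h
  refine ht.of_isClosed_subset (isClosed_le hF.differentiable.continuous continuous_const) ?_
  intro x hx
  by_contra hxt
  have h2 : l < F x := hsub hxt
  exact absurd hx (not_le.2 h2)

theorem exists_isMin (hF : HolderSmooth F L α) (hc : Coercive F) :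
    ∃ x, gradient F x = 0 ∧ F x = ⨅ y, F y := by
  obtain ⟨x, hx⟩ := hF.differentiable.continuous.exists_forall_le hc
  refine ⟨x, ?_, le_antisymm (le_ciInf hx) (ciInf_le hF.bddBelow x)⟩
  have h1 : IsLocalMin F x := Eventually.of_forall hx
  have h2 := h1.fderiv_eq_zero
  simp [gradient, h2]

theorem SGD.LojasiewiczOn.mono_set {K K' : Set (EuclideanSpace ℝ (Fin m))} {β ζ : ℝ}
    (h : LojasiewiczOn F K β ζ) (hK : K' ⊆ K) : LojasiewiczOn F K' β ζ :=
  fun x hx => h x (hK hx)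

/-- Raising the exponent leaves a spare factor `|F y - F x|^(β' - β)`, which is as small as desired
near `x` by continuity. Hence any strictly larger exponent comes with any positive constant, on a
smaller neighbourhood. -/
theorem exists_nhd_lojasiewicz_of_lt (hcont : Continuous F) {V : Set (EuclideanSpace ℝ (Fin m))}
    {x : EuclideanSpace ℝ (Fin m)} {β ζ β' ζ' : ℝ} (hV : IsOpen V) (hx : x ∈ V) (hζ : 0 < ζ)
    (h : ∀ y ∈ V, |F y - F x| ^ β ≤ ζ * ‖gradient F y‖) (hβ : 0 < β) (hβ' : β < β')
    (hζ' : 0 < ζ') :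
    ∃ V : Set (EuclideanSpace ℝ (Fin m)), IsOpen V ∧ x ∈ V ∧
      ∀ y ∈ V, |F y - F x| ^ β' ≤ ζ' * ‖gradient F y‖ := by
  have hc : Continuous fun y => |F y - F x| ^ (β' - β) :=
    (hcont.sub continuous_const).abs.rpow_const fun _ => Or.inr (by linarith)
  refine ⟨V ∩ {y | |F y - F x| ^ (β' - β) < ζ' / ζ},
    hV.inter (isOpen_lt hc continuous_const), ⟨hx, ?_⟩, ?_⟩
  · simp only [sub_self, abs_zero, Set.mem_ofPred_eq]
    rw [Real.zero_rpow (by linarith)]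
    positivity
  · rintro y ⟨hy, hy2⟩
    have h1 : |F y - F x| ^ β' = |F y - F x| ^ (β' - β) * |F y - F x| ^ β := by
      rw [← Real.rpow_add_of_nonneg (abs_nonneg _) (by linarith) hβ.le]
      congr 1; ring
    rw [h1]
    calc |F y - F x| ^ (β' - β) * |F y - F x| ^ β
        ≤ ζ' / ζ * (ζ * ‖gradient F y‖) :=
          mul_le_mul (le_of_lt hy2) (h y hy) (by positivity) (by positivity)
      _ = ζ' * ‖gradient F y‖ := by field_simp

theorem SGD.LojasiewiczOn.of_lt (hcont : Continuous F) {K : Set (EuclideanSpace ℝ (Fin m))}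
    {β ζ β' ζ' : ℝ} (h : LojasiewiczOn F K β ζ) (hβ : 0 < β) (hζ : 0 < ζ) (hβ' : β < β')
    (hζ' : 0 < ζ') : LojasiewiczOn F K β' ζ' := by
  intro x hxK hx
  obtain ⟨V, hV, hxV, hVle⟩ := h x hxK hx
  exact exists_nhd_lojasiewicz_of_lt hcont hV hxV hζ hVle hβ hβ' hζ'

theorem lojasiewiczOn_univ_one (hcont : Continuous F) (h : Lojasiewicz F) :
    LojasiewiczOn F Set.univ 1 1 := by
  intro x _ hx
  obtain ⟨V, hV, hxV, β, ζ, hβ, hβ1, hζ, hVle⟩ := h.2 x hx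
  exact exists_nhd_lojasiewicz_of_lt hcont hV hxV hζ hVle hβ hβ1 one_pos

/-- `F` is constant on the critical points within reach of one Łojasiewicz inequality. This is what
makes exponents transferable between neighbouring critical points and critical values isolated. -/
theorem value_eq_of_lojasiewicz {x y : EuclideanSpace ℝ (Fin m)} {β ζ : ℝ} (hβ : 0 < β)
    (h : |F y - F x| ^ β ≤ ζ * ‖gradient F y‖) (hy : gradient F y = 0) : F y = F x := by
  rw [hy, norm_zero, mul_zero] at h
  have h1 : |F y - F x| ^ β = 0 := le_antisymm h (by positivity)
  rw [Real.rpow_eq_zero (abs_nonneg _) hβ.ne', abs_eq_zero, sub_eq_zero] at h1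
  exact h1

/-- On a compact set the exponents and constants of the Łojasiewicz inequalities can be chosen
uniformly. -/
theorem exists_lojasiewiczOn_of_isCompact (hF : HolderSmooth F L α) (h : Lojasiewicz F)
    {K : Set (EuclideanSpace ℝ (Fin m))} (hK : IsCompact K) :
    ∃ β : ℝ, 0 < β ∧ β < 1 ∧ LojasiewiczOn F K β 1 := by
  have hcont := hF.differentiable.continuous
  have hS : IsCompact (K ∩ {x | gradient F x = 0}) :=
    hK.inter_right (isClosed_eq (continuous_gradient_of_holder hF) continuous_const)
  have key : ∀ x ∈ K ∩ {x | gradient F x = 0}, ∃ V ∈ 𝓝 x, IsOpen V ∧ ∃ β : ℝ, 0 < β ∧ β < 1 ∧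
      ∀ y ∈ V, |F y - F x| ^ β ≤ 1 * ‖gradient F y‖ := by
    rintro x ⟨_, hx⟩
    obtain ⟨V, hV, hxV, β, ζ, hβ, hβ1, hζ, hVle⟩ := h.2 x hx
    obtain ⟨W, hW, hxW, hWle⟩ := exists_nhd_lojasiewicz_of_lt (β' := (β + 1) / 2) hcont hV hxV hζ
      hVle hβ (by linarith) one_pos
    exact ⟨W, hW.mem_nhds hxW, hW, (β + 1) / 2, by linarith, by linarith, hWle⟩
  choose! V hVn hVo β hβ hβ1 hVle using key
  obtain ⟨t, htS, ht⟩ := hS.elim_nhds_subcover V hVn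
  -- `B` lies strictly above the finitely many exponents of the subcover, so that
  -- `exists_nhd_lojasiewicz_of_lt` can bring all of them to `B`.
  obtain ⟨B, hB0, hB1, hBt⟩ : ∃ B : ℝ, 0 < B ∧ B < 1 ∧ ∀ x ∈ t, β x < B := by
    rcases t.eq_empty_or_nonempty with rfl | hne
    · exact ⟨1 / 2, by norm_num, by norm_num, by simp⟩
    · obtain ⟨z, hz, hmax⟩ := t.exists_max_image β hne
      refine ⟨(β z + 1) / 2, ?_, ?_, fun x hx => ?_⟩
      · linarith [hβ z (htS z hz)]
      · linarith [hβ1 z (htS z hz)]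
      · linarith [hmax x hx, hβ1 z (htS z hz)]
  refine ⟨B, hB0, hB1, fun x hxK hx => ?_⟩
  obtain ⟨z, hzt, hxz⟩ := Set.mem_iUnion₂.1 (ht ⟨hxK, hx⟩)
  -- The inequality at the centre `z` is also one at the critical point `x`, since both points have
  -- the same value.
  have hFx : F x = F z := value_eq_of_lojasiewicz (hβ z (htS z hzt)) (hVle z (htS z hzt) x hxz) hx
  refine exists_nhd_lojasiewicz_of_lt hcont (hVo z (htS z hzt)) hxz one_pos ?_ (hβ z (htS z hzt))
    (hBt z hzt) one_pos
  rw [hFx]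
  exact hVle z (htS z hzt)

/-- A Łojasiewicz function has finitely many critical values on a compact set. -/
theorem finite_critical_values {β ζ : ℝ} (hF : HolderSmooth F L α)
    {K : Set (EuclideanSpace ℝ (Fin m))} (hK : IsCompact K) (hβ : 0 < β)
    (h : LojasiewiczOn F K β ζ) : (F '' (K ∩ {x | gradient F x = 0})).Finite := by
  have hS : IsCompact (K ∩ {x | gradient F x = 0}) :=
    hK.inter_right (isClosed_eq (continuous_gradient_of_holder hF) continuous_const)
  have key : ∀ x ∈ K ∩ {x | gradient F x = 0}, ∃ V ∈ 𝓝 x,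
      ∀ y ∈ V, |F y - F x| ^ β ≤ ζ * ‖gradient F y‖ := by
    rintro x ⟨hxK, hx⟩
    obtain ⟨V, hV, hxV, hVle⟩ := h x hxK hx
    exact ⟨V, hV.mem_nhds hxV, hVle⟩
  choose! V hVn hVle using key
  obtain ⟨t, htS, ht⟩ := hS.elim_nhds_subcover V hVn
  refine (t.finite_toSet.image F).subset ?_
  rintro _ ⟨x, hx, rfl⟩
  obtain ⟨z, hzt, hxz⟩ := Set.mem_iUnion₂.1 (ht hx)
  exact ⟨z, hzt, (value_eq_of_lojasiewicz hβ (hVle z (htS z hzt) x hxz) hx.2).symm⟩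

/-- Around the critical points at level `v`, the Łojasiewicz inequality holds on a bounded open
set. -/
theorem exists_isOpen_lojasiewicz (hF : HolderSmooth F L α) (hc : Coercive F) {l v β ζ : ℝ}
    (hv : v ≤ l) (h : LojasiewiczOn F (sublevel F l) β ζ) :
    ∃ U : Set (EuclideanSpace ℝ (Fin m)), IsOpen U ∧ Bornology.IsBounded U ∧
      (∀ x, gradient F x = 0 → F x = v → x ∈ U) ∧
      ∀ y ∈ U, |F y - v| ^ β ≤ ζ * ‖gradient F y‖ := by
  have key : ∀ x, gradient F x = 0 ∧ F x = v → ∃ V : Set (EuclideanSpace ℝ (Fin m)),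
      IsOpen V ∧ x ∈ V ∧ ∀ y ∈ V, |F y - F x| ^ β ≤ ζ * ‖gradient F y‖ :=
    fun x hx => h x (by simpa [sublevel, hx.2] using hv) hx.1
  choose! V hVo hxV hVle using key
  have hcont := hF.differentiable.continuous
  -- Cutting with a strict sublevel set keeps the union open and makes it bounded, by coercivity.
  refine ⟨(⋃ x ∈ {x | gradient F x = 0 ∧ F x = v}, V x) ∩ {y | F y < v + 1},
    (isOpen_biUnion hVo).inter (isOpen_lt hcont continuous_const), ?_, ?_, ?_⟩
  · refine (isCompact_sublevel hF hc (v + 1)).isBounded.subset ?_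
    rintro y ⟨_, hy⟩
    exact le_of_lt (show F y < v + 1 from hy)
  · intro x hx hxv
    exact ⟨Set.mem_iUnion₂.2 ⟨x, ⟨hx, hxv⟩, hxV x ⟨hx, hxv⟩⟩, by simp [hxv]⟩
  · rintro y ⟨hy, _⟩
    obtain ⟨x, hx, hyx⟩ := Set.mem_iUnion₂.1 hy
    have := hVle x hx y hyx
    rwa [hx.2] at this

theorem SGD.GloballyLojasiewicz.value_eq_iInf (hF : HolderSmooth F L α) (hc : Coercive F)
    (h : GloballyLojasiewicz F) {x : EuclideanSpace ℝ (Fin m)} (hx : gradient F x = 0) :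
    F x = ⨅ y, F y := by
  obtain ⟨z, hz, hzmin⟩ := exists_isMin hF hc
  obtain ⟨β, ζ, hβ, _, _, hle⟩ := h.2 z hz
  rw [← hzmin]
  exact value_eq_of_lojasiewicz hβ (hle x) hx

/-- The gap is at most a power of `ζ` when the exponent exceeds `α / (1 + α)`. -/
theorem SGD.LojasiewiczInf.gap_rpow_le (hF : HolderSmooth F L α) {β ζ : ℝ} (hζ : 0 < ζ)
    (h : LojasiewiczInf F β ζ) (x : EuclideanSpace ℝ (Fin m)) :
    gap F x ^ (β * ((1 + α) / α)) ≤
      ζ ^ ((1 + α) / α) * ((1 + α) * L ^ (1 / α) / α) * gap F x := by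
  have hα := hF.α_pos
  have hg := gap_nonneg hF x
  rw [Real.rpow_mul hg, mul_assoc]
  calc (gap F x ^ β) ^ ((1 + α) / α) ≤ (ζ * ‖gradient F x‖) ^ ((1 + α) / α) := by
        apply Real.rpow_le_rpow (by positivity) (h x) (by positivity)
    _ = ζ ^ ((1 + α) / α) * ‖gradient F x‖ ^ ((1 + α) / α) :=
        Real.mul_rpow hζ.le (norm_nonneg _)
    _ ≤ _ := by
        gcongr
        exact gradient_rpow_le_gap hF x

/-- Intermediate values between the minimum and infinity. A positive dimension is needed for points
going to infinity to exist. -/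
theorem exists_gap_eq (hm : 1 ≤ m) (hF : HolderSmooth F L α) (hc : Coercive F) {s : ℝ}
    (hs : 0 ≤ s) : ∃ x, gap F x = s := by
  obtain ⟨z, _, hz⟩ := exists_isMin hF hc
  have : Nonempty (Fin m) := ⟨⟨0, hm⟩⟩
  have : (cocompact (EuclideanSpace ℝ (Fin m))).NeBot := inferInstance
  obtain ⟨y, hy⟩ := (hc.eventually (eventually_ge_atTop (s + ⨅ y, F y))).exists
  have hcont : Continuous (gap F) := hF.differentiable.continuous.sub continuous_const
  have := mem_range_of_exists_le_of_exists_ge hcont ⟨z, (by unfold gap; linarith : gap F z ≤ s)⟩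
    ⟨y, (by unfold gap; linarith : s ≤ gap F y)⟩
  exact this

/-- A globally Łojasiewicz function satisfies a Łojasiewicz inequality relative to its infimum,
and its exponent is at least `α / (1 + α)`. -/
theorem SGD.GloballyLojasiewicz.exists_lojasiewiczInf (hm : 1 ≤ m) (hF : HolderSmooth F L α)
    (hc : Coercive F) (h : GloballyLojasiewicz F) :
    ∃ β ζ : ℝ, α / (1 + α) ≤ β ∧ β < 1 ∧ 0 < ζ ∧ LojasiewiczInf F β ζ := by
  have hα := hF.α_pos
  have hL := hF.L_pos
  obtain ⟨z, hz, hzmin⟩ := exists_isMin hF hc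
  obtain ⟨β, ζ, hβ, hβ1, hζ, hle⟩ := h.2 z hz
  have hinf : LojasiewiczInf F β ζ := by
    intro x
    have := hle x
    rwa [hzmin, abs_of_nonneg (sub_nonneg.2 (ciInf_le hF.bddBelow x))] at this
  refine ⟨β, ζ, ?_, hβ1, hζ, hinf⟩
  by_contra! hlt
  have hq : β * ((1 + α) / α) < 1 := by
    rw [lt_div_iff₀ (by positivity)] at hlt
    rw [← mul_div_assoc, div_lt_one hα]
    exact hlt
  set A := ζ ^ ((1 + α) / α) * ((1 + α) * L ^ (1 / α) / α) with hA
  have hApos : 0 < A := by positivity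
  set q := β * ((1 + α) / α) with hqdef
  -- If the exponent were too small, every gap `s` would satisfy `s^q ≤ A s` with `q < 1`. The value
  -- chosen here has `A s^(1-q) = 1/2`, which contradicts this.
  obtain ⟨x, hx⟩ := exists_gap_eq hm hF hc
    (s := (1 / (2 * A)) ^ (1 / (1 - q))) (by positivity)
  have h1 := hinf.gap_rpow_le hF hζ x
  set s := gap F x with hs
  have hspos : 0 < s := by rw [hx]; positivity
  have h2 : s ^ (1 - q) = 1 / (2 * A) := by
    rw [hx, ← Real.rpow_mul (by positivity), one_div_mul_cancel (by linarith), Real.rpow_one]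
  have h3 : s = s ^ q * s ^ (1 - q) := by
    rw [← Real.rpow_add hspos]; simp
  have h4 : 0 < s ^ q := by positivity
  have h5 : A * s = s ^ q / 2 := by
    conv_lhs => rw [h3, h2]
    field_simp
  rw [← hA, h5] at h1
  linarith

/-- For exponents in `(α / (1 + α), 1 / 2)`, the Łojasiewicz inequality relative to the infimum
improves to the exponent `1 / 2`. -/
theorem SGD.LojasiewiczInf.gap_le_of_lt_half (hF : HolderSmooth F L α) {β ζ : ℝ}
    (hβ : α / (1 + α) < β) (hβ2 : β < 1 / 2) (hζ : 0 < ζ) (h : LojasiewiczInf F β ζ)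
    (x : EuclideanSpace ℝ (Fin m)) :
    gap F x ≤ ζ ^ (2 + globalLambda α β * ((1 + α) / α)) *
      ((1 + α) * L ^ (1 / α) / α) ^ globalLambda α β * ‖gradient F x‖ ^ 2 := by
  have hα := hF.α_pos
  have hL := hF.L_pos
  have hβ0 : 0 < β := lt_trans (by positivity) hβ
  rcases (gap_nonneg hF x).eq_or_lt with h0 | h0
  · rw [← h0]; positivity
  set s := gap F x with hs
  have hq : 0 < (1 + α) / α * β - 1 := by
    rw [div_lt_iff₀ (by positivity)] at hβ
    rw [sub_pos, div_mul_eq_mul_div, lt_div_iff₀ hα]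
    linarith
  set q := (1 + α) / α * β - 1 with hqdef
  have hlam : globalLambda α β = (1 - 2 * β) / q := by
    rw [globalLambda, if_pos hβ2]
  set lam := globalLambda α β with hlamdef
  have hlam0 : 0 ≤ lam := by
    rw [hlam]; apply div_nonneg <;> linarith
  set K := (1 + α) * L ^ (1 / α) / α with hK
  have hKpos : 0 < K := by positivity
  -- Dividing the inequality of `gap_rpow_le` by `s` bounds a positive power of the gap. Its power
  -- `λ` bounds the missing factor `s^(1 - 2β)` by a constant.
  have h1 : s ^ q ≤ ζ ^ ((1 + α) / α) * K := by
    have h2 := h.gap_rpow_le hF hζ x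
    have h3 : s ^ (β * ((1 + α) / α)) = s ^ q * s := by
      rw [hqdef, mul_comm β, Real.rpow_sub h0, Real.rpow_one]
      field_simp
    rw [← hs, h3] at h2
    exact le_of_mul_le_mul_right h2 h0
  have h4 : s ^ (1 - 2 * β) ≤ ζ ^ (lam * ((1 + α) / α)) * K ^ lam := by
    have h5 : s ^ (1 - 2 * β) = (s ^ q) ^ lam := by
      rw [← Real.rpow_mul h0.le, hlam]
      congr 1; field_simp
    rw [h5, mul_comm lam, Real.rpow_mul hζ.le, ← Real.mul_rpow (by positivity) hKpos.le]
    exact Real.rpow_le_rpow (by positivity) h1 hlam0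
  have h6 : s ^ (2 * β) ≤ ζ ^ 2 * ‖gradient F x‖ ^ 2 := by
    have h7 : s ^ (2 * β) = (s ^ β) ^ 2 := by
      rw [← Real.rpow_natCast, ← Real.rpow_mul h0.le]; congr 1; push_cast; ring
    rw [h7, ← mul_pow]
    exact pow_le_pow_left₀ (by positivity) (h x) 2
  calc s = s ^ (1 - 2 * β) * s ^ (2 * β) := by
        rw [← Real.rpow_add h0]; simp
    _ ≤ (ζ ^ (lam * ((1 + α) / α)) * K ^ lam) * (ζ ^ 2 * ‖gradient F x‖ ^ 2) := by gcongr
    _ = _ := by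
        rw [Real.rpow_add hζ, Real.rpow_two]; ring

end Landscape

/-! ### Learning rates -/

section Rates

variable {γ : ℕ → ℝ} {α : ℝ}

theorem partialSum_succ (γ : ℕ → ℝ) (n : ℕ) :
    partialSum γ (n + 1) = partialSum γ n + γ (n + 1) :=
  Finset.sum_Icc_succ_top (by omega) γ

theorem SGD.StepSizes.monotone_partialSum (hγ : StepSizes γ α) : Monotone (partialSum γ) :=
  monotone_nat_of_le_succ fun n => by
    rw [partialSum_succ]; linarith [hγ.pos (n + 1) (by omega)]

theorem SGD.StepSizes.partialSum_pos (hγ : StepSizes γ α) (n : ℕ) : 0 < partialSum γ (n + 1) := by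
  have h1 : partialSum γ 0 = 0 := by simp [partialSum]
  have h2 := hγ.monotone_partialSum (Nat.zero_le n)
  rw [partialSum_succ]
  linarith [hγ.pos (n + 1) (by omega)]

theorem SGD.StepSizes.tendsto_zero (hγ : StepSizes γ α) (hα : 0 < α) :
    Tendsto γ atTop (𝓝 0) := by
  rw [← tendsto_add_atTop_iff_nat 1]
  have h := (hγ.summable.tendsto_atTop_zero).rpow_const (p := 1 / (1 + α))
    (Or.inr (by positivity))
  rw [Real.zero_rpow (by positivity)] at h
  refine h.congr fun n => ?_
  rw [← Real.rpow_mul (hγ.pos _ (by omega)).le, mul_one_div_cancel (by positivity), Real.rpow_one]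

theorem SGD.StepSizes.rateInv_spec (hγ : StepSizes γ α) (hα : 0 < α) {t : ℝ} (ht : 0 < t) :
    1 ≤ rateInv γ t ∧ γ (rateInv γ t) ≤ t := by
  have h := ((hγ.tendsto_zero hα).eventually (eventually_le_nhds ht)).and (eventually_ge_atTop 1)
  obtain ⟨n, h1, h2⟩ := h.exists
  exact Nat.sInf_mem (s := {n : ℕ | 1 ≤ n ∧ γ n ≤ t}) ⟨n, h2, h1⟩

theorem SGD.StepSizes.sumInv_spec (hγ : StepSizes γ α) (t : ℝ) :
    1 ≤ sumInv γ t ∧ t ≤ partialSum γ (sumInv γ t + 1) := by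
  have h := (((tendsto_add_atTop_iff_nat 1).2 hγ.diverges).eventually
    (eventually_ge_atTop t)).and (eventually_ge_atTop 1)
  obtain ⟨n, h1, h2⟩ := h.exists
  exact Nat.sInf_mem (s := {n : ℕ | 1 ≤ n ∧ t ≤ partialSum γ (n + 1)}) ⟨n, h2, h1⟩

theorem SGD.StepSizes.le_partialSum_of_sumInv_le (hγ : StepSizes γ α) {t : ℝ} {n : ℕ}
    (hn : sumInv γ t ≤ n) : t ≤ partialSum γ (n + 1) :=
  (hγ.sumInv_spec t).2.trans (hγ.monotone_partialSum (by omega))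

theorem SGD.StepSizes.rateCount_spec (hγ : StepSizes γ α) (hα : 0 < α) {t : ℝ} (ht : 0 < t)
    {n : ℕ} (hn : RateCount γ t n) : 1 ≤ n ∧ γ n ≤ t := by
  obtain ⟨h1, h2⟩ := hγ.rateInv_spec hα ht
  rcases hn with rfl | ⟨hanti, hn⟩
  · exact ⟨h1, h2⟩
  · exact ⟨h1.trans hn, (hanti h1 (h1.trans hn) hn).trans h2⟩

/-- Both regimes are reduced to one inequality: per step, the rates shrink by at most a factor `exp
(-τ γ_{n+1})`. The margin `τ B < κ` is what lets the contraction of the recursion beat the decay of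
the rates. -/
theorem exists_decay_rate (hγ : StepSizes γ α) {ρ κ B : ℝ} (hr : RefinedStepSizes γ α ρ)
    (hκ : 0 < κ) (hB : 0 ≤ B) (hcrit : CriticalCondition γ κ B) :
    ∃ τ : ℝ, 0 < τ ∧ τ * B < κ ∧ ∀ᶠ n : ℕ in atTop, γ n ≤ Real.exp (τ * γ (n + 1)) * γ (n + 1) := by
  have key : ∀ τ : ℝ, (∀ᶠ n : ℕ in atTop, Real.log (γ n / γ (n + 1)) ≤ τ * γ (n + 1)) →
      ∀ᶠ n : ℕ in atTop, γ n ≤ Real.exp (τ * γ (n + 1)) * γ (n + 1) := by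
    intro τ h
    filter_upwards [h, eventually_ge_atTop 1] with n hn h1
    have hp := hγ.pos n h1
    have hp' := hγ.pos (n + 1) (by omega)
    rwa [Real.log_le_iff_le_exp (by positivity), div_le_iff₀ hp'] at hn
  rcases hr.decay with h | ⟨γs, hγs, h⟩
  · refine ⟨κ / (2 * (B + 1)), by positivity, ?_, key _ ?_⟩
    · rw [div_mul_eq_mul_div, div_lt_iff₀ (by positivity)]
      nlinarith
    · filter_upwards [h.def (by positivity : 0 < κ / (2 * (B + 1)))] with n hn
      rw [Real.norm_of_nonneg (hγ.pos (n + 1) (by omega)).le] at hn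
      exact (Real.le_norm_self _).trans hn
  · have hlt := hcrit γs hγs h
    -- In the critical regime `τ` must exceed `1 / γs`; this `η` is small enough to keep `(1 + η) B
    -- < κ γs`.
    set η := (κ * γs - B) / (2 * (B + 1)) with hη
    have hη0 : 0 < η := by
      apply div_pos <;> linarith
    refine ⟨(1 + η) / γs, by positivity, ?_, key _ ?_⟩
    · rw [div_mul_eq_mul_div, div_lt_iff₀ hγs]
      have : η * B < κ * γs - B := by
        rw [hη, div_mul_eq_mul_div, div_lt_iff₀ (by positivity)]
        nlinarith
      linarith
    · filter_upwards [h.isLittleO.def hη0] with n hn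
      have hp' := hγ.pos (n + 1) (by omega)
      rw [Real.norm_of_nonneg (by positivity : 0 ≤ γ (n + 1) / γs)] at hn
      have := (Real.le_norm_self _).trans hn
      simp only [Pi.sub_apply] at this
      calc _ ≤ γ (n + 1) / γs + η * (γ (n + 1) / γs) := by linarith
        _ = (1 + η) / γs * γ (n + 1) := by ring

/-! ### Recursive inequalities -/

/-- The bound `z ≤ C u` propagates. Passing from `u n` to `u (n + 1)` costs `exp (s a)`, the
contraction gains `1 - a`, and since `s < 1` a fraction `(1 - s) a / 2` of `C u` remains to absorb
the source. The source may be measured with `u n` or `u (n + 1)`, as either index occurs in the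
applications. -/
theorem eventually_le_of_recursion {z u a : ℕ → ℝ} {s K : ℝ} (hs0 : 0 ≤ s) (hs : s < 1)
    (hK : 0 ≤ K) (hu : ∀ᶠ n in atTop, 0 < u n) (ha : ∀ᶠ n in atTop, 0 ≤ a n ∧ a n ≤ 1)
    (hua : ∀ᶠ n in atTop, u n ≤ Real.exp (s * a n) * u (n + 1))
    (hz : ∀ᶠ n in atTop, z (n + 1) ≤ (1 - a n) * z n + K * a n * (u n + u (n + 1))) :
    ∃ C : ℝ, 0 < C ∧ ∀ᶠ n in atTop, z n ≤ C * u n := by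
  obtain ⟨N, hN⟩ := eventually_atTop.1 (hu.and (ha.and (hua.and hz)))
  -- The first part starts the induction. For the second, `exp (s a) ≤ 3` gives `u n + u (n + 1) ≤ 4
  -- u (n + 1)`, so the source `4 K a u (n + 1)` must fit into `C (1 - s) a u (n + 1) / 2`.
  set C := max (max 1 (z N / u N)) (8 * K / (1 - s)) with hC
  have hC0 : 0 < C := lt_of_lt_of_le one_pos ((le_max_left _ _).trans (le_max_left _ _))
  have hC1 : z N / u N ≤ C := (le_max_right _ _).trans (le_max_left _ _)
  have hC2 : 8 * K ≤ C * (1 - s) := by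
    rw [← div_le_iff₀ (by linarith)]; exact le_max_right _ _
  refine ⟨C, hC0, eventually_atTop.2 ⟨N, fun n hn => ?_⟩⟩
  induction n, hn using Nat.le_induction with
  | base =>
    have := (hN N le_rfl).1
    rwa [div_le_iff₀ this] at hC1
  | succ n hn ih =>
    obtain ⟨hu0, ⟨ha0, ha1⟩, hua, hz⟩ := hN n hn
    have hu1 := (hN (n + 1) (by omega)).1
    have he : Real.exp (s * a n) ≤ 3 := by
      have : Real.exp (s * a n) ≤ Real.exp 1 := Real.exp_le_exp.2 (by nlinarith)
      linarith [Real.exp_one_lt_d9]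
    have h1 : (1 - a n) * Real.exp (s * a n) ≤ 1 - (1 - s) * a n / 2 := by
      have h2 : 1 - a n ≤ Real.exp (-a n) := by linarith [Real.add_one_le_exp (-a n)]
      have hx0 : 0 ≤ (1 - s) * a n := by nlinarith
      have hx1 : (1 - s) * a n ≤ 1 := by nlinarith
      have h3 : Real.exp (-((1 - s) * a n)) ≤ 1 - (1 - s) * a n / 2 := by
        have h4 := Real.add_one_le_exp ((1 - s) * a n)
        rw [Real.exp_neg]
        rw [inv_le_iff_one_le_mul₀ (Real.exp_pos _)]
        nlinarith
      calc (1 - a n) * Real.exp (s * a n) ≤ Real.exp (-a n) * Real.exp (s * a n) := by gcongr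
        _ = Real.exp (-((1 - s) * a n)) := by rw [← Real.exp_add]; congr 1; ring
        _ ≤ _ := h3
    have h5 : (1 - a n) * z n ≤ C * (1 - (1 - s) * a n / 2) * u (n + 1) := by
      calc (1 - a n) * z n ≤ (1 - a n) * (C * (Real.exp (s * a n) * u (n + 1))) := by
            apply mul_le_mul_of_nonneg_left _ (by linarith)
            exact ih.trans (by gcongr)
        _ = C * ((1 - a n) * Real.exp (s * a n)) * u (n + 1) := by ring
        _ ≤ _ := by gcongr
    have h6 : u n ≤ 3 * u (n + 1) := hua.trans (by gcongr)
    have h7 : K * a n * (u n + u (n + 1)) ≤ K * a n * (4 * u (n + 1)) := by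
      gcongr; linarith
    have h8 : a n * u (n + 1) * (8 * K) ≤ a n * u (n + 1) * (C * (1 - s)) := by gcongr
    nlinarith

/-- The comparison with `u = γ^p` and `a = h γ_{n+1}`: the power decays at speed `p τ`, below the
contraction speed `h`. -/
theorem eventually_le_rate_rpow (hγ : StepSizes γ α) (hα : 0 < α) {z : ℕ → ℝ} {p h τ K : ℝ}
    (hp : 0 < p) (hτ : 0 < τ) (hK : 0 ≤ K) (hh : p * τ < h)
    (hdecay : ∀ᶠ n : ℕ in atTop, γ n ≤ Real.exp (τ * γ (n + 1)) * γ (n + 1))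
    (hz : ∀ᶠ n in atTop, z (n + 1) ≤
      (1 - h * γ (n + 1)) * z n + K * (γ (n + 1) * γ (n + 1) ^ p)) :
    ∃ C : ℝ, 0 < C ∧ ∀ᶠ n in atTop, z n ≤ C * γ n ^ p := by
  have hpτ : 0 < p * τ := by positivity
  have hh0 : 0 < h := by linarith
  have hsmall := ((hγ.tendsto_zero hα).comp (tendsto_add_atTop_nat 1)).eventually
    (eventually_le_nhds (by positivity : (0 : ℝ) < 1 / h))
  refine eventually_le_of_recursion (a := fun n => h * γ (n + 1)) (s := p * τ / h) (K := K / h)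
    (by positivity) ((div_lt_one hh0).2 hh) (by positivity) ?_ ?_ ?_ ?_
  · filter_upwards [eventually_ge_atTop 1] with n hn
    have := hγ.pos n hn
    positivity
  · filter_upwards [hsmall] with n hn
    have := hγ.pos (n + 1) (by omega)
    refine ⟨by positivity, ?_⟩
    simp only [Function.comp_apply] at hn
    rw [le_div_iff₀ hh0] at hn
    linarith
  · filter_upwards [hdecay, eventually_ge_atTop 1] with n hn h1
    have hp0 := hγ.pos n h1
    have hp1 := hγ.pos (n + 1) (by omega)
    calc γ n ^ p ≤ (Real.exp (τ * γ (n + 1)) * γ (n + 1)) ^ p :=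
          Real.rpow_le_rpow hp0.le hn hp.le
      _ = Real.exp (τ * γ (n + 1)) ^ p * γ (n + 1) ^ p :=
          Real.mul_rpow (Real.exp_pos _).le hp1.le
      _ = _ := by
          rw [← Real.exp_mul]
          congr 2
          field_simp
  · filter_upwards [hz, eventually_ge_atTop 1] with n hn h1
    have hp0 := hγ.pos n h1
    have hp1 := hγ.pos (n + 1) (by omega)
    refine hn.trans ?_
    have : K / h * (h * γ (n + 1)) = K * γ (n + 1) := by field_simp
    rw [this]
    have h2 : 0 ≤ K * γ (n + 1) * γ n ^ p := by positivity
    linarith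

/-- The comparison with `u = T^(-q)`, where `T` is the partial sum: `T_{n+1} / T_n ≤ exp (γ_{n+1} /
T_n)`, so `u` decays at speed `q / T`, below the contraction speed `b / T`. -/
theorem eventually_le_partialSum_rpow (hγ : StepSizes γ α) (hα : 0 < α) {z : ℕ → ℝ} {q b K : ℝ}
    (hq : 0 < q) (hK : 0 ≤ K) (hb : q < b)
    (hz : ∀ᶠ n in atTop, z (n + 1) ≤ (1 - b / partialSum γ n * γ (n + 1)) * z n +
      K * (γ (n + 1) / partialSum γ n) * (partialSum γ n ^ (-q) + partialSum γ (n + 1) ^ (-q))) :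
    ∃ C : ℝ, 0 < C ∧ ∀ᶠ n in atTop, z n ≤ C * partialSum γ n ^ (-q) := by
  have hb0 : 0 < b := by linarith
  have hsmall := ((hγ.tendsto_zero hα).comp (tendsto_add_atTop_nat 1)).eventually
    (eventually_le_nhds (by positivity : (0 : ℝ) < 1 / b))
  have hT := hγ.diverges.eventually (eventually_ge_atTop 1)
  refine eventually_le_of_recursion (a := fun n => b / partialSum γ n * γ (n + 1)) (s := q / b)
    (K := K / b) (by positivity) ((div_lt_one hb0).2 hb) (by positivity) ?_ ?_ ?_ ?_
  · filter_upwards [hT] with n hn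
    positivity
  · filter_upwards [hsmall, hT] with n hn h1
    have hp1 := hγ.pos (n + 1) (by omega)
    refine ⟨by positivity, ?_⟩
    simp only [Function.comp_apply] at hn
    rw [le_div_iff₀ hb0] at hn
    rw [div_mul_eq_mul_div, div_le_one (by linarith)]
    linarith
  · filter_upwards [hT] with n h1
    have hp1 := hγ.pos (n + 1) (by omega)
    have hT0 : 0 < partialSum γ n := by linarith
    have hT1 := hγ.partialSum_pos n
    have h2 : partialSum γ (n + 1) ≤ Real.exp (γ (n + 1) / partialSum γ n) * partialSum γ n := by
      have := Real.add_one_le_exp (γ (n + 1) / partialSum γ n)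
      calc partialSum γ (n + 1) = (γ (n + 1) / partialSum γ n + 1) * partialSum γ n := by
            rw [partialSum_succ]; field_simp; ring
        _ ≤ _ := by gcongr
    have h3 : partialSum γ (n + 1) ^ q ≤
        Real.exp (q / b * (b / partialSum γ n * γ (n + 1))) * partialSum γ n ^ q := by
      calc _ ≤ (Real.exp (γ (n + 1) / partialSum γ n) * partialSum γ n) ^ q :=
            Real.rpow_le_rpow hT1.le h2 hq.le
        _ = _ := by
            rw [Real.mul_rpow (Real.exp_pos _).le hT0.le, ← Real.exp_mul]
            congr 2
            field_simp
    rw [Real.rpow_neg hT0.le, Real.rpow_neg hT1.le, ← div_eq_mul_inv,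
      le_div_iff₀ (by positivity), inv_mul_eq_div, div_le_iff₀ (by positivity)]
    exact h3
  · filter_upwards [hz] with n hn
    refine hn.trans (le_of_eq ?_)
    congr 2
    field_simp

/-- A linear lower bound of a power, with slope `b / T`. -/
theorem exists_linear_le_rpow {Q c b q : ℝ} (hQ : 1 < Q) (hc : 0 < c) (hb : 0 < b)
    (hq : q ≤ 1 / (Q - 1)) :
    ∃ K : ℝ, 0 ≤ K ∧ ∀ T x : ℝ, 1 ≤ T → 0 ≤ x → b / T * x - K * (T⁻¹ * T ^ (-q)) ≤ c * x ^ Q := by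
  have hQ1 : 0 < Q - 1 := by linarith
  refine ⟨c * (Q - 1) * (b / (c * Q)) ^ (Q / (Q - 1)), by positivity, fun T x hT hx => ?_⟩
  have hT0 : 0 < T := by linarith
  -- The point of tangency, where the derivative `c Q s^(Q-1)` equals the slope `b / T`. Bernoulli's
  -- inequality at `x / s` says that the convex power stays above this tangent, whose intercept is
  -- of order `s^Q ≤ const T^(-1-q)` because `q ≤ 1 / (Q - 1)` and `T ≥ 1`.
  set s := (b / (c * Q) / T) ^ (1 / (Q - 1)) with hs
  have hs0 : 0 < s := by positivity
  have h1 : s ^ (Q - 1) = b / (c * Q) / T := by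
    rw [hs, ← Real.rpow_mul (by positivity), one_div_mul_cancel hQ1.ne', Real.rpow_one]
  have h2 : s ^ Q ≤ (b / (c * Q)) ^ (Q / (Q - 1)) * (T⁻¹ * T ^ (-q)) := by
    rw [hs, ← Real.rpow_mul (by positivity), one_div_mul_eq_div, div_eq_mul_inv (b / (c * Q)) T,
      Real.mul_rpow (by positivity) (by positivity), Real.inv_rpow hT0.le]
    gcongr
    rw [← Real.rpow_neg_one T, ← Real.rpow_add hT0, ← Real.rpow_neg hT0.le]
    apply Real.rpow_le_rpow_of_exponent_le hT
    have : Q / (Q - 1) = 1 + 1 / (Q - 1) := by field_simp; ring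
    linarith
  have h3 := one_add_mul_self_le_rpow_one_add (s := x / s - 1) (p := Q)
    (by have : 0 ≤ x / s := by positivity
        linarith) hQ.le
  have h4 : s ^ Q * (x / s) ^ Q = x ^ Q := by
    rw [← Real.mul_rpow hs0.le (by positivity), mul_div_cancel₀ _ hs0.ne']
  have h5 : s ^ Q = s ^ (Q - 1) * s := by
    rw [Real.rpow_sub hs0, Real.rpow_one]; field_simp
  have h6 : Q * s ^ (Q - 1) * x - (Q - 1) * s ^ Q ≤ x ^ Q := by
    rw [add_sub_cancel] at h3
    rw [← h4]
    have h7 := mul_le_mul_of_nonneg_left h3 (by positivity : 0 ≤ s ^ Q)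
    refine le_trans (le_of_eq ?_) h7
    have : s ^ Q * (x / s) = s ^ (Q - 1) * x := by rw [h5]; field_simp
    linear_combination (-Q) * this
  have h8 : c * (Q * s ^ (Q - 1) * x) = b / T * x := by
    rw [h1]; field_simp
  have h9 := mul_le_mul_of_nonneg_left h6 hc.le
  have h10 := mul_le_mul_of_nonneg_left h2 (by positivity : 0 ≤ c * (Q - 1))
  nlinarith

end Rates

/-! ### Cost -/

theorem timedRun_val_cost {m d : ℕ} (w : OpCosts)
    (g : EuclideanSpace ℝ (Fin d) → EuclideanSpace ℝ (Fin m) → EuclideanSpace ℝ (Fin m))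
    (γ : ℕ → ℝ) (x : ℕ → EuclideanSpace ℝ (Fin d)) (u : ℕ → EuclideanSpace ℝ (Fin m))
    (hu : ∀ n, u (n + 1) = u n - γ (n + 1) • g (x (n + 1)) (u n)) (n : ℕ) :
    (timedRun w g γ x (u 0) n).val = u n ∧
      (timedRun w g γ x (u 0) n).cost =
        w.init + n * (w.draw + (w.oracle + (w.rate + m * (w.arith + w.arith)))) := by
  induction n with
  | zero => simp [timedRun, Timed.op]
  | succ n ih =>
    constructor
    · simp only [timedRun, Timed.bind, timedStep, Timed.op, Timed.forCoords, ih.1, hu n]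
      ext i
      simp
    · simp only [timedRun, Timed.bind, timedStep, Timed.op, Timed.forCoords, ih.2]
      simp
      ring

theorem exists_timedRun_cost_le {m d : ℕ} (w : OpCosts)
    (g : EuclideanSpace ℝ (Fin d) → EuclideanSpace ℝ (Fin m) → EuclideanSpace ℝ (Fin m))
    (γ : ℕ → ℝ) {Ω : Type*} (x : ℕ → Ω → EuclideanSpace ℝ (Fin d))
    (u : ℕ → Ω → EuclideanSpace ℝ (Fin m))
    (hu : ∀ n ω, u (n + 1) ω = u n ω - γ (n + 1) • g (x (n + 1) ω) (u n ω)) :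
    ∃ C : ℝ, 0 < C ∧ ∀ n : ℕ, 1 ≤ n → ∀ ω,
      (timedRun w g γ (fun k => x k ω) (u 0 ω) n).val = u n ω ∧
      ((timedRun w g γ (fun k => x k ω) (u 0 ω) n).cost : ℝ) ≤ C * n := by
  refine ⟨w.init + (w.draw + (w.oracle + (w.rate + m * (w.arith + w.arith)))) + 1, by positivity,
    fun n hn ω => ?_⟩
  obtain ⟨h1, h2⟩ := timedRun_val_cost w g γ (fun k => x k ω) (fun k => u k ω)
    (fun k => hu k ω) n
  refine ⟨h1, ?_⟩
  rw [h2]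
  push_cast
  have hn' : (1 : ℝ) ≤ n := by exact_mod_cast hn
  have h3 : (w.init : ℝ) ≤ w.init * n := le_mul_of_one_le_right (by positivity) hn'
  nlinarith

/-! ### Bounds in probability -/

/-- Turns bounds on countably many pieces, each with its own constant, into one constant at
confidence `1 - δ`. By continuity of the measure, finitely many pieces still have mass above `1 -
δ`. The strict inequality leaves a surplus, which is spent on the exceptional sets of these pieces;
the constants do not depend on `n`. -/
theorem exists_withProb_of_cover {Ω ι : Type*} [MeasurableSpace Ω] {μ : Measure Ω}
    [IsProbabilityMeasure μ] [Countable ι] {E : Set Ω} {δ : ℝ} (hE : ENNReal.ofReal (1 - δ) < μ E)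
    (S : ι → Set Ω) (hS : ∀ᵐ ω ∂μ, ω ∈ E → ∃ i, ω ∈ S i) (R : ℕ → Ω → ℝ)
    (h : ∀ i, ∀ η : ENNReal, 0 < η → ∃ C : ℝ, ∀ n, μ (S i ∩ {ω | C < R n ω}) ≤ η) :
    ∃ C : ℝ, 0 < C ∧ ∀ n, WithProb μ δ fun ω => R n ω ≤ C := by
  rcases isEmpty_or_nonempty ι with hι | hι
  · exfalso
    have : μ E = 0 := by
      rw [measure_eq_zero_iff_ae_notMem]
      filter_upwards [hS] with ω hω hωE
      obtain ⟨i, _⟩ := hω hωE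
      exact hι.elim i
    rw [this] at hE
    exact not_lt_bot hE
  obtain ⟨f, hf⟩ := exists_surjective_nat ι
  set G : ℕ → Set Ω := fun J => ⋃ j ∈ Finset.range J, S (f j) with hG
  have hmono : Monotone G := fun a b hab =>
    Set.biUnion_subset_biUnion_left fun j hj => by
      simp only [SetLike.mem_coe, Finset.mem_range] at hj ⊢
      omega
  have hlim := tendsto_measure_iUnion_atTop (μ := μ) hmono
  have hlt : ENNReal.ofReal (1 - δ) < μ (⋃ J, G J) := by
    refine hE.trans_le (measure_mono_ae ?_)
    filter_upwards [hS] with ω hω hωE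
    obtain ⟨i, hi⟩ := hω hωE
    obtain ⟨j, rfl⟩ := hf i
    refine Set.mem_iUnion.2 ⟨j + 1, Set.mem_iUnion₂.2 ⟨j, by simp, hi⟩⟩
  obtain ⟨J, hJ⟩ := (hlim.eventually (lt_mem_nhds hlt)).exists
  set η := μ (G J) - ENNReal.ofReal (1 - δ) with hη
  have hη0 : 0 < η := tsub_pos_of_lt hJ
  -- The surplus is divided by `J + 1` rather than `J`, so that an empty family needs no separate
  -- treatment.
  choose C hC using fun j => h (f j) (η / (J + 1)) (ENNReal.div_pos hη0.ne' (by simp))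
  obtain ⟨M, hM⟩ := ((Finset.range J).finite_toSet.image C).bddAbove
  refine ⟨max 1 M, by positivity, fun n => ?_⟩
  have h1 : μ (G J ∩ {ω | max 1 M < R n ω}) ≤ η := by
    calc μ (G J ∩ {ω | max 1 M < R n ω})
        ≤ μ (⋃ j ∈ Finset.range J, (S (f j) ∩ {ω | C j < R n ω})) := by
          apply measure_mono
          rintro ω ⟨hω, hR⟩
          obtain ⟨j, hj, hωj⟩ := Set.mem_iUnion₂.1 hω
          refine Set.mem_iUnion₂.2 ⟨j, hj, hωj, ?_⟩
          have : C j ≤ M := hM ⟨j, hj, rfl⟩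
          exact lt_of_le_of_lt (this.trans (le_max_right _ _)) hR
      _ ≤ ∑ j ∈ Finset.range J, μ (S (f j) ∩ {ω | C j < R n ω}) :=
          measure_biUnion_finset_le _ _
      _ ≤ ∑ j ∈ Finset.range J, η / (J + 1) := Finset.sum_le_sum fun j _ => hC j n
      _ = J * (η / (J + 1)) := by simp
      _ ≤ (J + 1) * (η / (J + 1)) := by gcongr; exact le_self_add
      _ ≤ η := ENNReal.mul_div_le
  have h2 : μ (G J) ≤ μ {ω | R n ω ≤ max 1 M} + η := by
    calc μ (G J) ≤ μ ({ω | R n ω ≤ max 1 M} ∪ (G J ∩ {ω | max 1 M < R n ω})) := by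
          apply measure_mono
          intro ω hω
          rcases le_or_gt (R n ω) (max 1 M) with h | h
          · exact Or.inl h
          · exact Or.inr ⟨hω, h⟩
      _ ≤ _ := (measure_union_le _ _).trans (by gcongr)
  have h3 : ENNReal.ofReal (1 - δ) + η = μ (G J) := add_tsub_cancel_of_le hJ.le
  rw [← h3] at h2
  refine ENNReal.le_of_add_le_add_right ?_ h2
  exact ne_top_of_le_ne_top (measure_ne_top μ (G J)) tsub_le_self

set_option linter.unusedSectionVars false

/-! ### Independence of the past and the next innovation -/

section Freezing

variable {Ω : Type*} [mΩ : MeasurableSpace Ω] {μ : Measure Ω} [IsProbabilityMeasure μ]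

/-- Reassociation of the product of three laws. It serves to add the initial point to the past
innovations without losing independence from the next one. -/
theorem IndepFun.prodMk_left_of_indepFun {A B C : Type*} [MeasurableSpace A] [MeasurableSpace B]
    [MeasurableSpace C] {a : Ω → A} {b : Ω → B} {c : Ω → C} (ha : Measurable a)
    (hb : Measurable b) (hc : Measurable c) (h : IndepFun a (fun ω => (b ω, c ω)) μ)
    (hbc : IndepFun b c μ) : IndepFun (fun ω => (a ω, b ω)) c μ := by
  have : IsProbabilityMeasure (μ.map a) := Measure.isProbabilityMeasure_map ha.aemeasurable
  have : IsProbabilityMeasure (μ.map b) := Measure.isProbabilityMeasure_map hb.aemeasurable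
  have : IsProbabilityMeasure (μ.map c) := Measure.isProbabilityMeasure_map hc.aemeasurable
  have hab : IndepFun a b μ := h.comp measurable_id measurable_fst
  rw [indepFun_iff_map_prod_eq_prod_map_map (ha.prodMk hb).aemeasurable hc.aemeasurable,
    (indepFun_iff_map_prod_eq_prod_map_map ha.aemeasurable hb.aemeasurable).1 hab]
  rw [indepFun_iff_map_prod_eq_prod_map_map ha.aemeasurable (hb.prodMk hc).aemeasurable,
    (indepFun_iff_map_prod_eq_prod_map_map hb.aemeasurable hc.aemeasurable).1 hbc,
    ← Measure.prodAssoc_prod] at h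
  have h2 := congrArg (Measure.map (MeasurableEquiv.prodAssoc (α := A) (β := B) (γ := C)).symm) h
  rw [Measure.map_map (MeasurableEquiv.measurable _) (ha.prodMk (hb.prodMk hc)),
    Measure.map_map (MeasurableEquiv.measurable _) (MeasurableEquiv.measurable _)] at h2
  simpa [Function.comp_def, MeasurableEquiv.prodAssoc] using h2

theorem integrable_affine {p q r : Ω → ℝ} (hp : Integrable p μ) (hq : Integrable q μ)
    (hr : Integrable r μ) (a b : ℝ) : Integrable (fun ω => p ω - a * q ω + b * r ω) μ :=
  (hp.sub (hq.const_mul a)).add (hr.const_mul b)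

theorem integral_affine {p q r : Ω → ℝ} (hp : Integrable p μ) (hq : Integrable q μ)
    (hr : Integrable r μ) (a b : ℝ) :
    ∫ ω, (p ω - a * q ω + b * r ω) ∂μ = ∫ ω, p ω ∂μ - a * ∫ ω, q ω ∂μ + b * ∫ ω, r ω ∂μ := by
  rw [integral_add (f := fun ω => p ω - a * q ω) (hp.sub (hq.const_mul a)) (hr.const_mul b),
    integral_sub hp (hq.const_mul a), integral_const_mul, integral_const_mul]

/-- By Tonelli, the past variable can be frozen while the innovation is integrated out against its
law, here represented by a copy `y`. This replaces conditional expectations throughout. -/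
theorem lintegral_freeze {S A : Type*} [MeasurableSpace S] [MeasurableSpace A] {Z : Ω → S}
    {x y : Ω → A} (hZ : Measurable Z) (hx : Measurable x) (hy : Measurable y)
    (hind : IndepFun Z x μ) (hlaw : μ.map x = μ.map y) {h : S × A → ENNReal}
    (hh : Measurable h) :
    ∫⁻ ω, h (Z ω, x ω) ∂μ = ∫⁻ ω, ∫⁻ ω', h (Z ω, y ω') ∂μ ∂μ := by
  have : IsProbabilityMeasure (μ.map y) := Measure.isProbabilityMeasure_map hy.aemeasurable
  rw [← lintegral_map hh (hZ.prodMk hx),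
    (indepFun_iff_map_prod_eq_prod_map_map hZ.aemeasurable hx.aemeasurable).1 hind, hlaw,
    lintegral_prod _ hh.aemeasurable, lintegral_map hh.lintegral_prod_right' hZ]
  refine lintegral_congr fun ω => ?_
  rw [lintegral_map (by fun_prop) hy]

theorem integral_freeze {S A : Type*} [MeasurableSpace S] [MeasurableSpace A] {Z : Ω → S}
    {x y : Ω → A} (hZ : Measurable Z) (hx : Measurable x) (hy : Measurable y)
    (hind : IndepFun Z x μ) (hlaw : μ.map x = μ.map y) {h : S × A → ℝ}
    (hh : Measurable h) (hint : Integrable (fun ω => h (Z ω, x ω)) μ) :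
    ∫ ω, h (Z ω, x ω) ∂μ = ∫ ω, ∫ ω', h (Z ω, y ω') ∂μ ∂μ := by
  have : IsProbabilityMeasure (μ.map y) := Measure.isProbabilityMeasure_map hy.aemeasurable
  have : IsProbabilityMeasure (μ.map Z) := Measure.isProbabilityMeasure_map hZ.aemeasurable
  have hmap := (indepFun_iff_map_prod_eq_prod_map_map hZ.aemeasurable hx.aemeasurable).1 hind
  have hint2 : Integrable h (μ.map fun ω => (Z ω, x ω)) :=
    (integrable_map_measure hh.aestronglyMeasurable (hZ.prodMk hx).aemeasurable).2 hint
  rw [← integral_map (hZ.prodMk hx).aemeasurable hh.aestronglyMeasurable]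
  rw [hmap, hlaw] at hint2 ⊢
  rw [integral_prod _ hint2, integral_map hZ.aemeasurable
    hh.stronglyMeasurable.integral_prod_right'.aestronglyMeasurable]
  refine integral_congr_ae (ae_of_all _ fun ω => ?_)
  exact integral_map hy.aemeasurable (by fun_prop : Measurable _).aestronglyMeasurable

end Freezing

/-! ### The iteration, adapted to a filtration -/

/-- A run of stochastic gradient descent adapted to a filtration `ℱ`, under the standing
assumptions. -/
structure IsSGD {Ω : Type*} [mΩ : MeasurableSpace Ω] (μ : Measure Ω) (ℱ : Filtration ℕ mΩ)
    {m d : ℕ} (F : EuclideanSpace ℝ (Fin m) → ℝ) (X : Ω → EuclideanSpace ℝ (Fin d))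
    (g : EuclideanSpace ℝ (Fin d) → EuclideanSpace ℝ (Fin m) → EuclideanSpace ℝ (Fin m))
    (L α C₀ κ c : ℝ) (γ : ℕ → ℝ) (ξ : ℕ → Ω → EuclideanSpace ℝ (Fin d))
    (θ : ℕ → Ω → EuclideanSpace ℝ (Fin m)) : Prop where
  smooth : HolderSmooth F L α
  oracle : OracleBounds μ F X g C₀ κ c
  rates : StepSizes γ α
  measurable_X : Measurable X
  measurable_oracle :
    Measurable fun p : EuclideanSpace ℝ (Fin d) × EuclideanSpace ℝ (Fin m) => g p.1 p.2
  adapted : ∀ n, Measurable[ℱ n] (θ n)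
  measurable_innov : ∀ n, Measurable (ξ (n + 1))
  indep : ∀ n, Indep (ℱ n) (MeasurableSpace.comap (ξ (n + 1)) inferInstance) μ
  law : ∀ n, μ.map (ξ (n + 1)) = μ.map X
  step : ∀ n ω, θ (n + 1) ω = θ n ω - γ (n + 1) • g (ξ (n + 1) ω) (θ n ω)
  integrable_zero : Integrable (fun ω => gap F (θ 0 ω)) μ

/-- The oracle call of the `(n + 1)`-st step. -/
def noisyGrad {Ω : Type*} {m d : ℕ}
    (g : EuclideanSpace ℝ (Fin d) → EuclideanSpace ℝ (Fin m) → EuclideanSpace ℝ (Fin m))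
    (ξ : ℕ → Ω → EuclideanSpace ℝ (Fin d)) (θ : ℕ → Ω → EuclideanSpace ℝ (Fin m)) (n : ℕ)
    (ω : Ω) : EuclideanSpace ℝ (Fin m) := g (ξ (n + 1) ω) (θ n ω)

namespace IsSGD

variable {Ω : Type*} [mΩ : MeasurableSpace Ω] {μ : Measure Ω} [IsProbabilityMeasure μ]
  {ℱ : Filtration ℕ mΩ} {m d : ℕ} {F : EuclideanSpace ℝ (Fin m) → ℝ}
  {X : Ω → EuclideanSpace ℝ (Fin d)}
  {g : EuclideanSpace ℝ (Fin d) → EuclideanSpace ℝ (Fin m) → EuclideanSpace ℝ (Fin m)}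
  {L α C₀ κ c : ℝ} {γ : ℕ → ℝ} {ξ : ℕ → Ω → EuclideanSpace ℝ (Fin d)}
  {θ : ℕ → Ω → EuclideanSpace ℝ (Fin m)}

theorem measurable (S : IsSGD μ ℱ F X g L α C₀ κ c γ ξ θ) (n : ℕ) : Measurable (θ n) :=
  (S.adapted n).mono (ℱ.le n) le_rfl

theorem continuous (S : IsSGD μ ℱ F X g L α C₀ κ c γ ξ θ) : Continuous F :=
  S.smooth.differentiable.continuous

theorem measurable_gap (S : IsSGD μ ℱ F X g L α C₀ κ c γ ξ θ) : Measurable (gap F) :=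
  (S.continuous.sub continuous_const).measurable

theorem measurable_gradient (S : IsSGD μ ℱ F X g L α C₀ κ c γ ξ θ) : Measurable (gradient F) :=
  (continuous_gradient_of_holder S.smooth).measurable

theorem measurable_noisyGrad (S : IsSGD μ ℱ F X g L α C₀ κ c γ ξ θ) (n : ℕ) :
    Measurable (noisyGrad g ξ θ n) :=
  S.measurable_oracle.comp ((S.measurable_innov n).prodMk (S.measurable n))

theorem measurable_meanOracle (S : IsSGD μ ℱ F X g L α C₀ κ c γ ξ θ) :
    Measurable (meanOracle μ X g) := by
  have h : Measurable fun p : EuclideanSpace ℝ (Fin m) × Ω => g (X p.2) p.1 :=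
    S.measurable_oracle.comp ((S.measurable_X.comp measurable_snd).prodMk measurable_fst)
  exact h.stronglyMeasurable.integral_prod_right'.measurable

theorem indepFun (S : IsSGD μ ℱ F X g L α C₀ κ c γ ξ θ) {n : ℕ} {A : Type*} [MeasurableSpace A]
    {Z : Ω → A} (hZ : Measurable[ℱ n] Z) : IndepFun Z (ξ (n + 1)) μ := by
  rw [IndepFun_iff_Indep]
  exact indep_of_indep_of_le_left (S.indep n) (measurable_iff_comap_le.1 hZ)

theorem step_noisyGrad (S : IsSGD μ ℱ F X g L α C₀ κ c γ ξ θ) (n : ℕ) (ω : Ω) :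
    θ (n + 1) ω = θ n ω - γ (n + 1) • noisyGrad g ξ θ n ω := S.step n ω

/-- Stated with the Lebesgue integral since integrability of the oracle call along the iterates is
not yet known: it is deduced from this bound. -/
theorem lintegral_noisyGrad_sq (S : IsSGD μ ℱ F X g L α C₀ κ c γ ξ θ) {n : ℕ} {ψ : Ω → ℝ}
    (hψ : Measurable[ℱ n] ψ) (hψ0 : ∀ ω, 0 ≤ ψ ω) :
    ∫⁻ ω, ENNReal.ofReal (ψ ω * ‖noisyGrad g ξ θ n ω‖ ^ 2) ∂μ ≤
      ∫⁻ ω, ENNReal.ofReal (ψ ω * (C₀ * (gap F (θ n ω) + 1))) ∂μ := by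
  have hZ : Measurable[ℱ n] fun ω => (ψ ω, θ n ω) := hψ.prodMk (S.adapted n)
  have hh : Measurable fun p : (ℝ × EuclideanSpace ℝ (Fin m)) × EuclideanSpace ℝ (Fin d) =>
      ENNReal.ofReal (p.1.1 * ‖g p.2 p.1.2‖ ^ 2) := by
    have h1 : Measurable fun p : (ℝ × EuclideanSpace ℝ (Fin m)) × EuclideanSpace ℝ (Fin d) =>
        g p.2 p.1.2 :=
      S.measurable_oracle.comp (measurable_snd.prodMk (measurable_snd.comp measurable_fst))
    exact (((measurable_fst.comp measurable_fst).mul (h1.norm.pow_const 2))).ennreal_ofReal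
  have key := lintegral_freeze (hZ.mono (ℱ.le n) le_rfl) (S.measurable_innov n) S.measurable_X
    (S.indepFun hZ) (S.law n) hh
  simp only [noisyGrad]
  refine key.trans_le (lintegral_mono fun ω => ?_)
  have h2 : ∀ ω', ENNReal.ofReal (ψ ω * ‖g (X ω') (θ n ω)‖ ^ 2) =
      ENNReal.ofReal (ψ ω) * ENNReal.ofReal (‖g (X ω') (θ n ω)‖ ^ 2) :=
    fun ω' => ENNReal.ofReal_mul (hψ0 ω)
  simp only [h2]
  rw [lintegral_const_mul' _ _ ENNReal.ofReal_ne_top, ENNReal.ofReal_mul (hψ0 ω)]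
  gcongr
  have h3 := (S.oracle.memLp (θ n ω)).integrable_norm_pow (by norm_num)
  rw [← ofReal_integral_eq_lintegral_ofReal h3 (ae_of_all _ fun _ => by positivity)]
  exact ENNReal.ofReal_le_ofReal (S.oracle.second_moment (θ n ω))

theorem integrable_mul_noisyGrad_sq (S : IsSGD μ ℱ F X g L α C₀ κ c γ ξ θ) {n : ℕ} {ψ : Ω → ℝ}
    (hψ : Measurable[ℱ n] ψ) (hψ0 : ∀ ω, 0 ≤ ψ ω)
    (hint : Integrable (fun ω => ψ ω * (gap F (θ n ω) + 1)) μ) :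
    Integrable (fun ω => ψ ω * ‖noisyGrad g ξ θ n ω‖ ^ 2) μ ∧
      ∫ ω, ψ ω * ‖noisyGrad g ξ θ n ω‖ ^ 2 ∂μ ≤ C₀ * ∫ ω, ψ ω * (gap F (θ n ω) + 1) ∂μ := by
  have hC := S.oracle.C_pos
  have h1 := S.lintegral_noisyGrad_sq hψ hψ0
  have h2 : Integrable (fun ω => ψ ω * (C₀ * (gap F (θ n ω) + 1))) μ := by
    refine (hint.const_mul C₀).congr (ae_of_all _ fun ω => ?_)
    ring
  have hg : ∀ ω, 0 ≤ gap F (θ n ω) := fun ω => gap_nonneg S.smooth _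
  have hmeas : Measurable fun ω => ψ ω * ‖noisyGrad g ξ θ n ω‖ ^ 2 :=
    (hψ.mono (ℱ.le n) le_rfl).mul ((S.measurable_noisyGrad n).norm.pow_const 2)
  have hnn : ∀ ω, 0 ≤ ψ ω * ‖noisyGrad g ξ θ n ω‖ ^ 2 := fun ω => by
    have := hψ0 ω; positivity
  have hnn2 : ∀ ω, 0 ≤ ψ ω * (C₀ * (gap F (θ n ω) + 1)) := fun ω => by
    have := hψ0 ω; have := hg ω; positivity
  rw [← ofReal_integral_eq_lintegral_ofReal h2 (ae_of_all _ hnn2)] at h1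
  have h3 : Integrable (fun ω => ψ ω * ‖noisyGrad g ξ θ n ω‖ ^ 2) μ := by
    refine ⟨hmeas.aestronglyMeasurable, ?_⟩
    rw [hasFiniteIntegral_iff_ofReal (ae_of_all _ hnn)]
    exact h1.trans_lt ENNReal.ofReal_lt_top
  refine ⟨h3, ?_⟩
  rw [← ofReal_integral_eq_lintegral_ofReal h3 (ae_of_all _ hnn)] at h1
  have h4 := (ENNReal.ofReal_le_ofReal_iff (integral_nonneg hnn2)).1 h1
  refine h4.trans (le_of_eq ?_)
  rw [← integral_const_mul]
  congr 1; ext ω; ring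

theorem integral_inner_noisyGrad (S : IsSGD μ ℱ F X g L α C₀ κ c γ ξ θ) {n : ℕ}
    {v : Ω → EuclideanSpace ℝ (Fin m)} (hv : Measurable[ℱ n] v)
    (hint : Integrable (fun ω => inner ℝ (v ω) (noisyGrad g ξ θ n ω)) μ) :
    ∫ ω, inner ℝ (v ω) (noisyGrad g ξ θ n ω) ∂μ =
      ∫ ω, inner ℝ (v ω) (meanOracle μ X g (θ n ω)) ∂μ := by
  have hZ : Measurable[ℱ n] fun ω => (v ω, θ n ω) := hv.prodMk (S.adapted n)
  have hh : Measurable fun p : (EuclideanSpace ℝ (Fin m) × EuclideanSpace ℝ (Fin m)) ×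
      EuclideanSpace ℝ (Fin d) => (inner ℝ p.1.1 (g p.2 p.1.2) : ℝ) := by
    have h1 : Measurable fun p : (EuclideanSpace ℝ (Fin m) × EuclideanSpace ℝ (Fin m)) ×
        EuclideanSpace ℝ (Fin d) => g p.2 p.1.2 :=
      S.measurable_oracle.comp (measurable_snd.prodMk (measurable_snd.comp measurable_fst))
    exact (measurable_fst.comp measurable_fst).inner h1
  have key := integral_freeze (hZ.mono (ℱ.le n) le_rfl) (S.measurable_innov n) S.measurable_X
    (S.indepFun hZ) (S.law n) hh hint
  refine key.trans (integral_congr_ae (ae_of_all _ fun ω => ?_))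
  exact integral_inner ((S.oracle.memLp (θ n ω)).integrable (by norm_num)) (v ω)

/-! ### One step -/

theorem gap_step_le (S : IsSGD μ ℱ F X g L α C₀ κ c γ ξ θ) (n : ℕ) (ω : Ω) :
    gap F (θ (n + 1) ω) ≤ gap F (θ n ω)
      - γ (n + 1) * inner ℝ (gradient F (θ n ω)) (noisyGrad g ξ θ n ω)
      + L / (1 + α) * (γ (n + 1) * ‖noisyGrad g ξ θ n ω‖) ^ (1 + α) := by
  have h := descent_le S.smooth (θ n ω) (θ (n + 1) ω)
  have hγ := S.rates.pos (n + 1) (by omega)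
  have h1 : θ (n + 1) ω - θ n ω = -(γ (n + 1) • noisyGrad g ξ θ n ω) := by
    rw [S.step_noisyGrad]; abel
  rw [h1, inner_neg_right, inner_smul_right, norm_neg, norm_smul, Real.norm_of_nonneg hγ.le] at h
  unfold gap
  linarith

/-- The power `1 + α` of the oracle is traded for a square, so that only second moments are needed,
while the rate keeps the summable power `γ^(1+α)`. -/
theorem gap_step_le' (S : IsSGD μ ℱ F X g L α C₀ κ c γ ξ θ) (n : ℕ) (ω : Ω) :
    gap F (θ (n + 1) ω) ≤ gap F (θ n ω)
      - γ (n + 1) * inner ℝ (gradient F (θ n ω)) (noisyGrad g ξ θ n ω)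
      + L / (1 + α) * γ (n + 1) ^ (1 + α) * (1 + ‖noisyGrad g ξ θ n ω‖ ^ 2) := by
  have hL := S.smooth.L_pos
  have hα := S.smooth.α_pos
  have hγ := S.rates.pos (n + 1) (by omega)
  refine (S.gap_step_le n ω).trans ?_
  rw [Real.mul_rpow hγ.le (norm_nonneg _), mul_assoc]
  gcongr
  exact rpow_one_add_le_one_add_sq S.smooth.α_le_one (norm_nonneg _) hα

theorem integrable_noisyGrad_sq_of_gap (S : IsSGD μ ℱ F X g L α C₀ κ c γ ξ θ) {n : ℕ}
    (h : Integrable (fun ω => gap F (θ n ω)) μ) :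
    Integrable (fun ω => ‖noisyGrad g ξ θ n ω‖ ^ 2) μ ∧
      ∫ ω, ‖noisyGrad g ξ θ n ω‖ ^ 2 ∂μ ≤ C₀ * ∫ ω, (gap F (θ n ω) + 1) ∂μ := by
  have := S.integrable_mul_noisyGrad_sq (n := n) (ψ := fun _ => 1) measurable_const
    (fun _ => zero_le_one) (by simpa using h.add (integrable_const 1))
  simpa using this

theorem integrable_gradient_sq_of_gap (S : IsSGD μ ℱ F X g L α C₀ κ c γ ξ θ) {n : ℕ}
    (h : Integrable (fun ω => gap F (θ n ω)) μ) :
    Integrable (fun ω => ‖gradient F (θ n ω)‖ ^ 2) μ := by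
  obtain ⟨A, hA, hle⟩ := exists_gradient_sq_le S.smooth
  refine ((h.add (integrable_const 1)).const_mul A).mono'
    ((S.measurable_gradient.comp (S.measurable n)).norm.pow_const 2).aestronglyMeasurable
    (ae_of_all _ fun ω => ?_)
  rw [Real.norm_of_nonneg (by positivity)]
  exact hle _

theorem integrable_inner_noisyGrad (S : IsSGD μ ℱ F X g L α C₀ κ c γ ξ θ) {n : ℕ}
    (h : Integrable (fun ω => gap F (θ n ω)) μ) {v : Ω → EuclideanSpace ℝ (Fin m)}
    (hv : Measurable v) (hv2 : Integrable (fun ω => ‖v ω‖ ^ 2) μ) :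
    Integrable (fun ω => inner ℝ (v ω) (noisyGrad g ξ θ n ω)) μ := by
  refine (hv2.add (S.integrable_noisyGrad_sq_of_gap h).1).mono'
    (hv.inner (S.measurable_noisyGrad n)).aestronglyMeasurable (ae_of_all _ fun ω => ?_)
  have h1 := norm_inner_le_norm (𝕜 := ℝ) (v ω) (noisyGrad g ξ θ n ω)
  simp only [Pi.add_apply]
  nlinarith [sq_nonneg (‖v ω‖ - ‖noisyGrad g ξ θ n ω‖), sq_nonneg ‖v ω‖,
    sq_nonneg ‖noisyGrad g ξ θ n ω‖]

/-- A bootstrap: an integrable gap makes the oracle call and the gradient square integrable, and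
these dominate the next gap through the descent inequality. -/
theorem integrable_gap (S : IsSGD μ ℱ F X g L α C₀ κ c γ ξ θ) (n : ℕ) :
    Integrable (fun ω => gap F (θ n ω)) μ := by
  induction n with
  | zero => exact S.integrable_zero
  | succ n ih =>
    have h1 := S.integrable_inner_noisyGrad ih (S.measurable_gradient.comp (S.measurable n))
      (S.integrable_gradient_sq_of_gap ih)
    have h2 := (S.integrable_noisyGrad_sq_of_gap ih).1
    refine ((ih.sub (h1.const_mul (γ (n + 1)))).add
      (((integrable_const 1).add h2).const_mul (L / (1 + α) * γ (n + 1) ^ (1 + α)))).mono'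
      (S.measurable_gap.comp (S.measurable (n + 1))).aestronglyMeasurable (ae_of_all _ fun ω => ?_)
    rw [Real.norm_of_nonneg (gap_nonneg S.smooth _)]
    exact S.gap_step_le' n ω

theorem integrable_gradient_sq (S : IsSGD μ ℱ F X g L α C₀ κ c γ ξ θ) (n : ℕ) :
    Integrable (fun ω => ‖gradient F (θ n ω)‖ ^ 2) μ :=
  S.integrable_gradient_sq_of_gap (S.integrable_gap n)

theorem integrable_weight_mul {ψ f : Ω → ℝ} {B : ℝ} (hψ : Measurable ψ) (hψ0 : ∀ ω, 0 ≤ ψ ω)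
    (hψB : ∀ ω, ψ ω ≤ B) (hf : Integrable f μ) : Integrable (fun ω => ψ ω * f ω) μ :=
  hf.bdd_mul (c := B) hψ.aestronglyMeasurable
    (ae_of_all _ fun ω => by rw [Real.norm_of_nonneg (hψ0 ω)]; exact hψB ω)

/-- Alignment of the oracle, weighted by a bounded function of the past. -/
theorem integral_weight_inner_ge (S : IsSGD μ ℱ F X g L α C₀ κ c γ ξ θ) {n : ℕ} {ψ : Ω → ℝ}
    {B : ℝ} (hψ : Measurable[ℱ n] ψ) (hψ0 : ∀ ω, 0 ≤ ψ ω) (hψB : ∀ ω, ψ ω ≤ B) :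
    Integrable (fun ω => ψ ω * inner ℝ (gradient F (θ n ω)) (noisyGrad g ξ θ n ω)) μ ∧
    κ * ∫ ω, ψ ω * ‖gradient F (θ n ω)‖ ^ 2 ∂μ ≤
      ∫ ω, ψ ω * inner ℝ (gradient F (θ n ω)) (noisyGrad g ξ θ n ω) ∂μ := by
  have hψm := hψ.mono (ℱ.le n) le_rfl
  have hgm : Measurable fun ω => gradient F (θ n ω) := S.measurable_gradient.comp (S.measurable n)
  have hv : Measurable[ℱ n] fun ω => ψ ω • gradient F (θ n ω) :=
    hψ.smul (S.measurable_gradient.comp (S.adapted n))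
  have hi := integrable_weight_mul (μ := μ) hψm hψ0 hψB
    (S.integrable_inner_noisyGrad (S.integrable_gap n) hgm (S.integrable_gradient_sq n))
  refine ⟨hi, ?_⟩
  have hi2 : Integrable (fun ω => inner ℝ (ψ ω • gradient F (θ n ω)) (noisyGrad g ξ θ n ω)) μ := by
    simpa only [inner_smul_left, conj_trivial] using hi
  have h1 := S.integral_inner_noisyGrad hv hi2
  simp only [inner_smul_left, conj_trivial] at h1
  rw [h1, ← integral_const_mul]
  have hsq := integrable_weight_mul (μ := μ) hψm hψ0 hψB (S.integrable_gradient_sq n)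
  refine integral_mono (hsq.const_mul κ) ?_ fun ω => ?_
  · refine integrable_weight_mul hψm hψ0 hψB ?_
    refine ((S.integrable_gradient_sq n).const_mul c).mono'
      (hgm.inner (S.measurable_meanOracle.comp (S.measurable n))).aestronglyMeasurable
      (ae_of_all _ fun ω => ?_)
    refine (norm_inner_le_norm (𝕜 := ℝ) _ _).trans ?_
    have := S.oracle.growth (θ n ω)
    nlinarith [norm_nonneg (gradient F (θ n ω))]
  · have := S.oracle.align (θ n ω)
    rw [real_inner_comm] at this
    nlinarith [hψ0 ω]

/-- The one-step inequality, weighted by a bounded function of the past. -/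
theorem integral_weight_gap_succ_le (S : IsSGD μ ℱ F X g L α C₀ κ c γ ξ θ) {n : ℕ} {ψ : Ω → ℝ}
    {B : ℝ} (hψ : Measurable[ℱ n] ψ) (hψ0 : ∀ ω, 0 ≤ ψ ω) (hψB : ∀ ω, ψ ω ≤ B) :
    ∫ ω, ψ ω * gap F (θ (n + 1) ω) ∂μ ≤
      ∫ ω, ψ ω * gap F (θ n ω) ∂μ
        - κ * γ (n + 1) * ∫ ω, ψ ω * ‖gradient F (θ n ω)‖ ^ 2 ∂μ
        + L / (1 + α) * (1 + C₀) * γ (n + 1) ^ (1 + α) *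
          ∫ ω, ψ ω * (gap F (θ n ω) + 1) ∂μ := by
  have hL := S.smooth.L_pos
  have hα := S.smooth.α_pos
  have hγ := S.rates.pos (n + 1) (by omega)
  have hψm := hψ.mono (ℱ.le n) le_rfl
  obtain ⟨hi, h1⟩ := S.integral_weight_inner_ge hψ hψ0 hψB
  have hgap := integrable_weight_mul (μ := μ) hψm hψ0 hψB (S.integrable_gap n)
  have hgap1 := integrable_weight_mul (μ := μ) hψm hψ0 hψB
    ((S.integrable_gap n).add (integrable_const 1))
  obtain ⟨hsq, h2⟩ := S.integrable_mul_noisyGrad_sq hψ hψ0 hgap1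
  have hψi := integrable_weight_mul (μ := μ) hψm hψ0 hψB (integrable_const 1)
  simp only [mul_one] at hψi
  have hadd : Integrable (fun ω => ψ ω + ψ ω * ‖noisyGrad g ξ θ n ω‖ ^ 2) μ := hψi.add hsq
  set K := L / (1 + α) * γ (n + 1) ^ (1 + α) with hK
  have hK0 : 0 ≤ K := by positivity
  have h3 : ∫ ω, ψ ω * gap F (θ (n + 1) ω) ∂μ ≤ ∫ ω, (ψ ω * gap F (θ n ω)
      - γ (n + 1) * (ψ ω * inner ℝ (gradient F (θ n ω)) (noisyGrad g ξ θ n ω))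
      + K * (ψ ω + ψ ω * ‖noisyGrad g ξ θ n ω‖ ^ 2)) ∂μ := by
    refine integral_mono (integrable_weight_mul hψm hψ0 hψB (S.integrable_gap (n + 1)))
      (integrable_affine hgap hi hadd _ _) fun ω => ?_
    have := mul_le_mul_of_nonneg_left (S.gap_step_le' n ω) (hψ0 ω)
    refine this.trans (le_of_eq ?_)
    rw [hK]; ring
  rw [integral_affine hgap hi hadd, integral_add hψi hsq] at h3
  have h4 : ∫ ω, ψ ω ∂μ ≤ ∫ ω, ψ ω * (gap F (θ n ω) + 1) ∂μ := by
    refine integral_mono hψi hgap1 fun ω => ?_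
    have := mul_nonneg (hψ0 ω) (gap_nonneg S.smooth (θ n ω))
    simp only
    linarith
  have h5 : K * (∫ ω, ψ ω ∂μ + ∫ ω, ψ ω * ‖noisyGrad g ξ θ n ω‖ ^ 2 ∂μ) ≤
      K * ((1 + C₀) * ∫ ω, ψ ω * (gap F (θ n ω) + 1) ∂μ) := by
    gcongr; linarith
  have h6 := mul_le_mul_of_nonneg_left h1 hγ.le
  have h7 : L / (1 + α) * (1 + C₀) * γ (n + 1) ^ (1 + α) *
      ∫ ω, ψ ω * (gap F (θ n ω) + 1) ∂μ =
      K * ((1 + C₀) * ∫ ω, ψ ω * (gap F (θ n ω) + 1) ∂μ) := by rw [hK]; ring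
  rw [h7]
  linarith

end IsSGD

/-! ### Construction of the filtration -/

/-- The initial point and the first `n` innovations. -/
noncomputable def history {Ω : Type*} {m d : ℕ} (ξ : ℕ → Ω → EuclideanSpace ℝ (Fin d))
    (θ₀ : Ω → EuclideanSpace ℝ (Fin m)) (n : ℕ) (ω : Ω) :
    EuclideanSpace ℝ (Fin m) × (ℕ → EuclideanSpace ℝ (Fin d)) :=
  (θ₀ ω, fun k => if k < n then ξ (k + 1) ω else 0)

section History

variable {Ω : Type*} [mΩ : MeasurableSpace Ω] {μ : Measure Ω} [IsProbabilityMeasure μ]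
  {m d : ℕ} {ξ : ℕ → Ω → EuclideanSpace ℝ (Fin d)} {θ₀ : Ω → EuclideanSpace ℝ (Fin m)}

theorem measurable_history (hξ : ∀ n, Measurable (ξ (n + 1))) (hθ₀ : Measurable θ₀) (n : ℕ) :
    Measurable (history ξ θ₀ n) := by
  refine hθ₀.prodMk (measurable_pi_lambda _ fun k => ?_)
  split_ifs
  · exact hξ k
  · exact measurable_const

/-- The filtration generated by the initial point and the innovations. -/
noncomputable def historyFiltration (hξ : ∀ n, Measurable (ξ (n + 1))) (hθ₀ : Measurable θ₀) :
    Filtration ℕ mΩ where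
  seq n := MeasurableSpace.comap (history ξ θ₀ n) inferInstance
  mono' := by
    intro n k hnk
    -- All histories live in one space, padded with zeros; an earlier history is then a measurable
    -- truncation of a later one.
    have h : history ξ θ₀ n =
        (fun p : EuclideanSpace ℝ (Fin m) × (ℕ → EuclideanSpace ℝ (Fin d)) =>
          (p.1, fun j => if j < n then p.2 j else 0)) ∘ history ξ θ₀ k := by
      ext ω : 1
      simp only [history, Function.comp_apply, Prod.mk.injEq, true_and]
      ext j : 1
      by_cases hj : j < n
      · simp [hj, lt_of_lt_of_le hj hnk]
      · simp [hj]
    have hm : Measurable (fun p : EuclideanSpace ℝ (Fin m) × (ℕ → EuclideanSpace ℝ (Fin d)) =>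
          (p.1, fun j => if j < n then p.2 j else 0)) := by
      refine measurable_fst.prodMk (measurable_pi_lambda _ fun j => ?_)
      split_ifs
      · fun_prop
      · exact measurable_const
    change MeasurableSpace.comap (history ξ θ₀ n) _ ≤ MeasurableSpace.comap (history ξ θ₀ k) _
    rw [h, ← MeasurableSpace.comap_comp]
    exact MeasurableSpace.comap_mono hm.comap_le
  le' n := (measurable_history hξ hθ₀ n).comap_le

theorem indepFun_history (hξ : ∀ n, Measurable (ξ (n + 1))) (hθ₀ : Measurable θ₀)
    (hind : iIndepFun (fun n => ξ (n + 1)) μ)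
    (hind₀ : IndepFun θ₀ (fun ω n => ξ (n + 1) ω) μ) (n : ℕ) :
    IndepFun (history ξ θ₀ n) (ξ (n + 1)) μ := by
  have hcut : Measurable fun (x : ℕ → EuclideanSpace ℝ (Fin d)) (k : ℕ) =>
      if k < n then x k else 0 := by
    refine measurable_pi_lambda _ fun j => ?_
    split_ifs
    · fun_prop
    · exact measurable_const
  refine IndepFun.prodMk_left_of_indepFun hθ₀ (hcut.comp (measurable_pi_lambda _ hξ)) (hξ n)
    ?_ ?_
  · exact hind₀.comp measurable_id (hcut.prodMk (measurable_pi_apply n))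
  · have h := hind.indepFun_finset (Finset.range n) {n} (by simp) hξ
    have h1 : Measurable fun (x : Finset.range n → EuclideanSpace ℝ (Fin d)) (k : ℕ) =>
        if hk : k < n then x ⟨k, Finset.mem_range.2 hk⟩ else 0 := by
      refine measurable_pi_lambda _ fun j => ?_
      split_ifs
      · fun_prop
      · exact measurable_const
    have h2 : Measurable fun (x : ({n} : Finset ℕ) → EuclideanSpace ℝ (Fin d)) =>
        x ⟨n, Finset.mem_singleton_self n⟩ := by fun_prop
    have h3 := h.comp h1 h2
    convert h3 using 1
    · ext ω k
      by_cases hk : k < n <;> simp [hk]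
    · rfl

end History

/-! ### Convergence of the function values -/

section L1Bounded

variable {Ω : Type*} [mΩ : MeasurableSpace Ω] {μ : Measure Ω} [IsProbabilityMeasure μ]
  {ℱ : Filtration ℕ mΩ}

theorem eLpNorm_one_le_of_integral_norm_le {f : Ω → ℝ} {B : ℝ} (hf : Integrable f μ)
    (h : ∫ ω, ‖f ω‖ ∂μ ≤ B) : eLpNorm f 1 μ ≤ (B.toNNReal : ENNReal) := by
  rw [eLpNorm_one_eq_lintegral_enorm, ← ofReal_integral_norm_eq_lintegral_enorm hf]
  exact ENNReal.ofReal_le_ofReal h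

/-- A nonnegative supermartingale converges almost surely. -/
theorem ae_exists_tendsto_of_supermartingale {V : ℕ → Ω → ℝ} (hV : Supermartingale V ℱ μ)
    (hV0 : ∀ n ω, 0 ≤ V n ω) : ∀ᵐ ω ∂μ, ∃ l, Tendsto (fun n => V n ω) atTop (𝓝 l) := by
  have h1 : ∀ n, eLpNorm ((-V) n) 1 μ ≤ ((∫ ω, V 0 ω ∂μ).toNNReal : ENNReal) := fun n => by
    refine eLpNorm_one_le_of_integral_norm_le (hV.integrable n).neg ?_
    have h2 := hV.setIntegral_le (Nat.zero_le n) (MeasurableSet.univ)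
    simp only [setIntegral_univ] at h2
    refine le_trans (le_of_eq (integral_congr_ae (ae_of_all _ fun ω => ?_))) h2
    simp [abs_of_nonneg (hV0 n ω)]
  filter_upwards [hV.neg.exists_ae_tendsto_of_bdd h1] with ω ⟨l, hl⟩
  exact ⟨-l, by simpa using hl.neg⟩

end L1Bounded

theorem exists_tendsto_prod_one_add {a : ℕ → ℝ} (ha : ∀ n, 0 ≤ a n) (hs : Summable a) :
    (∃ l, Tendsto (fun n => ∏ k ∈ Finset.range n, (1 + a k)) atTop (𝓝 l)) ∧
      ∀ n, ∏ k ∈ Finset.range n, (1 + a k) ≤ Real.exp (∑' k, a k) := by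
  have h1 : ∀ n, ∏ k ∈ Finset.range n, (1 + a k) ≤ Real.exp (∑' k, a k) := fun n =>
    (Real.prod_one_add_le_exp_sum _ ha).trans
      (Real.exp_le_exp.2 (hs.sum_le_tsum _ fun k _ => ha k))
  refine ⟨⟨_, tendsto_atTop_ciSup (monotone_nat_of_le_succ fun n => ?_)
    ⟨_, Set.forall_mem_range.2 h1⟩⟩, h1⟩
  rw [Finset.prod_range_succ]
  exact le_mul_of_one_le_right (Finset.prod_nonneg fun k _ => by linarith [ha k])
    (by linarith [ha n])

namespace IsSGD

variable {Ω : Type*} [mΩ : MeasurableSpace Ω] {μ : Measure Ω} [IsProbabilityMeasure μ]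
  {ℱ : Filtration ℕ mΩ} {m d : ℕ} {F : EuclideanSpace ℝ (Fin m) → ℝ}
  {X : Ω → EuclideanSpace ℝ (Fin d)}
  {g : EuclideanSpace ℝ (Fin d) → EuclideanSpace ℝ (Fin m) → EuclideanSpace ℝ (Fin m)}
  {L α C₀ κ c : ℝ} {γ : ℕ → ℝ} {ξ : ℕ → Ω → EuclideanSpace ℝ (Fin d)}
  {θ : ℕ → Ω → EuclideanSpace ℝ (Fin m)}

/-- Taking indicators of past events as weights yields the set-integral form from which the
supermartingale property is read off. -/
theorem setIntegral_gap_succ_le (S : IsSGD μ ℱ F X g L α C₀ κ c γ ξ θ) {n : ℕ} {A : Set Ω}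
    (hA : MeasurableSet[ℱ n] A) :
    ∫ ω in A, gap F (θ (n + 1) ω) ∂μ ≤ ∫ ω in A, gap F (θ n ω) ∂μ
        - κ * γ (n + 1) * ∫ ω in A, ‖gradient F (θ n ω)‖ ^ 2 ∂μ
        + L / (1 + α) * (1 + C₀) * γ (n + 1) ^ (1 + α) * ∫ ω in A, (gap F (θ n ω) + 1) ∂μ := by
  have hψ : Measurable[ℱ n] (A.indicator fun _ => (1 : ℝ)) := measurable_const.indicator hA
  have h := S.integral_weight_gap_succ_le (B := 1) hψ
    (fun ω => Set.indicator_nonneg (fun _ _ => zero_le_one) ω)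
    (fun ω => Set.indicator_le' (fun _ _ => le_rfl) (fun _ _ => zero_le_one) ω)
  have key : ∀ f : Ω → ℝ, ∫ ω, A.indicator (fun _ => (1 : ℝ)) ω * f ω ∂μ = ∫ ω in A, f ω ∂μ := by
    intro f
    rw [← integral_indicator (ℱ.le n A hA)]
    refine integral_congr_ae (ae_of_all _ fun ω => ?_)
    by_cases hω : ω ∈ A <;> simp [hω]
  simpa only [key] using h

/-- The coefficient of the error term in the one-step inequality. -/
noncomputable def errorRate (L α C₀ : ℝ) (γ : ℕ → ℝ) (n : ℕ) : ℝ :=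
  L / (1 + α) * (1 + C₀) * γ (n + 1) ^ (1 + α)

/-- The growth factor of the Robbins–Siegmund argument. -/
noncomputable def growthFactor (L α C₀ : ℝ) (γ : ℕ → ℝ) (n : ℕ) : ℝ :=
  ∏ k ∈ Finset.range n, (1 + errorRate L α C₀ γ k)

theorem errorRate_nonneg (S : IsSGD μ ℱ F X g L α C₀ κ c γ ξ θ) (n : ℕ) :
    0 ≤ errorRate L α C₀ γ n := by
  have hL := S.smooth.L_pos
  have hα := S.smooth.α_pos
  have hC := S.oracle.C_pos
  have hγ := S.rates.pos (n + 1) (by omega)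
  unfold errorRate
  positivity

theorem summable_errorRate (S : IsSGD μ ℱ F X g L α C₀ κ c γ ξ θ) :
    Summable (errorRate L α C₀ γ) := S.rates.summable.mul_left _

theorem growthFactor_pos (S : IsSGD μ ℱ F X g L α C₀ κ c γ ξ θ) (n : ℕ) :
    0 < growthFactor L α C₀ γ n :=
  Finset.prod_pos fun k _ => by linarith [S.errorRate_nonneg k]

theorem exists_growthFactor_le (S : IsSGD μ ℱ F X g L α C₀ κ c γ ξ θ) :
    ∃ P : ℝ, 0 < P ∧ ∀ n, growthFactor L α C₀ γ n ≤ P :=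
  ⟨_, Real.exp_pos _,
    (exists_tendsto_prod_one_add S.errorRate_nonneg S.summable_errorRate).2⟩

/-- The Robbins–Siegmund supermartingale. -/
noncomputable def lyapunov (F : EuclideanSpace ℝ (Fin m) → ℝ) (L α C₀ κ : ℝ) (γ : ℕ → ℝ)
    (θ : ℕ → Ω → EuclideanSpace ℝ (Fin m)) (n : ℕ) (ω : Ω) : ℝ :=
  (gap F (θ n ω) + 1) / growthFactor L α C₀ γ n +
    ∑ k ∈ Finset.range n,
      κ * γ (k + 1) / growthFactor L α C₀ γ (k + 1) * ‖gradient F (θ k ω)‖ ^ 2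

theorem sum_nonneg_of_lyapunov (S : IsSGD μ ℱ F X g L α C₀ κ c γ ξ θ) (k : ℕ) (ω : Ω) :
    0 ≤ κ * γ (k + 1) / growthFactor L α C₀ γ (k + 1) * ‖gradient F (θ k ω)‖ ^ 2 := by
  have hκ := S.oracle.κ_pos
  have hγ := S.rates.pos (k + 1) (by omega)
  have := S.growthFactor_pos (k + 1)
  positivity

theorem integrable_lyapunov (S : IsSGD μ ℱ F X g L α C₀ κ c γ ξ θ) (n : ℕ) :
    Integrable (lyapunov F L α C₀ κ γ θ n) μ :=
  (((S.integrable_gap n).add (integrable_const 1)).div_const _).add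
    (integrable_finsetSum _ fun k _ => (S.integrable_gradient_sq k).const_mul _)

theorem lyapunov_nonneg (S : IsSGD μ ℱ F X g L α C₀ κ c γ ξ θ) (n : ℕ) (ω : Ω) :
    0 ≤ lyapunov F L α C₀ κ γ θ n ω := by
  have h1 := gap_nonneg S.smooth (θ n ω)
  have h2 := S.growthFactor_pos n
  exact add_nonneg (by positivity) (Finset.sum_nonneg fun k _ => S.sum_nonneg_of_lyapunov k ω)

/-- Adding `1` to the gap makes the error purely multiplicative, of factor `1 + errorRate`; dividing
by the growth factor of the next index cancels it, and the drift already spent is stored in the sum.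
-/
theorem supermartingale_lyapunov (S : IsSGD μ ℱ F X g L α C₀ κ c γ ξ θ) :
    Supermartingale (lyapunov F L α C₀ κ γ θ) ℱ μ := by
  refine supermartingale_of_setIntegral_succ_le (fun n => Measurable.stronglyMeasurable ?_)
    S.integrable_lyapunov fun n A hA => ?_
  · refine (((S.measurable_gap.comp (S.adapted n)).add_const 1).div_const _).add ?_
    refine Finset.measurable_fun_sum _ fun k hk => ?_
    have hk' : Measurable[ℱ n] (θ k) :=
      (S.adapted k).mono (ℱ.mono (Finset.mem_range.1 hk).le) le_rfl
    exact ((S.measurable_gradient.norm.pow_const 2).const_mul _).comp hk'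
  · have h := S.setIntegral_gap_succ_le hA
    set P := growthFactor L α C₀ γ n with hP
    have hP0 : 0 < P := S.growthFactor_pos n
    have ha := S.errorRate_nonneg n
    have hP1 : growthFactor L α C₀ γ (n + 1) = P * (1 + errorRate L α C₀ γ n) :=
      Finset.prod_range_succ _ _
    change _ ≤ _ - _ + errorRate L α C₀ γ n * _ at h
    set a := errorRate L α C₀ γ n with hadef
    have hg1 : IntegrableOn (fun ω => gap F (θ (n + 1) ω) + 1) A μ :=
      ((S.integrable_gap (n + 1)).add (integrable_const 1)).integrableOn
    have hg0 : IntegrableOn (fun ω => gap F (θ n ω) + 1) A μ :=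
      ((S.integrable_gap n).add (integrable_const 1)).integrableOn
    have hG : IntegrableOn (fun ω => ‖gradient F (θ n ω)‖ ^ 2) A μ :=
      (S.integrable_gradient_sq n).integrableOn
    have hsum : IntegrableOn (fun ω => ∑ k ∈ Finset.range n,
        κ * γ (k + 1) / growthFactor L α C₀ γ (k + 1) * ‖gradient F (θ k ω)‖ ^ 2) A μ :=
      (integrable_finsetSum _ fun k _ => (S.integrable_gradient_sq k).const_mul _).integrableOn
    have e1 : ∫ ω in A, lyapunov F L α C₀ κ γ θ (n + 1) ω ∂μ =
        (∫ ω in A, (gap F (θ (n + 1) ω) + 1) ∂μ) / (P * (1 + a)) +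
        (∫ ω in A, ∑ k ∈ Finset.range n,
          κ * γ (k + 1) / growthFactor L α C₀ γ (k + 1) * ‖gradient F (θ k ω)‖ ^ 2 ∂μ +
        κ * γ (n + 1) / (P * (1 + a)) * ∫ ω in A, ‖gradient F (θ n ω)‖ ^ 2 ∂μ) := by
      simp only [lyapunov, Finset.sum_range_succ, hP1]
      have hadd : IntegrableOn (fun ω => ∑ k ∈ Finset.range n,
          κ * γ (k + 1) / growthFactor L α C₀ γ (k + 1) * ‖gradient F (θ k ω)‖ ^ 2 +
          κ * γ (n + 1) / (P * (1 + a)) * ‖gradient F (θ n ω)‖ ^ 2) A μ :=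
        hsum.add (hG.const_mul _)
      rw [integral_add (hg1.div_const _) hadd, integral_div,
        integral_add hsum (hG.const_mul _), integral_const_mul]
    have e2 : ∫ ω in A, lyapunov F L α C₀ κ γ θ n ω ∂μ =
        (∫ ω in A, (gap F (θ n ω) + 1) ∂μ) / P + ∫ ω in A, ∑ k ∈ Finset.range n,
          κ * γ (k + 1) / growthFactor L α C₀ γ (k + 1) * ‖gradient F (θ k ω)‖ ^ 2 ∂μ := by
      simp only [lyapunov]
      rw [integral_add (hg0.div_const _) hsum, integral_div]
    have e3 : ∀ k, ∫ ω in A, (gap F (θ k ω) + 1) ∂μ =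
        ∫ ω in A, gap F (θ k ω) ∂μ + ∫ ω in A, (1 : ℝ) ∂μ := fun k =>
      integral_add (S.integrable_gap k).integrableOn (integrable_const 1).integrableOn
    rw [e1, e2]
    have h2 : ∫ ω in A, (gap F (θ (n + 1) ω) + 1) ∂μ
        + κ * γ (n + 1) * ∫ ω in A, ‖gradient F (θ n ω)‖ ^ 2 ∂μ ≤
        (1 + a) * ∫ ω in A, (gap F (θ n ω) + 1) ∂μ := by
      rw [e3 (n + 1)]
      have := e3 n
      linarith
    have h3 := div_le_div_of_nonneg_right h2 (by positivity : 0 ≤ P * (1 + a))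
    rw [add_div, mul_comm P (1 + a), mul_div_mul_left _ _ (by positivity)] at h3
    rw [mul_comm P (1 + a)]
    have h4 : κ * γ (n + 1) / ((1 + a) * P) * ∫ ω in A, ‖gradient F (θ n ω)‖ ^ 2 ∂μ =
        κ * γ (n + 1) * (∫ ω in A, ‖gradient F (θ n ω)‖ ^ 2 ∂μ) / ((1 + a) * P) := by ring
    rw [h4]
    linarith

theorem integral_lyapunov_le (S : IsSGD μ ℱ F X g L α C₀ κ c γ ξ θ) (n : ℕ) :
    ∫ ω, lyapunov F L α C₀ κ γ θ n ω ∂μ ≤ ∫ ω, lyapunov F L α C₀ κ γ θ 0 ω ∂μ := by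
  have := S.supermartingale_lyapunov.setIntegral_le (Nat.zero_le n) MeasurableSet.univ
  simpa only [setIntegral_univ] using this

theorem exists_integral_gap_le (S : IsSGD μ ℱ F X g L α C₀ κ c γ ξ θ) :
    ∃ B : ℝ, 0 < B ∧ ∀ n, ∫ ω, (gap F (θ n ω) + 1) ∂μ ≤ B := by
  obtain ⟨P, hP, hPle⟩ := S.exists_growthFactor_le
  set I := ∫ ω, lyapunov F L α C₀ κ γ θ 0 ω ∂μ with hI
  have hI0 : 0 ≤ I := integral_nonneg (S.lyapunov_nonneg 0)
  refine ⟨P * I + 1, by positivity, fun n => ?_⟩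
  have h1 : ∫ ω, (gap F (θ n ω) + 1) ∂μ ≤ ∫ ω, P * lyapunov F L α C₀ κ γ θ n ω ∂μ := by
    refine integral_mono ((S.integrable_gap n).add (integrable_const 1))
      ((S.integrable_lyapunov n).const_mul P) fun ω => ?_
    have hg := gap_nonneg S.smooth (θ n ω)
    have h2 : (gap F (θ n ω) + 1) / growthFactor L α C₀ γ n ≤ lyapunov F L α C₀ κ γ θ n ω :=
      le_add_of_nonneg_right (Finset.sum_nonneg fun k _ => S.sum_nonneg_of_lyapunov k ω)
    rw [div_le_iff₀ (S.growthFactor_pos n)] at h2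
    refine h2.trans ?_
    rw [mul_comm]
    exact mul_le_mul_of_nonneg_right (hPle n) (S.lyapunov_nonneg n ω)
  rw [integral_const_mul] at h1
  have := mul_le_mul_of_nonneg_left (S.integral_lyapunov_le n) hP.le
  linarith

theorem exists_sum_integral_gradient_sq_le (S : IsSGD μ ℱ F X g L α C₀ κ c γ ξ θ) :
    ∃ B : ℝ, 0 < B ∧ ∀ n,
      ∫ ω, ∑ k ∈ Finset.range n, γ (k + 1) * ‖gradient F (θ k ω)‖ ^ 2 ∂μ ≤ B := by
  obtain ⟨P, hP, hPle⟩ := S.exists_growthFactor_le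
  have hκ := S.oracle.κ_pos
  set I := ∫ ω, lyapunov F L α C₀ κ γ θ 0 ω ∂μ with hI
  have hI0 : 0 ≤ I := integral_nonneg (S.lyapunov_nonneg 0)
  refine ⟨P / κ * I + 1, by positivity, fun n => ?_⟩
  have h1 : ∫ ω, ∑ k ∈ Finset.range n, γ (k + 1) * ‖gradient F (θ k ω)‖ ^ 2 ∂μ ≤
      ∫ ω, P / κ * lyapunov F L α C₀ κ γ θ n ω ∂μ := by
    refine integral_mono (integrable_finsetSum _ fun k _ => (S.integrable_gradient_sq k).const_mul _)
      ((S.integrable_lyapunov n).const_mul _) fun ω => ?_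
    have hg := gap_nonneg S.smooth (θ n ω)
    have hPn := S.growthFactor_pos n
    have h2 : ∑ k ∈ Finset.range n, κ * γ (k + 1) / growthFactor L α C₀ γ (k + 1) *
        ‖gradient F (θ k ω)‖ ^ 2 ≤ lyapunov F L α C₀ κ γ θ n ω :=
      le_add_of_nonneg_left (by positivity)
    have h3 := mul_le_mul_of_nonneg_left h2 (by positivity : 0 ≤ P / κ)
    refine le_trans ?_ h3
    rw [Finset.mul_sum]
    refine Finset.sum_le_sum fun k _ => ?_
    have hγ := S.rates.pos (k + 1) (by omega)
    have hPk := S.growthFactor_pos (k + 1)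
    have h4 : P / κ * (κ * γ (k + 1) / growthFactor L α C₀ γ (k + 1) *
        ‖gradient F (θ k ω)‖ ^ 2) =
        P / growthFactor L α C₀ γ (k + 1) * (γ (k + 1) * ‖gradient F (θ k ω)‖ ^ 2) := by
      field_simp
    rw [h4]
    refine le_mul_of_one_le_left (by positivity) ?_
    rw [one_le_div hPk]
    exact hPle _
  rw [integral_const_mul] at h1
  have := mul_le_mul_of_nonneg_left (S.integral_lyapunov_le n) (by positivity : 0 ≤ P / κ)
  linarith

/-- The stored drift is bounded by the convergent supermartingale, hence summable. Subtracting it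
and multiplying back by the convergent growth factor recovers the gap; boundedness of the growth
factor removes it from the weights of the sum. -/
theorem ae_tendsto_gap_and_summable (S : IsSGD μ ℱ F X g L α C₀ κ c γ ξ θ) :
    ∀ᵐ ω ∂μ, (∃ l, Tendsto (fun n => gap F (θ n ω)) atTop (𝓝 l)) ∧
      Summable fun k => γ (k + 1) * ‖gradient F (θ k ω)‖ ^ 2 := by
  obtain ⟨P, hP, hPle⟩ := S.exists_growthFactor_le
  obtain ⟨⟨p, hp⟩, _⟩ := exists_tendsto_prod_one_add S.errorRate_nonneg S.summable_errorRate
  have hκ := S.oracle.κ_pos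
  filter_upwards [ae_exists_tendsto_of_supermartingale S.supermartingale_lyapunov
    S.lyapunov_nonneg] with ω ⟨v, hv⟩
  obtain ⟨B, hB⟩ := hv.bddAbove_range
  have hsum : Summable fun k => κ * γ (k + 1) / growthFactor L α C₀ γ (k + 1) *
      ‖gradient F (θ k ω)‖ ^ 2 := by
    refine summable_of_sum_range_le (c := B) (fun k => S.sum_nonneg_of_lyapunov k ω) fun n => ?_
    have hg := gap_nonneg S.smooth (θ n ω)
    have hPn := S.growthFactor_pos n
    have h2 : ∑ k ∈ Finset.range n, κ * γ (k + 1) / growthFactor L α C₀ γ (k + 1) *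
        ‖gradient F (θ k ω)‖ ^ 2 ≤ lyapunov F L α C₀ κ γ θ n ω :=
      le_add_of_nonneg_left (by positivity)
    exact h2.trans (hB ⟨n, rfl⟩)
  refine ⟨⟨p * (v - ∑' k, κ * γ (k + 1) / growthFactor L α C₀ γ (k + 1) *
      ‖gradient F (θ k ω)‖ ^ 2) - 1, ?_⟩, ?_⟩
  · have h1 := (hp.mul (hv.sub hsum.hasSum.tendsto_sum_nat)).sub_const 1
    refine h1.congr fun n => ?_
    have hPn := S.growthFactor_pos n
    change growthFactor L α C₀ γ n * _ - 1 = _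
    simp only [lyapunov, add_sub_cancel_right]
    field_simp
    ring
  · refine Summable.of_nonneg_of_le (fun k => ?_) (fun k => ?_) (hsum.mul_left (P / κ))
    · have hγ := S.rates.pos (k + 1) (by omega)
      positivity
    · have hγ := S.rates.pos (k + 1) (by omega)
      have hPk := S.growthFactor_pos (k + 1)
      have h4 : P / κ * (κ * γ (k + 1) / growthFactor L α C₀ γ (k + 1) *
          ‖gradient F (θ k ω)‖ ^ 2) =
          P / growthFactor L α C₀ γ (k + 1) * (γ (k + 1) * ‖gradient F (θ k ω)‖ ^ 2) := by
        field_simp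
      rw [h4]
      refine le_mul_of_one_le_left (by positivity) ?_
      rw [one_le_div hPk]
      exact hPle _

/-- The function values converge almost surely to an integrable limit. -/
theorem exists_integrable_limit (S : IsSGD μ ℱ F X g L α C₀ κ c γ ξ θ) :
    ∃ Fs : Ω → ℝ, Measurable Fs ∧ Integrable Fs μ ∧
      ∀ᵐ ω ∂μ, Tendsto (fun n => F (θ n ω)) atTop (𝓝 (Fs ω)) := by
  obtain ⟨l, hlm, hl⟩ := measurable_limit_of_tendsto_metrizable_ae (L := atTop)
    (fun n => (S.measurable_gap.comp (S.measurable n)).aemeasurable)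
    (S.ae_tendsto_gap_and_summable.mono fun ω h => h.1)
  obtain ⟨B, hB, hBle⟩ := S.exists_integral_gap_le
  have hint : Integrable l μ := by
    rw [← memLp_one_iff_integrable]
    refine ⟨hlm.aestronglyMeasurable, ?_⟩
    -- Fatou: the limit inherits the uniform bound on the mean gap.
    have h1 := Lp.eLpNorm_lim_le_liminf_eLpNorm (p := 1)
      (fun n => (S.measurable_gap.comp (S.measurable n)).aestronglyMeasurable) l hl
    refine (h1.trans (liminf_le_of_frequently_le' (Frequently.of_forall fun n =>
      eLpNorm_one_le_of_integral_norm_le (B := B) (S.integrable_gap n) ?_))).trans_lt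
      ENNReal.coe_lt_top
    refine le_trans (integral_mono (S.integrable_gap n).norm
      ((S.integrable_gap n).add (integrable_const 1)) fun ω => ?_) (hBle n)
    simp only [Pi.add_apply, Function.comp_apply]
    rw [Real.norm_of_nonneg (gap_nonneg S.smooth _)]
    linarith
  refine ⟨fun ω => l ω + ⨅ y, F y, hlm.add_const _, hint.add (integrable_const _), ?_⟩
  filter_upwards [hl] with ω hω
  refine (hω.add_const (⨅ y, F y)).congr fun n => ?_
  simp [gap]

/-! ### Convergence of the noise -/

/-- The oracle call can be read off from two consecutive iterates because the rate is nonzero. -/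
theorem measurable_noisyGrad_succ (S : IsSGD μ ℱ F X g L α C₀ κ c γ ξ θ) (n : ℕ) :
    Measurable[ℱ (n + 1)] (noisyGrad g ξ θ n) := by
  have hγ := S.rates.pos (n + 1) (by omega)
  have h : noisyGrad g ξ θ n = fun ω => (γ (n + 1))⁻¹ • (θ n ω - θ (n + 1) ω) := by
    ext ω : 1
    rw [S.step_noisyGrad, sub_sub_cancel, smul_smul, inv_mul_cancel₀ hγ.ne', one_smul]
  rw [h]
  exact (((S.adapted n).mono (ℱ.mono (Nat.le_succ n)) le_rfl).sub (S.adapted (n + 1))).const_smul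
    (γ (n + 1))⁻¹

/-- The centred oracle noise. -/
noncomputable def noise (μ : Measure Ω) (X : Ω → EuclideanSpace ℝ (Fin d))
    (g : EuclideanSpace ℝ (Fin d) → EuclideanSpace ℝ (Fin m) → EuclideanSpace ℝ (Fin m))
    (ξ : ℕ → Ω → EuclideanSpace ℝ (Fin d)) (θ : ℕ → Ω → EuclideanSpace ℝ (Fin m)) (n : ℕ)
    (ω : Ω) : EuclideanSpace ℝ (Fin m) := meanOracle μ X g (θ n ω) - noisyGrad g ξ θ n ω

theorem exists_noise_sq_le (S : IsSGD μ ℱ F X g L α C₀ κ c γ ξ θ) :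
    ∃ B : ℝ, 0 < B ∧ ∀ n, Integrable (fun ω => ‖noise μ X g ξ θ n ω‖ ^ 2) μ ∧
      ∫ ω, ‖noise μ X g ξ θ n ω‖ ^ 2 ∂μ ≤ B := by
  obtain ⟨A, hA, hAle⟩ := exists_gradient_sq_le S.smooth
  obtain ⟨B, hB, hBle⟩ := S.exists_integral_gap_le
  have hC := S.oracle.C_pos
  refine ⟨2 * c ^ 2 * A * B + 2 * (C₀ * B), by positivity, fun n => ?_⟩
  have hg1 : Integrable (fun ω => gap F (θ n ω) + 1) μ :=
    (S.integrable_gap n).add (integrable_const 1)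
  have hb := S.integrable_noisyGrad_sq_of_gap (S.integrable_gap n)
  have hle : ∀ ω, ‖noise μ X g ξ θ n ω‖ ^ 2 ≤
      2 * c ^ 2 * A * (gap F (θ n ω) + 1) + 2 * ‖noisyGrad g ξ θ n ω‖ ^ 2 := by
    intro ω
    have h1 : ‖noise μ X g ξ θ n ω‖ ≤ ‖meanOracle μ X g (θ n ω)‖ + ‖noisyGrad g ξ θ n ω‖ :=
      norm_sub_le _ _
    have h2 : ‖meanOracle μ X g (θ n ω)‖ ^ 2 ≤ c ^ 2 * (A * (gap F (θ n ω) + 1)) := by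
      calc _ ≤ (c * ‖gradient F (θ n ω)‖) ^ 2 :=
            pow_le_pow_left₀ (norm_nonneg _) (S.oracle.growth _) 2
        _ = c ^ 2 * ‖gradient F (θ n ω)‖ ^ 2 := by ring
        _ ≤ _ := by gcongr; exact hAle _
    have h3 : ‖noise μ X g ξ θ n ω‖ ^ 2 ≤
        (‖meanOracle μ X g (θ n ω)‖ + ‖noisyGrad g ξ θ n ω‖) ^ 2 :=
      pow_le_pow_left₀ (norm_nonneg _) h1 2
    nlinarith [sq_nonneg (‖meanOracle μ X g (θ n ω)‖ - ‖noisyGrad g ξ θ n ω‖)]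
  have hi : Integrable (fun ω => 2 * c ^ 2 * A * (gap F (θ n ω) + 1) +
      2 * ‖noisyGrad g ξ θ n ω‖ ^ 2) μ := (hg1.const_mul _).add (hb.1.const_mul _)
  have hm : Measurable fun ω => ‖noise μ X g ξ θ n ω‖ ^ 2 :=
    ((S.measurable_meanOracle.comp (S.measurable n)).sub (S.measurable_noisyGrad n)).norm.pow_const 2
  have hint : Integrable (fun ω => ‖noise μ X g ξ θ n ω‖ ^ 2) μ := by
    refine hi.mono' hm.aestronglyMeasurable (ae_of_all _ fun ω => ?_)
    rw [Real.norm_of_nonneg (by positivity)]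
    exact hle ω
  refine ⟨hint, (integral_mono hint hi hle).trans ?_⟩
  rw [integral_add (hg1.const_mul _) (hb.1.const_mul _), integral_const_mul, integral_const_mul]
  have h5 := hBle n
  have h6 : C₀ * ∫ ω, (gap F (θ n ω) + 1) ∂μ ≤ C₀ * B := by gcongr
  have h7 : 2 * c ^ 2 * A * ∫ ω, (gap F (θ n ω) + 1) ∂μ ≤ 2 * c ^ 2 * A * B := by gcongr
  linarith [hb.2]

theorem integral_inner_noise (S : IsSGD μ ℱ F X g L α C₀ κ c γ ξ θ) {n : ℕ}
    {v : Ω → EuclideanSpace ℝ (Fin m)} (hv : Measurable[ℱ n] v)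
    (hv2 : Integrable (fun ω => ‖v ω‖ ^ 2) μ) :
    Integrable (fun ω => inner ℝ (v ω) (noise μ X g ξ θ n ω)) μ ∧
      ∫ ω, inner ℝ (v ω) (noise μ X g ξ θ n ω) ∂μ = 0 := by
  have hvm := hv.mono (ℱ.le n) le_rfl
  have h1 := S.integrable_inner_noisyGrad (S.integrable_gap n) hvm hv2
  have h2 : Integrable (fun ω => inner ℝ (v ω) (meanOracle μ X g (θ n ω))) μ := by
    refine (hv2.add ((S.integrable_gradient_sq n).const_mul (c ^ 2))).mono'
      (hvm.inner (S.measurable_meanOracle.comp (S.measurable n))).aestronglyMeasurable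
      (ae_of_all _ fun ω => ?_)
    have h3 := norm_inner_le_norm (𝕜 := ℝ) (v ω) (meanOracle μ X g (θ n ω))
    have h4 : ‖meanOracle μ X g (θ n ω)‖ ^ 2 ≤ (c * ‖gradient F (θ n ω)‖) ^ 2 :=
      pow_le_pow_left₀ (norm_nonneg _) (S.oracle.growth _) 2
    simp only [Pi.add_apply]
    nlinarith [sq_nonneg (‖v ω‖ - ‖meanOracle μ X g (θ n ω)‖), sq_nonneg ‖v ω‖,
      sq_nonneg ‖meanOracle μ X g (θ n ω)‖]
  have h5 := S.integral_inner_noisyGrad hv h1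
  simp only [noise, inner_sub_right]
  refine ⟨h2.sub h1, ?_⟩
  rw [integral_sub h2 h1, h5, sub_self]

/-- The accumulated noise in the direction `e`. -/
noncomputable def noiseSum (μ : Measure Ω) (X : Ω → EuclideanSpace ℝ (Fin d))
    (g : EuclideanSpace ℝ (Fin d) → EuclideanSpace ℝ (Fin m) → EuclideanSpace ℝ (Fin m))
    (γ : ℕ → ℝ) (ξ : ℕ → Ω → EuclideanSpace ℝ (Fin d))
    (θ : ℕ → Ω → EuclideanSpace ℝ (Fin m)) (e : EuclideanSpace ℝ (Fin m)) (n : ℕ) (ω : Ω) : ℝ :=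
  ∑ k ∈ Finset.range n, γ (k + 1) * inner ℝ e (noise μ X g ξ θ k ω)

theorem measurable_noise_succ (S : IsSGD μ ℱ F X g L α C₀ κ c γ ξ θ) (n : ℕ) :
    Measurable[ℱ (n + 1)] (noise μ X g ξ θ n) :=
  (S.measurable_meanOracle.comp ((S.adapted n).mono (ℱ.mono (Nat.le_succ n)) le_rfl)).sub
    (S.measurable_noisyGrad_succ n)

theorem measurable_noiseSum (S : IsSGD μ ℱ F X g L α C₀ κ c γ ξ θ) (e : EuclideanSpace ℝ (Fin m))
    (n : ℕ) : Measurable[ℱ n] (noiseSum μ X g γ ξ θ e n) := by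
  refine Finset.measurable_fun_sum _ fun k hk => ?_
  have h := (S.measurable_noise_succ k).mono (ℱ.mono (Finset.mem_range.1 hk)) le_rfl
  exact (measurable_const.inner h).const_mul _

theorem integrable_noiseSum (S : IsSGD μ ℱ F X g L α C₀ κ c γ ξ θ) (e : EuclideanSpace ℝ (Fin m))
    (n : ℕ) : Integrable (noiseSum μ X g γ ξ θ e n) μ :=
  integrable_finsetSum _ fun _ _ => (S.integral_inner_noise measurable_const
    (integrable_const _)).1.const_mul _

theorem martingale_noiseSum (S : IsSGD μ ℱ F X g L α C₀ κ c γ ξ θ)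
    (e : EuclideanSpace ℝ (Fin m)) : Martingale (noiseSum μ X g γ ξ θ e) ℱ μ := by
  refine martingale_of_setIntegral_eq_succ (fun n => (S.measurable_noiseSum e n).stronglyMeasurable)
    (S.integrable_noiseSum e) fun n A hA => ?_
  have h0 := S.integral_inner_noise (n := n) (v := A.indicator fun _ => e)
    (measurable_const.indicator hA) (by
      refine (integrable_const (‖e‖ ^ 2)).mono' ?_ (ae_of_all _ fun ω => ?_)
      · exact ((measurable_const.indicator (ℱ.le n A hA)).norm.pow_const 2).aestronglyMeasurable
      · by_cases hω : ω ∈ A <;> simp [hω])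
  have h1 : ∫ ω in A, inner ℝ e (noise μ X g ξ θ n ω) ∂μ = 0 := by
    rw [← integral_indicator (ℱ.le n A hA), ← h0.2]
    refine integral_congr_ae (ae_of_all _ fun ω => ?_)
    by_cases hω : ω ∈ A <;> simp [hω]
  have hi : Integrable (fun ω => inner ℝ e (noise μ X g ξ θ n ω)) μ :=
    (S.integral_inner_noise measurable_const (integrable_const _)).1
  have h2 : ∫ ω in A, noiseSum μ X g γ ξ θ e (n + 1) ω ∂μ =
      ∫ ω in A, noiseSum μ X g γ ξ θ e n ω ∂μ +
        γ (n + 1) * ∫ ω in A, inner ℝ e (noise μ X g ξ θ n ω) ∂μ := by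
    simp only [noiseSum, Finset.sum_range_succ]
    rw [integral_add (f := fun ω => ∑ k ∈ Finset.range n, γ (k + 1) *
        inner ℝ e (noise μ X g ξ θ k ω))
      (S.integrable_noiseSum e n).integrableOn (hi.const_mul _).integrableOn, integral_const_mul]
  rw [h2, h1, mul_zero, add_zero]

/-- Eventually `γ ≤ 1`, and `1 + α ≤ 2`. -/
theorem summable_rates_sq (S : IsSGD μ ℱ F X g L α C₀ κ c γ ξ θ) :
    Summable fun n => γ (n + 1) ^ 2 := by
  have hα := S.smooth.α_pos
  refine Summable.of_norm_bounded_eventually_nat S.rates.summable ?_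
  filter_upwards [((S.rates.tendsto_zero hα).comp (tendsto_add_atTop_nat 1)).eventually
    (eventually_le_nhds one_pos)] with n hn
  have hγ := S.rates.pos (n + 1) (by omega)
  rw [Real.norm_of_nonneg (by positivity), ← Real.rpow_two]
  exact Real.rpow_le_rpow_of_exponent_ge hγ hn (by linarith [S.smooth.α_le_one])

/-- Each increment is orthogonal to the past sum, so the second moments add up. With `∑ γ²` finite
this bounds the martingale in `L²`, hence in `L¹`. -/
theorem noiseSum_sq_le (S : IsSGD μ ℱ F X g L α C₀ κ c γ ξ θ) (e : EuclideanSpace ℝ (Fin m))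
    {B : ℝ} (hB : ∀ n, Integrable (fun ω => ‖noise μ X g ξ θ n ω‖ ^ 2) μ ∧
      ∫ ω, ‖noise μ X g ξ θ n ω‖ ^ 2 ∂μ ≤ B) (n : ℕ) :
    Integrable (fun ω => noiseSum μ X g γ ξ θ e n ω ^ 2) μ ∧
      ∫ ω, noiseSum μ X g γ ξ θ e n ω ^ 2 ∂μ ≤
        ∑ k ∈ Finset.range n, γ (k + 1) ^ 2 * (‖e‖ ^ 2 * B) := by
  induction n with
  | zero => simp [noiseSum]
  | succ n ih =>
    have hMm := S.measurable_noiseSum e n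
    have hMm' := hMm.mono (ℱ.le n) le_rfl
    have hnm : Measurable (noise μ X g ξ θ n) := (S.measurable_noise_succ n).mono (ℱ.le _) le_rfl
    have hv : Measurable[ℱ n] fun ω => noiseSum μ X g γ ξ θ e n ω • e := hMm.smul_const e
    have hv2 : Integrable (fun ω => ‖noiseSum μ X g γ ξ θ e n ω • e‖ ^ 2) μ := by
      refine (ih.1.mul_const (‖e‖ ^ 2)).congr (ae_of_all _ fun ω => ?_)
      simp only [norm_smul, mul_pow, Real.norm_eq_abs, sq_abs]
    obtain ⟨hc1, hc2⟩ := S.integral_inner_noise hv hv2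
    have hle : ∀ ω, inner ℝ e (noise μ X g ξ θ n ω) ^ 2 ≤
        ‖e‖ ^ 2 * ‖noise μ X g ξ θ n ω‖ ^ 2 := fun ω => by
      rw [← mul_pow, ← sq_abs]
      exact pow_le_pow_left₀ (abs_nonneg _) (abs_real_inner_le_norm _ _) 2
    have hq : Integrable (fun ω => inner ℝ e (noise μ X g ξ θ n ω) ^ 2) μ := by
      refine ((hB n).1.const_mul (‖e‖ ^ 2)).mono'
        ((measurable_const.inner hnm).pow_const 2).aestronglyMeasurable (ae_of_all _ fun ω => ?_)
      rw [Real.norm_of_nonneg (by positivity)]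
      exact hle ω
    have hexp : ∀ ω, noiseSum μ X g γ ξ θ e (n + 1) ω ^ 2 =
        noiseSum μ X g γ ξ θ e n ω ^ 2
          - (-(2 * γ (n + 1))) *
            inner ℝ (noiseSum μ X g γ ξ θ e n ω • e) (noise μ X g ξ θ n ω)
          + γ (n + 1) ^ 2 * inner ℝ e (noise μ X g ξ θ n ω) ^ 2 := fun ω => by
      simp only [noiseSum, Finset.sum_range_succ, inner_smul_left, conj_trivial]
      ring
    simp only [hexp]
    refine ⟨integrable_affine ih.1 hc1 hq _ _, ?_⟩
    rw [integral_affine ih.1 hc1 hq, hc2, Finset.sum_range_succ]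
    have h1 : ∫ ω, inner ℝ e (noise μ X g ξ θ n ω) ^ 2 ∂μ ≤ ‖e‖ ^ 2 * B := by
      refine (integral_mono hq ((hB n).1.const_mul (‖e‖ ^ 2)) hle).trans ?_
      rw [integral_const_mul]
      have := (hB n).2
      gcongr
    have h2 := mul_le_mul_of_nonneg_left h1 (sq_nonneg (γ (n + 1)))
    linarith [ih.2]

theorem ae_exists_tendsto_noiseSum (S : IsSGD μ ℱ F X g L α C₀ κ c γ ξ θ)
    (e : EuclideanSpace ℝ (Fin m)) :
    ∀ᵐ ω ∂μ, ∃ l, Tendsto (fun n => noiseSum μ X g γ ξ θ e n ω) atTop (𝓝 l) := by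
  obtain ⟨B, hB0, hB⟩ := S.exists_noise_sq_le
  have hs : Summable fun k => γ (k + 1) ^ 2 * (‖e‖ ^ 2 * B) := S.summable_rates_sq.mul_right _
  refine (S.martingale_noiseSum e).submartingale.exists_ae_tendsto_of_bdd
    (R := (1 + ∑' k, γ (k + 1) ^ 2 * (‖e‖ ^ 2 * B)).toNNReal) fun n => ?_
  obtain ⟨h1, h2⟩ := S.noiseSum_sq_le e hB n
  refine eLpNorm_one_le_of_integral_norm_le (S.integrable_noiseSum e n) ?_
  have h3 : ∫ ω, ‖noiseSum μ X g γ ξ θ e n ω‖ ∂μ ≤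
      ∫ ω, (1 + noiseSum μ X g γ ξ θ e n ω ^ 2) ∂μ := by
    refine integral_mono (S.integrable_noiseSum e n).norm ((integrable_const 1).add h1) fun ω => ?_
    simp only [Real.norm_eq_abs]
    rw [← sq_abs]
    nlinarith [sq_nonneg (|noiseSum μ X g γ ξ θ e n ω| - 1)]
  rw [integral_add (integrable_const 1) h1] at h3
  simp only [integral_const, probReal_univ, smul_eq_mul, mul_one] at h3
  have h4 : ∑ k ∈ Finset.range n, γ (k + 1) ^ 2 * (‖e‖ ^ 2 * B) ≤
      ∑' k, γ (k + 1) ^ 2 * (‖e‖ ^ 2 * B) := hs.sum_le_tsum _ fun k _ => by positivity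
  linarith

/-- The perturbation `θ_n - θ_0 + γ_1 b(θ_0) + ⋯ + γ_n b(θ_{n-1})` converges almost surely. -/
theorem ae_cauchySeq_perturbation (S : IsSGD μ ℱ F X g L α C₀ κ c γ ξ θ) :
    ∀ᵐ ω ∂μ, CauchySeq fun n => θ n ω +
      ∑ k ∈ Finset.range n, γ (k + 1) • meanOracle μ X g (θ k ω) := by
  have h : ∀ᵐ ω ∂μ, ∀ i : Fin m, ∃ l, Tendsto (fun n => noiseSum μ X g γ ξ θ
      (EuclideanSpace.single i (1 : ℝ)) n ω) atTop (𝓝 l) :=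
    ae_all_iff.2 fun i => S.ae_exists_tendsto_noiseSum _
  filter_upwards [h] with ω hω
  choose l hl using hω
  -- Compensating the drift leaves the initial point plus the accumulated noise, whose coordinates
  -- are the martingales above.
  have hsum : ∀ n, θ n ω + ∑ k ∈ Finset.range n, γ (k + 1) • meanOracle μ X g (θ k ω) =
      θ 0 ω + ∑ k ∈ Finset.range n, γ (k + 1) • noise μ X g ξ θ k ω := by
    intro n
    induction n with
    | zero => simp
    | succ n ih =>
      rw [Finset.sum_range_succ, Finset.sum_range_succ, ← add_assoc (θ 0 ω), ← ih,
        S.step_noisyGrad, noise, smul_sub]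
      abel
  simp only [hsum]
  have hlim : Tendsto (fun n => ∑ k ∈ Finset.range n, γ (k + 1) • noise μ X g ξ θ k ω) atTop
      (𝓝 (WithLp.toLp 2 l)) := by
    have h1 : Tendsto (fun n => WithLp.ofLp (∑ k ∈ Finset.range n,
        γ (k + 1) • noise μ X g ξ θ k ω)) atTop (𝓝 l) := by
      rw [tendsto_pi_nhds]
      intro i
      refine (hl i).congr fun n => ?_
      simp [noiseSum, EuclideanSpace.inner_single_left]
    exact ((PiLp.continuous_toLp 2 _).tendsto l).comp h1
  exact (hlim.const_add (θ 0 ω)).cauchySeq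

end IsSGD

/-! ### Accumulation points -/

/-- The almost sure behaviour of a trajectory: the values converge to `l`, the gradients are
summable against the rates, and the accumulation points are critical. -/
structure RegularPath {m : ℕ} (F : EuclideanSpace ℝ (Fin m) → ℝ) (γ : ℕ → ℝ)
    (u : ℕ → EuclideanSpace ℝ (Fin m)) (l : ℝ) : Prop where
  tendsto : Tendsto (fun n => F (u n)) atTop (𝓝 l)
  summable : Summable fun k => γ (k + 1) * ‖gradient F (u k)‖ ^ 2
  critical : ∀ x, MapClusterPt x atTop u → gradient F x = 0

section Paths

variable {m : ℕ} {F : EuclideanSpace ℝ (Fin m) → ℝ} {L α : ℝ} {γ : ℕ → ℝ}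
  {u : ℕ → EuclideanSpace ℝ (Fin m)} {l : ℝ}

theorem partialSum_eq_sum_range (γ : ℕ → ℝ) (n : ℕ) :
    partialSum γ n = ∑ k ∈ Finset.range n, γ (k + 1) := by
  induction n with
  | zero => simp [partialSum]
  | succ n ih => rw [partialSum_succ, Finset.sum_range_succ, ih]

/-- A perturbed gradient-like trajectory with summable squared gradients only accumulates at
critical points. -/
theorem gradient_eq_zero_of_mapClusterPt (hF : HolderSmooth F L α) (hγ : StepSizes γ α)
    {b : EuclideanSpace ℝ (Fin m) → EuclideanSpace ℝ (Fin m)} {c : ℝ} (hc : 0 < c)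
    (hb : ∀ x, ‖b x‖ ≤ c * ‖gradient F x‖)
    (hcauchy : CauchySeq fun n => u n + ∑ k ∈ Finset.range n, γ (k + 1) • b (u k))
    (hsum : Summable fun k => γ (k + 1) * ‖gradient F (u k)‖ ^ 2)
    {x : EuclideanSpace ℝ (Fin m)} (hx : MapClusterPt x atTop u) : gradient F x = 0 := by
  by_contra hne
  have hG0 : 0 < ‖gradient F x‖ := norm_pos_iff.2 hne
  set η := ‖gradient F x‖ / 2 with hη
  have hη0 : 0 < η := by positivity
  have hcont : Continuous fun y => ‖gradient F y‖ := (continuous_gradient_of_holder hF).norm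
  obtain ⟨r, hr, hball⟩ := Metric.eventually_nhds_iff_ball.1
    (hcont.continuousAt.eventually (lt_mem_nhds (show η < ‖gradient F x‖ by linarith)))
  obtain ⟨N₁, hN₁⟩ := Metric.cauchySeq_iff.1 hcauchy (r / 3) (by positivity)
  obtain ⟨N₂, hN₂⟩ := Metric.cauchySeq_iff.1 hsum.hasSum.tendsto_sum_nat.cauchySeq
    (r / 3 * (η / c)) (by positivity)
  obtain ⟨n, hn, hnN⟩ := ((hx.frequently (Metric.ball_mem_nhds x (by positivity :
    0 < r / 3))).and_eventually (eventually_ge_atTop (max N₁ N₂))).exists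
  have hn₁ : N₁ ≤ n := (le_max_left _ _).trans hnN
  have hn₂ : N₂ ≤ n := (le_max_right _ _).trans hnN
  -- Starting within `r / 3` of `x`, the perturbation moves the trajectory by less than `r / 3` and
  -- the drift by at most `r / 3`, so it never leaves the ball.
  have hstay : ∀ k, n ≤ k → u k ∈ Metric.ball x r := by
    intro k
    induction k using Nat.strong_induction_on with
    | _ k ih =>
      intro hk
      have h1 := hN₁ k (hn₁.trans hk) n hn₁
      have h2 := hN₂ k (hn₂.trans hk) n hn₂
      rw [dist_eq_norm, ← Finset.sum_range_add_sum_Ico _ hk] at h1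
      rw [Real.dist_eq, ← Finset.sum_range_add_sum_Ico _ hk, add_sub_cancel_left] at h2
      have h3 : ‖∑ j ∈ Finset.Ico n k, γ (j + 1) • b (u j)‖ ≤ r / 3 := by
        calc _ ≤ ∑ j ∈ Finset.Ico n k, ‖γ (j + 1) • b (u j)‖ := norm_sum_le _ _
          _ ≤ ∑ j ∈ Finset.Ico n k, c / η * (γ (j + 1) * ‖gradient F (u j)‖ ^ 2) := by
              refine Finset.sum_le_sum fun j hj => ?_
              obtain ⟨hj1, hj2⟩ := Finset.mem_Ico.1 hj
              have hγj := hγ.pos (j + 1) (by omega)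
              have hGj := hball _ (ih j hj2 hj1)
              rw [norm_smul, Real.norm_of_nonneg hγj.le]
              -- In the ball the gradient exceeds `η`, so the length of the drift is controlled by
              -- the summable energy.
              have h4 : ‖gradient F (u j)‖ ≤ ‖gradient F (u j)‖ ^ 2 / η := by
                rw [le_div_iff₀ hη0, sq]
                gcongr
              calc γ (j + 1) * ‖b (u j)‖ ≤ γ (j + 1) * (c * (‖gradient F (u j)‖ ^ 2 / η)) := by
                    gcongr
                    exact (hb _).trans (by gcongr)
                _ = _ := by ring
          _ = c / η * ∑ j ∈ Finset.Ico n k, γ (j + 1) * ‖gradient F (u j)‖ ^ 2 := by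
              rw [Finset.mul_sum]
          _ ≤ c / η * (r / 3 * (η / c)) := by
              gcongr
              exact (le_abs_self _).trans h2.le
          _ = r / 3 := by field_simp
      rw [Metric.mem_ball]
      rw [dist_eq_norm] at hn ⊢
      have h5 : u k - x = (u k + (∑ j ∈ Finset.range n, γ (j + 1) • b (u j) +
          ∑ j ∈ Finset.Ico n k, γ (j + 1) • b (u j)) -
          (u n + ∑ j ∈ Finset.range n, γ (j + 1) • b (u j))) -
          ∑ j ∈ Finset.Ico n k, γ (j + 1) • b (u j) + (u n - x) := by abel
      rw [h5]
      refine (norm_add_le _ _).trans_lt ?_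
      have := norm_sub_le (u k + (∑ j ∈ Finset.range n, γ (j + 1) • b (u j) +
          ∑ j ∈ Finset.Ico n k, γ (j + 1) • b (u j)) -
          (u n + ∑ j ∈ Finset.range n, γ (j + 1) • b (u j)))
          (∑ j ∈ Finset.Ico n k, γ (j + 1) • b (u j))
      linarith
  -- Remaining where the gradient exceeds `η` makes the rates themselves summable, which is
  -- excluded.
  have hsγ : Summable fun k => γ (k + 1) := by
    refine Summable.of_norm_bounded_eventually_nat (hsum.mul_left (1 / η ^ 2)) ?_
    filter_upwards [eventually_ge_atTop n] with k hk
    have hγk := hγ.pos (k + 1) (by omega)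
    have hGk := hball _ (hstay k hk)
    rw [Real.norm_of_nonneg hγk.le]
    have : η ^ 2 ≤ ‖gradient F (u k)‖ ^ 2 := pow_le_pow_left₀ hη0.le hGk.le 2
    rw [one_div_mul_eq_div, le_div_iff₀ (by positivity)]
    gcongr
  refine not_tendsto_nhds_of_tendsto_atTop hγ.diverges (∑' k, γ (k + 1)) ?_
  exact hsγ.hasSum.tendsto_sum_nat.congr fun n => (partialSum_eq_sum_range γ n).symm

namespace RegularPath

theorem value_eq (h : RegularPath F γ u l) (hF : HolderSmooth F L α)
    {x : EuclideanSpace ℝ (Fin m)} (hx : MapClusterPt x atTop u) : F x = l := by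
  have h1 : MapClusterPt (F x) atTop (F ∘ u) :=
    hx.continuousAt_comp hF.differentiable.continuous.continuousAt
  have h2 : (𝓝 (F x) ⊓ 𝓝 l).NeBot := h1.neBot.mono (inf_le_inf_left _ h.tendsto)
  exact eq_of_nhds_neBot h2

theorem accPoints_subset (h : RegularPath F γ u l) (hF : HolderSmooth F L α) {k : ℝ} (hl : l ≤ k) :
    accPoints u ⊆ sublevel F k := by
  intro x hx
  change F x ≤ k
  rwa [h.value_eq hF hx]

theorem eventually_mem_sublevel (h : RegularPath F γ u l) :
    ∀ᶠ n in atTop, u n ∈ sublevel F (l + 1) :=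
  h.tendsto.eventually (eventually_le_nhds (by linarith))

theorem exists_critical (h : RegularPath F γ u l) (hF : HolderSmooth F L α) (hc : Coercive F) :
    ∃ x, gradient F x = 0 ∧ F x = l := by
  obtain ⟨x, _, hx⟩ := (isCompact_sublevel hF hc (l + 1)).exists_mapClusterPt_of_frequently
    h.eventually_mem_sublevel.frequently
  exact ⟨x, h.critical x hx, h.value_eq hF hx⟩

/-- Otherwise infinitely many iterates would lie in a compact part of the complement of `U` and
accumulate there, at a critical point of level `l`. -/
theorem eventually_mem (h : RegularPath F γ u l) (hF : HolderSmooth F L α) (hc : Coercive F)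
    {U : Set (EuclideanSpace ℝ (Fin m))} (hU : IsOpen U)
    (hcrit : ∀ x, gradient F x = 0 → F x = l → x ∈ U) : ∀ᶠ n in atTop, u n ∈ U := by
  by_contra hcon
  have hcon' : ∃ᶠ n in atTop, u n ∈ sublevel F (l + 1) ∩ Uᶜ := by
    have := (not_eventually.1 hcon).and_eventually h.eventually_mem_sublevel
    exact this.mono fun n hn => ⟨hn.2, hn.1⟩
  obtain ⟨x, hxU, hx⟩ := ((isCompact_sublevel hF hc (l + 1)).inter_right
    hU.isClosed_compl).exists_mapClusterPt_of_frequently hcon'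
  exact hxU.2 (hcrit x (h.critical x hx) (h.value_eq hF hx))

theorem summable_value_rpow (h : RegularPath F γ u l) (hF : HolderSmooth F L α)
    (hγ : StepSizes γ α) (hc : Coercive F) {k β ζ : ℝ} (hl : l ≤ k)
    (hloj : LojasiewiczOn F (sublevel F k) β ζ) :
    Summable fun n => γ (n + 1) * |F (u n) - l| ^ (2 * β) := by
  obtain ⟨U, hU, _, hcrit, hle⟩ := exists_isOpen_lojasiewicz hF hc hl hloj
  refine Summable.of_norm_bounded_eventually_nat (h.summable.mul_left (ζ ^ 2)) ?_
  filter_upwards [h.eventually_mem hF hc hU hcrit] with n hn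
  have hγn := hγ.pos (n + 1) (by omega)
  rw [Real.norm_of_nonneg (by positivity)]
  have h1 : |F (u n) - l| ^ (2 * β) ≤ (ζ * ‖gradient F (u n)‖) ^ 2 := by
    rw [mul_comm 2 β, Real.rpow_mul (abs_nonneg _), Real.rpow_two]
    exact pow_le_pow_left₀ (by positivity) (hle _ hn) 2
  calc γ (n + 1) * |F (u n) - l| ^ (2 * β) ≤ γ (n + 1) * (ζ * ‖gradient F (u n)‖) ^ 2 := by gcongr
    _ = _ := by ring

end RegularPath

/-! ### The best iterate -/

/-- The best value is below each term of the weighted sum. Iterate `k` carries the weight `γ_{k+1}`,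
so the best among indices `0, …, n` meets the partial sum up to `n + 1`, as in the definition of
`sumInv`. -/
theorem best_rpow_mul_partialSum_le (hγ : StepSizes γ α) {β : ℝ} (hβ : 0 < β) (n : ℕ)
    (hx : 0 ≤ (⨅ k : Fin (n + 1), F (u k)) - l) :
    ((⨅ k : Fin (n + 1), F (u k)) - l) ^ (2 * β) * partialSum γ (n + 1) ≤
      ∑ k ∈ Finset.range (n + 1), γ (k + 1) * |F (u k) - l| ^ (2 * β) := by
  rw [partialSum_eq_sum_range, Finset.mul_sum]
  refine Finset.sum_le_sum fun k hk => ?_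
  have hγk := hγ.pos (k + 1) (by omega)
  rw [mul_comm]
  have h1 : (⨅ k : Fin (n + 1), F (u k)) ≤ F (u k) :=
    ciInf_le (f := fun k : Fin (n + 1) => F (u k)) (Set.finite_range _).bddBelow
      ⟨k, Finset.mem_range.1 hk⟩
  gcongr
  exact le_trans (by linarith) (le_abs_self _)

theorem exists_best_le (hγ : StepSizes γ α) {β : ℝ} (hβ : 0 < β)
    (hsum : Summable fun n => γ (n + 1) * |F (u n) - l| ^ (2 * β)) :
    ∃ C : ℝ, ∀ n, ((⨅ k : Fin (n + 1), F (u k)) - l) *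
      partialSum γ (n + 1) ^ (1 / max 1 (2 * β)) ≤ C := by
  have hnn : ∀ k, 0 ≤ γ (k + 1) * |F (u k) - l| ^ (2 * β) := fun k => by
    have := hγ.pos (k + 1) (by omega)
    positivity
  set A := ∑' n, γ (n + 1) * |F (u n) - l| ^ (2 * β) with hA
  have hA0 : 0 ≤ A := tsum_nonneg hnn
  refine ⟨A ^ (1 / (2 * β)) + |F (u 0) - l|, fun n => ?_⟩
  have hT := hγ.partialSum_pos n
  set T := partialSum γ (n + 1) with hTdef
  set x := (⨅ k : Fin (n + 1), F (u k)) - l with hxdef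
  have hq : 0 < max 1 (2 * β) := lt_of_lt_of_le one_pos (le_max_left _ _)
  rcases lt_or_ge x 0 with hx | hx
  · have : x * T ^ (1 / max 1 (2 * β)) ≤ 0 :=
      mul_nonpos_of_nonpos_of_nonneg hx.le (by positivity)
    have : 0 ≤ A ^ (1 / (2 * β)) + |F (u 0) - l| := by positivity
    linarith
  -- The natural rate is `T^(-1/(2β))`. It implies the weaker one with exponent `1 / max 1 (2β)`
  -- only for `T ≥ 1`; below, the initial value is a sufficient bound.
  rcases le_total T 1 with hT1 | hT1
  · have h1 : x ≤ |F (u 0) - l| := by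
      have : (⨅ k : Fin (n + 1), F (u k)) ≤ F (u 0) :=
        ciInf_le (f := fun k : Fin (n + 1) => F (u k)) (Set.finite_range _).bddBelow
          ⟨0, Nat.succ_pos n⟩
      exact le_trans (by linarith) (le_abs_self _)
    have h2 : T ^ (1 / max 1 (2 * β)) ≤ 1 := Real.rpow_le_one hT.le hT1 (by positivity)
    have h3 : 0 ≤ A ^ (1 / (2 * β)) := by positivity
    have h4 : x * T ^ (1 / max 1 (2 * β)) ≤ x := mul_le_of_le_one_right hx h2
    linarith
  · have h1 := (best_rpow_mul_partialSum_le hγ hβ n hx).trans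
      (hsum.sum_le_tsum _ fun k _ => hnn k)
    rw [← hxdef, ← hTdef, ← hA] at h1
    have h2 : x * T ^ (1 / (2 * β)) ≤ A ^ (1 / (2 * β)) := by
      have h3 := Real.rpow_le_rpow (by positivity) h1 (by positivity : 0 ≤ 1 / (2 * β))
      rwa [Real.mul_rpow (by positivity) hT.le, ← Real.rpow_mul hx,
        mul_one_div_cancel (by positivity), Real.rpow_one] at h3
    have h4 : T ^ (1 / max 1 (2 * β)) ≤ T ^ (1 / (2 * β)) := by
      refine Real.rpow_le_rpow_of_exponent_le hT1 ?_
      exact one_div_le_one_div_of_le (by positivity) (le_max_right _ _)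
    have h5 : x * T ^ (1 / max 1 (2 * β)) ≤ x * T ^ (1 / (2 * β)) := by gcongr
    have h6 := abs_nonneg (F (u 0) - l)
    linarith

end Paths

/-! ### Markov's inequality and the choice of a confidence level -/

theorem withProb_of_integral_le {Ω : Type*} [MeasurableSpace Ω] {μ : Measure Ω}
    [IsProbabilityMeasure μ] {f : Ω → ℝ} {B δ : ℝ} (hf : Integrable f μ) (hf0 : ∀ ω, 0 ≤ f ω)
    (hB : 0 < B) (h : ∫ ω, f ω ∂μ ≤ B) (hδ : 0 < δ) : WithProb μ δ fun ω => f ω ≤ B / δ := by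
  have h1 := mul_meas_ge_le_integral_of_nonneg (ae_of_all μ hf0) hf (B / δ)
  have h2 : μ.real {ω | B / δ ≤ f ω} ≤ δ := by
    have h3 := h1.trans h
    rw [div_mul_eq_mul_div, div_le_iff₀ hδ] at h3
    exact le_of_mul_le_mul_left h3 hB
  have h3 : μ {ω | B / δ ≤ f ω} ≤ ENNReal.ofReal δ := by
    rw [← ofReal_measureReal]
    exact ENNReal.ofReal_le_ofReal h2
  have h4 : 1 ≤ μ {ω | f ω ≤ B / δ} + μ {ω | B / δ ≤ f ω} := by
    rw [← measure_univ (μ := μ)]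
    refine (measure_mono fun ω _ => ?_).trans (measure_union_le _ _)
    exact le_total (f ω) (B / δ)
  change ENNReal.ofReal (1 - δ) ≤ μ {ω | f ω ≤ B / δ}
  rw [ENNReal.ofReal_sub _ hδ.le, ENNReal.ofReal_one, tsub_le_iff_right]
  exact h4.trans (by gcongr)

theorem SGD.WithProb.mono {Ω : Type*} [MeasurableSpace Ω] {μ : Measure Ω} {δ : ℝ}
    {p q : Ω → Prop} (h : WithProb μ δ p) (hpq : ∀ᵐ ω ∂μ, p ω → q ω) : WithProb μ δ q :=
  h.trans (measure_mono_ae hpq)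

/-- The level is chosen with mass strictly above `1 - δ`: the surplus is needed in
`exists_withProb_of_cover`. -/
theorem exists_level {Ω : Type*} [MeasurableSpace Ω] {μ : Measure Ω} [IsProbabilityMeasure μ]
    (f : Ω → ℝ) {δ : ℝ} (hδ : 0 < δ) (a : ℝ) :
    ∃ l : ℝ, a < l ∧ ENNReal.ofReal (1 - δ) < μ {ω | f ω ≤ l} := by
  have hmono : Monotone fun j : ℕ => {ω | f ω ≤ j} := fun i j hij ω hω =>
    le_trans (show f ω ≤ i from hω) (by exact_mod_cast hij)
  have hlim := tendsto_measure_iUnion_atTop (μ := μ) hmono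
  have huniv : ⋃ j : ℕ, {ω | f ω ≤ j} = Set.univ :=
    Set.eq_univ_of_forall fun ω => Set.mem_iUnion.2 (exists_nat_ge (f ω))
  rw [huniv, measure_univ] at hlim
  have hlt : ENNReal.ofReal (1 - δ) < 1 := by
    rw [← ENNReal.ofReal_one, ENNReal.ofReal_lt_ofReal_iff one_pos]
    linarith
  obtain ⟨j, hj1, hj2⟩ := ((hlim.eventually (lt_mem_nhds hlt)).and
    ((tendsto_natCast_atTop_atTop (R := ℝ)).eventually (eventually_gt_atTop a))).exists
  exact ⟨j, hj2, hj1⟩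

/-! ### The best iterate in probability -/

namespace IsSGD

variable {Ω : Type*} [mΩ : MeasurableSpace Ω] {μ : Measure Ω} [IsProbabilityMeasure μ]
  {ℱ : Filtration ℕ mΩ} {m d : ℕ} {F : EuclideanSpace ℝ (Fin m) → ℝ}
  {X : Ω → EuclideanSpace ℝ (Fin d)}
  {g : EuclideanSpace ℝ (Fin d) → EuclideanSpace ℝ (Fin m) → EuclideanSpace ℝ (Fin m)}
  {L α C₀ κ c : ℝ} {γ : ℕ → ℝ} {ξ : ℕ → Ω → EuclideanSpace ℝ (Fin d)}
  {θ : ℕ → Ω → EuclideanSpace ℝ (Fin m)} {Fs : Ω → ℝ}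

theorem ae_regularPath (S : IsSGD μ ℱ F X g L α C₀ κ c γ ξ θ)
    (hFs : ∀ᵐ ω ∂μ, Tendsto (fun n => F (θ n ω)) atTop (𝓝 (Fs ω))) :
    ∀ᵐ ω ∂μ, RegularPath F γ (fun n => θ n ω) (Fs ω) := by
  have hc : 0 < c := S.oracle.κ_pos.trans_le S.oracle.κ_le
  filter_upwards [hFs, S.ae_tendsto_gap_and_summable, S.ae_cauchySeq_perturbation]
    with ω h1 h2 h3
  exact ⟨h1, h2.2, fun x hx => gradient_eq_zero_of_mapClusterPt S.smooth S.rates hc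
    S.oracle.growth h3 h2.2 hx⟩

theorem withProb_accPoints (S : IsSGD μ ℱ F X g L α C₀ κ c γ ξ θ)
    (hreg : ∀ᵐ ω ∂μ, RegularPath F γ (fun n => θ n ω) (Fs ω)) {δ l : ℝ}
    (hl : ENNReal.ofReal (1 - δ) < μ {ω | Fs ω ≤ l}) :
    WithProb μ δ fun ω => accPoints (fun n => θ n ω) ⊆ sublevel F l :=
  SGD.WithProb.mono (p := fun ω => Fs ω ≤ l) hl.le
    (hreg.mono fun _ h hω => h.accPoints_subset S.smooth hω)

/-- The almost surely finite constant of `exists_best_le` is bounded by some integer `j`, uniformly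
in `n`. The pieces of the cover are the events with a given `j`, so no exceptional set arises. -/
theorem best_iterate_local (S : IsSGD μ ℱ F X g L α C₀ κ c γ ξ θ) (hcoer : Coercive F)
    (hreg : ∀ᵐ ω ∂μ, RegularPath F γ (fun n => θ n ω) (Fs ω)) {δ l β ζ : ℝ}
    (hl : ENNReal.ofReal (1 - δ) < μ {ω | Fs ω ≤ l}) (hβ : 0 < β)
    (hloj : LojasiewiczOn F (sublevel F l) β ζ) :
    ∃ C : ℝ, 0 < C ∧ ∀ ε : ℝ, 0 < ε →
      ∀ n : ℕ, sumInv γ (ε ^ (-(max 1 (2 * β)))) ≤ n →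
        WithProb μ δ fun ω => (⨅ k : Fin (n + 1), F (θ k ω)) - Fs ω ≤ C * ε := by
  have hcover : ∀ᵐ ω ∂μ, ω ∈ {ω | Fs ω ≤ l} →
      ∃ j : ℕ, ω ∈ {ω | ∀ n, ((⨅ k : Fin (n + 1), F (θ k ω)) - Fs ω) *
        partialSum γ (n + 1) ^ (1 / max 1 (2 * β)) ≤ j} := by
    filter_upwards [hreg] with ω hω hωl
    obtain ⟨C, hC⟩ := exists_best_le S.rates hβ
      (hω.summable_value_rpow S.smooth S.rates hcoer hωl hloj)
    obtain ⟨j, hj⟩ := exists_nat_ge C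
    exact ⟨j, fun n => (hC n).trans hj⟩
  obtain ⟨C, hC, hle⟩ := exists_withProb_of_cover hl _ hcover
    (fun n ω => ((⨅ k : Fin (n + 1), F (θ k ω)) - Fs ω) *
      partialSum γ (n + 1) ^ (1 / max 1 (2 * β))) fun j η _ =>
    ⟨j, fun n => (measure_mono_null (t := ∅) (fun ω hω => absurd (hω.1 n) (not_le.2 hω.2))
      measure_empty).le.trans bot_le⟩
  refine ⟨C, hC, fun ε hε n hn => (hle n).mono (ae_of_all _ fun ω hω => ?_)⟩
  have hT := S.rates.le_partialSum_of_sumInv_le hn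
  have hT0 := S.rates.partialSum_pos n
  have hq : 0 < max 1 (2 * β) := lt_of_lt_of_le one_pos (le_max_left _ _)
  have h1 := Real.rpow_le_rpow (by positivity) hT (by positivity : 0 ≤ 1 / max 1 (2 * β))
  rw [← Real.rpow_mul hε.le, neg_mul, mul_one_div_cancel hq.ne', Real.rpow_neg_one] at h1
  rcases le_or_gt ((⨅ k : Fin (n + 1), F (θ k ω)) - Fs ω) 0 with h | h
  · exact h.trans (by positivity)
  · have h2 := (mul_le_mul_of_nonneg_left h1 h.le).trans hω
    rwa [← div_eq_mul_inv, div_le_iff₀ hε] at h2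

theorem best_iterate_global (S : IsSGD μ ℱ F X g L α C₀ κ c γ ξ θ) {β ζ : ℝ} (hβ : 0 < β)
    (hζ : 0 < ζ) (hloj : LojasiewiczInf F β ζ) :
    ∃ C : ℝ, 0 < C ∧ ∀ δ : ℝ, 0 < δ → δ < 1 → ∀ ε : ℝ, 0 < ε →
      ∀ n : ℕ, sumInv γ (ε ^ (-(2 * β))) ≤ n →
        WithProb μ δ fun ω =>
          (⨅ k : Fin (n + 1), F (θ k ω)) - (⨅ x, F x) ≤ C / δ ^ (1 / β) * ε := by
  obtain ⟨B, hB, hBle⟩ := S.exists_sum_integral_gradient_sq_le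
  refine ⟨(ζ ^ 2 * B) ^ (1 / (2 * β)), by positivity, fun δ hδ hδ1 ε hε n hn => ?_⟩
  have hnn : ∀ k ω, 0 ≤ γ (k + 1) * ‖gradient F (θ k ω)‖ ^ 2 := fun k ω => by
    have := S.rates.pos (k + 1) (by omega)
    positivity
  refine (withProb_of_integral_le (integrable_finsetSum _ fun k _ =>
    (S.integrable_gradient_sq k).const_mul _) (fun ω => Finset.sum_nonneg fun k _ => hnn k ω) hB
    (hBle (n + 1)) hδ).mono (ae_of_all _ fun ω hω => ?_)
  have hT := S.rates.le_partialSum_of_sumInv_le hn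
  set x := (⨅ k : Fin (n + 1), F (θ k ω)) - (⨅ x, F x) with hx
  have hx0 : 0 ≤ x := sub_nonneg.2 (le_ciInf fun k => ciInf_le S.smooth.bddBelow _)
  have h1 := best_rpow_mul_partialSum_le (F := F) (u := fun k => θ k ω) S.rates hβ n hx0
  have h2 : ∑ k ∈ Finset.range (n + 1), γ (k + 1) * |F (θ k ω) - ⨅ x, F x| ^ (2 * β) ≤
      ζ ^ 2 * ∑ k ∈ Finset.range (n + 1), γ (k + 1) * ‖gradient F (θ k ω)‖ ^ 2 := by
    rw [Finset.mul_sum]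
    refine Finset.sum_le_sum fun k _ => ?_
    have hγk := S.rates.pos (k + 1) (by omega)
    have h3 := hloj (θ k ω)
    have h4 := gap_nonneg S.smooth (θ k ω)
    rw [gap] at h4
    rw [abs_of_nonneg h4, mul_comm 2 β, Real.rpow_mul h4, Real.rpow_two]
    calc _ ≤ γ (k + 1) * (ζ * ‖gradient F (θ k ω)‖) ^ 2 := by gcongr
      _ = _ := by ring
  have h5 : x ^ (2 * β) * ε ^ (-(2 * β)) ≤ ζ ^ 2 * B / δ := by
    calc _ ≤ x ^ (2 * β) * partialSum γ (n + 1) := by gcongr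
      _ ≤ _ := h1.trans h2
      _ ≤ ζ ^ 2 * (B / δ) := by gcongr
      _ = _ := by ring
  rw [Real.rpow_neg hε.le, ← div_eq_mul_inv, ← Real.div_rpow hx0 hε.le] at h5
  have h6 := Real.rpow_le_rpow (by positivity) h5 (by positivity : 0 ≤ 1 / (2 * β))
  rw [← Real.rpow_mul (by positivity), mul_one_div_cancel (by positivity), Real.rpow_one,
    Real.div_rpow (by positivity) hδ.le, div_le_iff₀ hε] at h6
  -- The argument yields `δ^(-1/(2β))`, which is at most `δ^(-1/β)` because `δ < 1`.
  refine h6.trans (mul_le_mul_of_nonneg_right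
    (div_le_div_of_nonneg_left (by positivity) (by positivity) ?_) hε.le)
  refine Real.rpow_le_rpow_of_exponent_ge hδ hδ1.le ?_
  exact one_div_le_one_div_of_le hβ (by linarith)

end IsSGD

/-! ### The last iterate near a critical level -/

/-- The excess of the value over the level `v`. -/
noncomputable def excess {m : ℕ} (F : EuclideanSpace ℝ (Fin m) → ℝ) (v : ℝ)
    (x : EuclideanSpace ℝ (Fin m)) : ℝ := max (F x - v) 0

/-- The event that the iterates of indices `N, …, n` belong to `U`. -/
def stay {Ω : Type*} {m : ℕ} (θ : ℕ → Ω → EuclideanSpace ℝ (Fin m))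
    (U : Set (EuclideanSpace ℝ (Fin m))) (N n : ℕ) : Set Ω :=
  {ω | ∀ k, N ≤ k → k ≤ n → θ k ω ∈ U}

/-- The indicator of `stay`. -/
noncomputable def stayInd {Ω : Type*} {m : ℕ} (θ : ℕ → Ω → EuclideanSpace ℝ (Fin m))
    (U : Set (EuclideanSpace ℝ (Fin m))) (N n : ℕ) : Ω → ℝ :=
  (stay θ U N n).indicator fun _ => 1

/-- The mean squared excess on the event `stay`. -/
noncomputable def localError {Ω : Type*} [MeasurableSpace Ω] (μ : Measure Ω) {m : ℕ}
    (F : EuclideanSpace ℝ (Fin m) → ℝ) (θ : ℕ → Ω → EuclideanSpace ℝ (Fin m))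
    (U : Set (EuclideanSpace ℝ (Fin m))) (v : ℝ) (N n : ℕ) : ℝ :=
  ∫ ω, stayInd θ U N n ω * excess F v (θ n ω) ^ 2 ∂μ

theorem excess_nonneg {m : ℕ} (F : EuclideanSpace ℝ (Fin m) → ℝ) (v : ℝ)
    (x : EuclideanSpace ℝ (Fin m)) : 0 ≤ excess F v x := le_max_right _ _

theorem stayInd_nonneg {Ω : Type*} {m : ℕ} (θ : ℕ → Ω → EuclideanSpace ℝ (Fin m))
    (U : Set (EuclideanSpace ℝ (Fin m))) (N n : ℕ) (ω : Ω) : 0 ≤ stayInd θ U N n ω :=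
  Set.indicator_nonneg (fun _ _ => zero_le_one) ω

theorem stayInd_le_one {Ω : Type*} {m : ℕ} (θ : ℕ → Ω → EuclideanSpace ℝ (Fin m))
    (U : Set (EuclideanSpace ℝ (Fin m))) (N n : ℕ) (ω : Ω) : stayInd θ U N n ω ≤ 1 :=
  Set.indicator_le' (fun _ _ => le_rfl) (fun _ _ => zero_le_one) ω

theorem stay_succ_subset {Ω : Type*} {m : ℕ} (θ : ℕ → Ω → EuclideanSpace ℝ (Fin m))
    (U : Set (EuclideanSpace ℝ (Fin m))) (N n : ℕ) : stay θ U N (n + 1) ⊆ stay θ U N n :=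
  fun _ hω k h1 h2 => hω k h1 (by omega)

/-- Here `y` is the excess, `a` the linear oracle term, `r` the Hölder remainder, `s` the rate and
`x` the norm of the oracle call. The a priori step bound `s x ≤ R` turns `r²`, of order `(s
x)^(2+2α)`, into `R^(2α) (s x)²`, so second moments suffice. -/
theorem sq_excess_step_le {y a r R M G x s α Λ : ℝ} (hy' : 0 ≤ y) (hx0 : 0 ≤ x) (hs : 0 ≤ s)
    (hα : 0 < α) (hΛ : 0 ≤ Λ) (hxR : s * x ≤ R) (ha : |a| ≤ s * (G * x))
    (hr : r = Λ * (s * x) ^ (1 + α))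
    (hα1 : α ≤ 1) (hM : M = 2 * G ^ 2 + 2 * Λ ^ 2 * R ^ (2 * α)) :
    (y + a + r) ^ 2 ≤
      y ^ 2 + 2 * (y * a) + (2 * Λ * s ^ (1 + α) * (y * (1 + x ^ 2)) + M * s ^ 2 * x ^ 2) := by
  have hsx : 0 ≤ s * x := by positivity
  have h1 : r ≤ Λ * s ^ (1 + α) * (1 + x ^ 2) := by
    rw [hr, Real.mul_rpow hs hx0, ← mul_assoc]
    gcongr
    exact rpow_one_add_le_one_add_sq hα1 hx0 hα
  have h2 : r ^ 2 ≤ Λ ^ 2 * R ^ (2 * α) * (s ^ 2 * x ^ 2) := by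
    have h3 : ((s * x) ^ (1 + α)) ^ 2 = (s * x) ^ (2 * α) * (s * x) ^ 2 := by
      rw [← Real.rpow_natCast, ← Real.rpow_mul hsx, ← Real.rpow_natCast (s * x) 2,
        ← Real.rpow_add_of_nonneg hsx (by positivity) (by positivity)]
      congr 1; push_cast; ring
    rw [hr, mul_pow, h3, mul_pow s x, mul_assoc]
    gcongr
  have h4 : a ^ 2 ≤ G ^ 2 * (s ^ 2 * x ^ 2) := by
    calc a ^ 2 = |a| ^ 2 := (sq_abs a).symm
      _ ≤ (s * (G * x)) ^ 2 := pow_le_pow_left₀ (abs_nonneg _) ha 2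
      _ = _ := by ring
  have h5 : y * r ≤ y * (Λ * s ^ (1 + α) * (1 + x ^ 2)) := by gcongr
  rw [hM]
  nlinarith [sq_nonneg (a - r)]

namespace IsSGD

variable {Ω : Type*} [mΩ : MeasurableSpace Ω] {μ : Measure Ω} [IsProbabilityMeasure μ]
  {ℱ : Filtration ℕ mΩ} {m d : ℕ} {F : EuclideanSpace ℝ (Fin m) → ℝ}
  {X : Ω → EuclideanSpace ℝ (Fin d)}
  {g : EuclideanSpace ℝ (Fin d) → EuclideanSpace ℝ (Fin m) → EuclideanSpace ℝ (Fin m)}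
  {L α C₀ κ c : ℝ} {γ : ℕ → ℝ} {ξ : ℕ → Ω → EuclideanSpace ℝ (Fin d)}
  {θ : ℕ → Ω → EuclideanSpace ℝ (Fin m)} {Fs : Ω → ℝ}
  {U : Set (EuclideanSpace ℝ (Fin m))}

theorem measurable_stayInd (S : IsSGD μ ℱ F X g L α C₀ κ c γ ξ θ) (hU : IsOpen U) (N n : ℕ) :
    Measurable[ℱ n] (stayInd θ U N n) := by
  refine measurable_const.indicator ?_
  have h : stay θ U N n = ⋂ k, ⋂ (_ : N ≤ k), ⋂ (_ : k ≤ n), θ k ⁻¹' U := by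
    ext ω; simp [stay]
  rw [h]
  refine MeasurableSet.iInter fun k => MeasurableSet.iInter fun _ => MeasurableSet.iInter fun hk => ?_
  exact ((S.adapted k).mono (ℱ.mono hk) le_rfl) hU.measurableSet

theorem measurable_excess (S : IsSGD μ ℱ F X g L α C₀ κ c γ ξ θ) (v : ℝ) :
    Measurable (excess F v) := (S.continuous.measurable.sub_const v).max measurable_const

theorem exists_bounds_on_bounded (S : IsSGD μ ℱ F X g L α C₀ κ c γ ξ θ)
    (hU : Bornology.IsBounded U) (v : ℝ) :
    ∃ R : ℝ, 0 < R ∧ ∀ x ∈ U, ‖gradient F x‖ ≤ R ∧ gap F x + 1 ≤ R ∧ excess F v x ≤ R ∧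
      ∀ y ∈ U, ‖y - x‖ ≤ R := by
  have hK : IsCompact (closure U) := hU.isCompact_closure
  have hgrad := continuous_gradient_of_holder S.smooth
  obtain ⟨R₁, h1⟩ := hK.exists_bound_of_continuousOn hgrad.continuousOn
  obtain ⟨R₂, h2⟩ := hK.exists_bound_of_continuousOn S.continuous.continuousOn
  obtain ⟨R₃, h3⟩ := Metric.isBounded_iff.1 hU
  refine ⟨|R₁| + (|R₂| + |⨅ y, F y| + |v| + 1) + |R₃|, by positivity, fun x hx => ?_⟩
  have e1 := h1 x (subset_closure hx)
  have e2 := h2 x (subset_closure hx)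
  have b1 := le_abs_self R₁
  have b2 := le_abs_self R₂
  have b3 := le_abs_self R₃
  have b4 := neg_abs_le (⨅ y, F y)
  have b5 := neg_abs_le v
  have b6 := abs_nonneg (⨅ y, F y)
  have b7 := abs_nonneg v
  have b8 := (Real.le_norm_self _).trans e2
  have b9 := abs_nonneg R₁
  have b10 := abs_nonneg R₂
  have b11 := abs_nonneg R₃
  refine ⟨by linarith, by unfold gap; linarith, max_le (by linarith) (by linarith),
    fun y hy => ?_⟩
  rw [← dist_eq_norm]
  linarith [h3 hy hx]

theorem sq_excess_succ_le (S : IsSGD μ ℱ F X g L α C₀ κ c γ ξ θ) {v R : ℝ} (hR : 0 < R)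
    (hb : ∀ x ∈ U, ‖gradient F x‖ ≤ R ∧ gap F x + 1 ≤ R ∧ excess F v x ≤ R ∧
      ∀ y ∈ U, ‖y - x‖ ≤ R) {N n : ℕ} (hn : N ≤ n) (ω : Ω) :
    stayInd θ U N (n + 1) ω * excess F v (θ (n + 1) ω) ^ 2 ≤
      stayInd θ U N n ω * excess F v (θ n ω) ^ 2
      - 2 * γ (n + 1) * (stayInd θ U N n ω * excess F v (θ n ω) *
          inner ℝ (gradient F (θ n ω)) (noisyGrad g ξ θ n ω))
      + (2 * (L / (1 + α)) * γ (n + 1) ^ (1 + α) * (stayInd θ U N n ω * excess F v (θ n ω) +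
          stayInd θ U N n ω * excess F v (θ n ω) * ‖noisyGrad g ξ θ n ω‖ ^ 2)
        + (2 * R ^ 2 + 2 * (L / (1 + α)) ^ 2 * R ^ (2 * α)) * γ (n + 1) ^ 2 *
          (stayInd θ U N n ω * ‖noisyGrad g ξ θ n ω‖ ^ 2)) := by
  have hL := S.smooth.L_pos
  have hα := S.smooth.α_pos
  have hγ := S.rates.pos (n + 1) (by omega)
  by_cases hω : ω ∈ stay θ U N n
  swap
  · have hω' : ω ∉ stay θ U N (n + 1) := fun h => hω (stay_succ_subset θ U N n h)
    simp [stayInd, hω, hω']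
  obtain ⟨hG, _, _, hstep⟩ := hb _ (hω n hn le_rfl)
  set y := excess F v (θ n ω) with hy
  have hy0 : 0 ≤ y := excess_nonneg F v _
  set x := ‖noisyGrad g ξ θ n ω‖ with hx
  set a := -(γ (n + 1) * inner ℝ (gradient F (θ n ω)) (noisyGrad g ξ θ n ω)) with ha
  have ha' : |a| ≤ γ (n + 1) * (R * x) := by
    rw [ha, abs_neg, abs_mul, abs_of_pos hγ]
    gcongr
    exact (abs_real_inner_le_norm _ _).trans (by gcongr)
  simp only [stayInd, Set.indicator_of_mem hω, one_mul]
  have hrew : y ^ 2 - 2 * γ (n + 1) * (y * inner ℝ (gradient F (θ n ω)) (noisyGrad g ξ θ n ω)) =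
      y ^ 2 + 2 * (y * a) := by rw [ha]; ring
  rw [hrew]
  by_cases hω' : ω ∈ stay θ U N (n + 1)
  · rw [Set.indicator_of_mem hω', one_mul]
    have hx' : γ (n + 1) * x ≤ R := by
      have h1 := hstep _ (hω' (n + 1) (by omega) le_rfl)
      rwa [S.step_noisyGrad, sub_sub_cancel_left, norm_neg, norm_smul,
        Real.norm_of_nonneg hγ.le] at h1
    have h2 := sq_excess_step_le (y := y) (α := α) (Λ := L / (1 + α)) hy0 (norm_nonneg _) hγ.le hα
      (by positivity) hx' ha' rfl S.smooth.α_le_one rfl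
    refine le_trans ?_ (h2.trans (le_of_eq (by ring)))
    -- The positive part of a number bounded by `y + a + r` is at most `|y + a + r|`, whatever the
    -- sign.
    refine pow_le_pow_left₀ (excess_nonneg _ _ _) ?_ 2 |>.trans (sq_abs _).le
    have h3 := S.gap_step_le n ω
    have h4 : F (θ n ω) - v ≤ y := le_max_left _ _
    refine max_le (le_trans ?_ (le_abs_self _)) (abs_nonneg _)
    unfold gap at h3
    rw [ha]
    linarith
  -- On exit from `U` the left side vanishes, and the right side dominates `(y + a)²` since its last
  -- term covers `a²`. Leaving `U` therefore costs nothing.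
  · rw [Set.indicator_of_notMem hω', zero_mul]
    have h5 : a ^ 2 ≤ R ^ 2 * (γ (n + 1) ^ 2 * x ^ 2) := by
      calc a ^ 2 = |a| ^ 2 := (sq_abs a).symm
        _ ≤ (γ (n + 1) * (R * x)) ^ 2 := pow_le_pow_left₀ (abs_nonneg _) ha' 2
        _ = _ := by ring
    have h6 : 0 ≤ 2 * (L / (1 + α)) * γ (n + 1) ^ (1 + α) * (y + y * x ^ 2) := by positivity
    have h7 : 0 ≤ 2 * (L / (1 + α)) ^ 2 * R ^ (2 * α) * (γ (n + 1) ^ 2 * x ^ 2) := by positivity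
    have h8 : 0 ≤ R ^ 2 * (γ (n + 1) ^ 2 * x ^ 2) := by positivity
    nlinarith [sq_nonneg (y + a)]

/-- The recursion satisfied by the mean squared excess. -/
theorem exists_localError_succ_le (S : IsSGD μ ℱ F X g L α C₀ κ c γ ξ θ) {v β ζ : ℝ}
    (hU : IsOpen U) (hUb : Bornology.IsBounded U) (hζ : 0 < ζ) (hβ : 0 < β)
    (hloj : ∀ y ∈ U, |F y - v| ^ β ≤ ζ * ‖gradient F y‖) (N : ℕ) :
    ∃ K : ℝ, 0 < K ∧ ∀ n, N ≤ n → ∀ h e η : ℝ, 0 ≤ e → 0 < η →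
      (∀ y, 0 ≤ y → h * y ^ 2 - e ≤ 2 * κ / ζ ^ 2 * (y ^ 2) ^ (β + 1 / 2)) →
      localError μ F θ U v N (n + 1) ≤ (1 - (h - η) * γ (n + 1)) * localError μ F θ U v N n
        + γ (n + 1) * (e + K * γ (n + 1) ^ (2 * α) / η + K * γ (n + 1)) := by
  have hL := S.smooth.L_pos
  have hα := S.smooth.α_pos
  have hκ := S.oracle.κ_pos
  have hC := S.oracle.C_pos
  obtain ⟨R, hR, hb⟩ := S.exists_bounds_on_bounded hUb v
  set Λ := L / (1 + α) with hΛ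
  have hΛ0 : 0 < Λ := by positivity
  set K₁ := 2 * Λ * (1 + C₀ * R) with hK₁
  set K₂ := (2 * R ^ 2 + 2 * Λ ^ 2 * R ^ (2 * α)) * (C₀ * R) with hK₂
  have hK₁0 : 0 < K₁ := by positivity
  have hK₂0 : 0 < K₂ := by positivity
  -- The linear minorant `(h, e)` of the drift and the share `η` given up to the remainder stay
  -- free, with `K` independent of them and of `n`: the two regimes choose them differently, one of
  -- them depending on `n`.
  refine ⟨K₁ ^ 2 + K₂, by positivity, fun n hn h e η he hη hpow => ?_⟩
  have hγ := S.rates.pos (n + 1) (by omega)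
  set s := γ (n + 1) with hs
  set ψ := stayInd θ U N n with hψdef
  have hψ0 : ∀ ω, 0 ≤ ψ ω := stayInd_nonneg θ U N n
  have hψ1 : ∀ ω, ψ ω ≤ 1 := stayInd_le_one θ U N n
  have hψm : Measurable[ℱ n] ψ := S.measurable_stayInd hU N n
  set Y : Ω → ℝ := fun ω => excess F v (θ n ω) with hY
  have hY0 : ∀ ω, 0 ≤ Y ω := fun ω => excess_nonneg F v _
  have hYm : Measurable[ℱ n] Y := (S.measurable_excess v).comp (S.adapted n)
  set φ : Ω → ℝ := fun ω => ψ ω * Y ω with hφ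
  have hφm : Measurable[ℱ n] φ := hψm.mul hYm
  have hφ0 : ∀ ω, 0 ≤ φ ω := fun ω => mul_nonneg (hψ0 ω) (hY0 ω)
  have hcase : ∀ ω, ψ ω = 0 ∨ (ψ ω = 1 ∧ θ n ω ∈ U) := by
    intro ω
    by_cases hω : ω ∈ stay θ U N n
    · exact Or.inr ⟨Set.indicator_of_mem hω _, hω n hn le_rfl⟩
    · exact Or.inl (Set.indicator_of_notMem hω _)
  have hφR : ∀ ω, φ ω ≤ R := by
    intro ω
    rcases hcase ω with h0 | ⟨h1, hω⟩
    · simp only [hφ, h0, zero_mul]; exact hR.le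
    · simp only [hφ, h1, one_mul]; exact (hb _ hω).2.2.1
  have hψint : Integrable ψ μ := by
    simpa using integrable_weight_mul (μ := μ) (hψm.mono (ℱ.le n) le_rfl) hψ0 hψ1
      (integrable_const 1)
  have hφint : Integrable φ μ := by
    simpa using integrable_weight_mul (μ := μ) (hφm.mono (ℱ.le n) le_rfl) hφ0 hφR
      (integrable_const 1)
  have hgap1 : Integrable (fun ω => gap F (θ n ω) + 1) μ :=
    (S.integrable_gap n).add (integrable_const 1)
  have hψgap := integrable_weight_mul (hψm.mono (ℱ.le n) le_rfl) hψ0 hψ1 hgap1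
  have hφgap := integrable_weight_mul (hφm.mono (ℱ.le n) le_rfl) hφ0 hφR hgap1
  obtain ⟨hψg, hψg2⟩ := S.integrable_mul_noisyGrad_sq hψm hψ0 hψgap
  obtain ⟨hφg, hφg2⟩ := S.integrable_mul_noisyGrad_sq hφm hφ0 hφgap
  obtain ⟨hin, hin2⟩ := S.integral_weight_inner_ge hφm hφ0 hφR
  have hφG := integrable_weight_mul (hφm.mono (ℱ.le n) le_rfl) hφ0 hφR (S.integrable_gradient_sq n)
  have hYsq : Integrable (fun ω => ψ ω * Y ω ^ 2) μ := by
    have hφY : ∀ ω, ψ ω * Y ω ^ 2 = φ ω * φ ω := by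
      intro ω
      rcases hcase ω with h0 | ⟨h1, _⟩
      · simp [hφ, h0]
      · simp only [hφ, h1]; ring
    simp only [hφY]
    exact integrable_weight_mul (hφm.mono (ℱ.le n) le_rfl) hφ0 hφR hφint
  have hz : localError μ F θ U v N n = ∫ ω, ψ ω * Y ω ^ 2 ∂μ := rfl
  -- integrate the pathwise bound
  have hφadd : Integrable (fun ω => φ ω + φ ω * ‖noisyGrad g ξ θ n ω‖ ^ 2) μ := hφint.add hφg
  set M := 2 * R ^ 2 + 2 * Λ ^ 2 * R ^ (2 * α) with hM
  have hrem : Integrable (fun ω => 2 * Λ * s ^ (1 + α) *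
      (φ ω + φ ω * ‖noisyGrad g ξ θ n ω‖ ^ 2) + M * s ^ 2 * (ψ ω * ‖noisyGrad g ξ θ n ω‖ ^ 2)) μ :=
    (hφadd.const_mul _).add (hψg.const_mul _)
  have h1 : localError μ F θ U v N (n + 1) ≤ ∫ ω, (ψ ω * Y ω ^ 2
      - 2 * s * (φ ω * inner ℝ (gradient F (θ n ω)) (noisyGrad g ξ θ n ω))
      + 1 * (2 * Λ * s ^ (1 + α) * (φ ω + φ ω * ‖noisyGrad g ξ θ n ω‖ ^ 2)
        + M * s ^ 2 * (ψ ω * ‖noisyGrad g ξ θ n ω‖ ^ 2))) ∂μ := by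
    refine integral_mono_of_nonneg (ae_of_all _ fun ω =>
      mul_nonneg (stayInd_nonneg θ U N (n + 1) ω) (sq_nonneg _))
      (integrable_affine hYsq hin hrem _ _) (ae_of_all _ fun ω => ?_)
    simp only [one_mul]
    exact S.sq_excess_succ_le hR hb hn ω
  rw [integral_affine hYsq hin hrem, integral_add (hφadd.const_mul _) (hψg.const_mul _),
    integral_const_mul, integral_const_mul, integral_add hφint hφg, ← hz, one_mul] at h1
  -- bounds on `U`
  have hψgapR : ∫ ω, ψ ω * (gap F (θ n ω) + 1) ∂μ ≤ R := by
    have : ∫ ω, ψ ω * (gap F (θ n ω) + 1) ∂μ ≤ ∫ _, R ∂μ := by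
      refine integral_mono hψgap (integrable_const R) fun ω => ?_
      rcases hcase ω with h0 | ⟨h1, hω⟩
      · simp only [h0, zero_mul]; exact hR.le
      · simp only [h1, one_mul]; exact (hb _ hω).2.1
    simpa using this
  have hφgapR : ∫ ω, φ ω * (gap F (θ n ω) + 1) ∂μ ≤ R * ∫ ω, φ ω ∂μ := by
    rw [← integral_const_mul]
    refine integral_mono hφgap (hφint.const_mul R) fun ω => ?_
    rcases hcase ω with h0 | ⟨h1, hω⟩
    · simp [hφ, h0]
    · have := mul_le_mul_of_nonneg_left (hb _ hω).2.1 (hφ0 ω)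
      simp only
      linarith
  have h2 : 2 * Λ * s ^ (1 + α) * (∫ ω, φ ω ∂μ + ∫ ω, φ ω * ‖noisyGrad g ξ θ n ω‖ ^ 2 ∂μ) ≤
      K₁ * s ^ (1 + α) * ∫ ω, φ ω ∂μ := by
    have : ∫ ω, φ ω ∂μ + ∫ ω, φ ω * ‖noisyGrad g ξ θ n ω‖ ^ 2 ∂μ ≤
        (1 + C₀ * R) * ∫ ω, φ ω ∂μ := by
      have := mul_le_mul_of_nonneg_left hφgapR hC.le
      linarith
    calc _ ≤ 2 * Λ * s ^ (1 + α) * ((1 + C₀ * R) * ∫ ω, φ ω ∂μ) := by gcongr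
      _ = _ := by rw [hK₁]; ring
  have h3 : M * s ^ 2 * ∫ ω, ψ ω * ‖noisyGrad g ξ θ n ω‖ ^ 2 ∂μ ≤ K₂ * s ^ 2 := by
    have : ∫ ω, ψ ω * ‖noisyGrad g ξ θ n ω‖ ^ 2 ∂μ ≤ C₀ * R :=
      hψg2.trans (by gcongr)
    calc _ ≤ M * s ^ 2 * (C₀ * R) := by gcongr
      _ = _ := by rw [hK₂]; ring
  -- the drift
  have h4 : h * localError μ F θ U v N n - e ≤ 2 * κ * ∫ ω, φ ω * ‖gradient F (θ n ω)‖ ^ 2 ∂μ := by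
    have h5 : ∫ ω, (h * (ψ ω * Y ω ^ 2) - e) ∂μ ≤
        ∫ ω, 2 * κ * (φ ω * ‖gradient F (θ n ω)‖ ^ 2) ∂μ := by
      refine integral_mono ((hYsq.const_mul h).sub (integrable_const e)) (hφG.const_mul _) fun ω => ?_
      rcases hcase ω with h0 | ⟨h1, hω⟩
      · simp only [hφ, h0]; linarith
      · simp only [hφ, h1, one_mul]
        refine (hpow (Y ω) (hY0 ω)).trans ?_
        rcases (hY0 ω).eq_or_lt with hy | hy
        · rw [← hy, zero_pow two_ne_zero, Real.zero_rpow (by positivity)]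
          simp
        · have hyF : |F (θ n ω) - v| = Y ω := by
            have : Y ω = F (θ n ω) - v := by
              rcases max_choice (F (θ n ω) - v) 0 with hm | hm
              · exact hm
              · exact absurd hm hy.ne'
            rw [← this, abs_of_pos hy]
          have h6 := hloj _ hω
          rw [hyF] at h6
          -- One factor of the excess comes from differentiating the square, two factors `Y^β` from
          -- the Łojasiewicz inequality; hence the exponent `β + 1/2` for the squared excess.
          have h7 : (Y ω ^ 2) ^ (β + 1 / 2) = Y ω * (Y ω ^ β) ^ 2 := by
            rw [← Real.rpow_natCast, ← Real.rpow_mul hy.le, ← Real.rpow_natCast (Y ω ^ β),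
              ← Real.rpow_mul hy.le, ← Real.rpow_one_add' hy.le (by positivity)]
            congr 1; push_cast; ring
          have h8 : (Y ω ^ β) ^ 2 ≤ (ζ * ‖gradient F (θ n ω)‖) ^ 2 :=
            pow_le_pow_left₀ (by positivity) h6 2
          rw [h7]
          calc 2 * κ / ζ ^ 2 * (Y ω * (Y ω ^ β) ^ 2)
              ≤ 2 * κ / ζ ^ 2 * (Y ω * (ζ * ‖gradient F (θ n ω)‖) ^ 2) := by gcongr
            _ = _ := by field_simp
    rw [integral_sub (hYsq.const_mul h) (integrable_const e), integral_const_mul,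
      integral_const_mul] at h5
    rw [hz]
    simpa using h5
  -- the linear error term
  have h9 : K₁ * s ^ α * ∫ ω, φ ω ∂μ ≤
      η * localError μ F θ U v N n + K₁ ^ 2 * s ^ (2 * α) / η := by
    have h10 : ∫ ω, K₁ * s ^ α * φ ω ∂μ ≤
        ∫ ω, (η * (ψ ω * Y ω ^ 2) + K₁ ^ 2 * s ^ (2 * α) / η) ∂μ := by
      refine integral_mono (hφint.const_mul _) ((hYsq.const_mul η).add (integrable_const _))
        fun ω => ?_
      have hq : 0 ≤ K₁ ^ 2 * s ^ (2 * α) / η := by positivity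
      rcases hcase ω with h0 | ⟨h1, _⟩
      · simp only [hφ, h0, zero_mul, mul_zero, zero_add]; exact hq
      · simp only [hφ, h1, one_mul]
        have hs2 : s ^ (2 * α) = (s ^ α) ^ 2 := by
          rw [mul_comm, Real.rpow_mul hγ.le, Real.rpow_two]
        rw [hs2, ← mul_pow]
        set b := K₁ * s ^ α with hbdef
        have h11 : b ^ 2 / η * η = b ^ 2 := by field_simp
        have h12 : 0 ≤ η * (Y ω - b / (2 * η)) ^ 2 := by positivity
        have h13 : η * (Y ω - b / (2 * η)) ^ 2 = η * Y ω ^ 2 - b * Y ω + b ^ 2 / η / 4 := by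
          field_simp
          ring
        have h14 : 0 ≤ b ^ 2 / η := by positivity
        linarith
    rw [integral_const_mul, integral_add (hYsq.const_mul η) (integrable_const _),
      integral_const_mul] at h10
    rw [hz]
    simpa using h10
  have hs1 : s ^ (1 + α) = s * s ^ α := by
    rw [Real.rpow_add hγ, Real.rpow_one]
  have h15 := mul_le_mul_of_nonneg_left h9 hγ.le
  have h16 := mul_le_mul_of_nonneg_left h4 hγ.le
  have h17 := mul_le_mul_of_nonneg_left hin2 (by positivity : 0 ≤ 2 * s)
  rw [hs1] at h1 h2
  have h18 : s * (K₁ ^ 2 * s ^ (2 * α) / η) + K₂ * s ^ 2 ≤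
      s * ((K₁ ^ 2 + K₂) * s ^ (2 * α) / η + (K₁ ^ 2 + K₂) * s) := by
    have e1 : 0 ≤ s * (K₂ * s ^ (2 * α) / η) := by positivity
    have e2 : 0 ≤ s * (K₁ ^ 2 * s) := by positivity
    have e3 : (K₁ ^ 2 + K₂) * s ^ (2 * α) / η =
      K₁ ^ 2 * s ^ (2 * α) / η + K₂ * s ^ (2 * α) / η := by ring
    rw [e3]
    nlinarith
  linarith

end IsSGD

/-! ### Rates for the last iterate -/

theorem exists_forall_le_of_eventually {z w : ℕ → ℝ} {n₀ : ℕ} (hw : ∀ n, n₀ ≤ n → 0 < w n)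
    (h : ∃ C : ℝ, ∀ᶠ n in atTop, z n ≤ C * w n) :
    ∃ C : ℝ, 0 < C ∧ ∀ n, n₀ ≤ n → z n ≤ C * w n := by
  obtain ⟨C, hC⟩ := h
  obtain ⟨N, hN⟩ := eventually_atTop.1 hC
  obtain ⟨M, hM⟩ := ((Finset.range N).finite_toSet.image fun n => z n / w n).bddAbove
  refine ⟨max 1 (max C M), by positivity, fun n hn => ?_⟩
  have hwn := hw n hn
  rcases le_or_gt N n with h | h
  · refine (hN n h).trans ?_
    gcongr
    exact (le_max_left _ _).trans (le_max_right _ _)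
  · have h1 : z n / w n ≤ M := hM ⟨n, by simpa using h, rfl⟩
    rw [← div_le_iff₀ hwn]
    exact h1.trans ((le_max_right _ _).trans (le_max_right _ _))

section Rates

variable {γ : ℕ → ℝ} {α ρ β : ℝ}

theorem eventually_partialSum_rpow_le (hγ : StepSizes γ α) (hα : 0 < α) {q : ℝ} (hq : 0 < q) :
    ∀ᶠ n in atTop, partialSum γ n ^ (-q) ≤ 2 ^ q * partialSum γ (n + 1) ^ (-q) := by
  have hsmall := ((hγ.tendsto_zero hα).comp (tendsto_add_atTop_nat 1)).eventually
    (eventually_le_nhds one_pos)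
  filter_upwards [hsmall, hγ.diverges.eventually (eventually_ge_atTop 1)] with n h1 h2
  simp only [Function.comp_apply] at h1
  have hT : 0 < partialSum γ n := by linarith
  have hT1 := hγ.partialSum_pos n
  have h3 : partialSum γ (n + 1) ≤ 2 * partialSum γ n := by rw [partialSum_succ]; linarith
  have h4 : partialSum γ (n + 1) ^ q ≤ 2 ^ q * partialSum γ n ^ q := by
    rw [← Real.mul_rpow (by norm_num) hT.le]
    exact Real.rpow_le_rpow hT1.le h3 hq.le
  rw [Real.rpow_neg hT.le, Real.rpow_neg hT1.le, ← div_eq_mul_inv, le_div_iff₀ (by positivity),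
    inv_mul_eq_div, div_le_iff₀ (by positivity)]
  exact h4

theorem SGD.RefinedStepSizes.one_lt_mul (hr : RefinedStepSizes γ α ρ) (hα : 0 < α) : 1 < α * ρ := by
  have := hr.ρ_gt
  rw [div_lt_iff₀ hα] at this
  linarith

theorem localExponent_pos (hr : RefinedStepSizes γ α ρ) (hα : 0 < α) (hα1 : α ≤ 1)
    (hβ : 1 / 2 < β) : 0 < localExponent α ρ β := by
  have h1 := hr.one_lt_mul hα
  have h2 : 1 < ρ := lt_of_le_of_lt (by rw [le_div_iff₀ hα]; linarith) hr.ρ_gt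
  refine lt_min (div_pos one_pos (by linarith)) (lt_min (by linarith) (by linarith))

theorem globalExponent_pos (hr : RefinedStepSizes γ α ρ) (hα : 0 < α) (hβ : 1 / 2 < β) :
    0 < globalExponent α ρ β := by
  have h1 := hr.one_lt_mul hα
  exact lt_min (div_pos one_pos (by linarith)) (by linarith)

theorem exists_rate_le (hγ : StepSizes γ α) (hr : RefinedStepSizes γ α ρ) :
    ∃ M : ℝ, 0 < M ∧ ∀ᶠ n : ℕ in atTop, γ (n + 1) ≤ M * partialSum γ (n + 1) ^ (-ρ) := by
  obtain ⟨M, hM, h⟩ := hr.bigO.exists_pos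
  refine ⟨M, hM, ((tendsto_add_atTop_nat 1).eventually h.bound).mono fun n hn => ?_⟩
  have hT := hγ.partialSum_pos n
  rw [Real.norm_of_nonneg (by positivity : 0 ≤ partialSum γ (n + 1) ^ (-ρ))] at hn
  exact (Real.le_norm_self _).trans hn

end Rates

namespace IsSGD

variable {Ω : Type*} [mΩ : MeasurableSpace Ω] {μ : Measure Ω} [IsProbabilityMeasure μ]
  {ℱ : Filtration ℕ mΩ} {m d : ℕ} {F : EuclideanSpace ℝ (Fin m) → ℝ}
  {X : Ω → EuclideanSpace ℝ (Fin d)}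
  {g : EuclideanSpace ℝ (Fin d) → EuclideanSpace ℝ (Fin m) → EuclideanSpace ℝ (Fin m)}
  {L α C₀ κ c : ℝ} {γ : ℕ → ℝ} {ξ : ℕ → Ω → EuclideanSpace ℝ (Fin d)}
  {θ : ℕ → Ω → EuclideanSpace ℝ (Fin m)} {Fs : Ω → ℝ}
  {U : Set (EuclideanSpace ℝ (Fin m))}

theorem localError_le_rate (S : IsSGD μ ℱ F X g L α C₀ κ c γ ξ θ) {v ζ τ : ℝ}
    (hU : IsOpen U) (hUb : Bornology.IsBounded U) (hζ : 0 < ζ)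
    (hloj : ∀ y ∈ U, |F y - v| ^ (1 / 2 : ℝ) ≤ ζ * ‖gradient F y‖) (hτ : 0 < τ)
    (hdecay : ∀ᶠ n : ℕ in atTop, γ n ≤ Real.exp (τ * γ (n + 1)) * γ (n + 1))
    (hτκ : min 1 (2 * α) * τ < 2 * κ / ζ ^ 2) (N : ℕ) :
    ∃ C : ℝ, 0 < C ∧ ∀ᶠ n in atTop, localError μ F θ U v N n ≤ C * γ n ^ min 1 (2 * α) := by
  have hα := S.smooth.α_pos
  obtain ⟨K, hK, hrec⟩ := S.exists_localError_succ_le hU hUb hζ one_half_pos hloj N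
  set p := min 1 (2 * α) with hp
  have hp0 : 0 < p := lt_min one_pos (by positivity)
  set H := 2 * κ / ζ ^ 2 with hH
  -- For `β = 1/2` the drift is exactly linear (`e = 0`); half of the margin over `p τ` is given to
  -- `η`.
  set η := (H - p * τ) / 2 with hη
  have hη0 : 0 < η := by rw [hη]; linarith
  refine eventually_le_rate_rpow S.rates hα (h := H - η) (τ := τ) (K := K / η + K) hp0 hτ
    (by positivity) (by rw [hη]; linarith) hdecay ?_
  have hsmall := ((S.rates.tendsto_zero hα).comp (tendsto_add_atTop_nat 1)).eventually
    (eventually_le_nhds one_pos)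
  filter_upwards [hsmall, eventually_ge_atTop N] with n h1 hn
  simp only [Function.comp_apply] at h1
  have hγ := S.rates.pos (n + 1) (by omega)
  refine (hrec n hn H 0 η le_rfl hη0 fun y _ => ?_).trans ?_
  · norm_num
  · have h2 : γ (n + 1) ^ (2 * α) ≤ γ (n + 1) ^ p :=
      Real.rpow_le_rpow_of_exponent_ge hγ h1 (min_le_right _ _)
    have h3 : γ (n + 1) ≤ γ (n + 1) ^ p := by
      conv_lhs => rw [← Real.rpow_one (γ (n + 1))]
      exact Real.rpow_le_rpow_of_exponent_ge hγ h1 (min_le_left _ _)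
    have h4 : γ (n + 1) * (0 + K * γ (n + 1) ^ (2 * α) / η + K * γ (n + 1)) ≤
        γ (n + 1) * (0 + K * γ (n + 1) ^ p / η + K * γ (n + 1) ^ p) := by gcongr
    have h5 : γ (n + 1) * (0 + K * γ (n + 1) ^ p / η + K * γ (n + 1) ^ p) =
        (K / η + K) * (γ (n + 1) * γ (n + 1) ^ p) := by ring
    linarith

theorem localError_le_partialSum (S : IsSGD μ ℱ F X g L α C₀ κ c γ ξ θ) {v β ζ ρ : ℝ}
    (hU : IsOpen U) (hUb : Bornology.IsBounded U) (hζ : 0 < ζ) (hβ : 1 / 2 < β)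
    (hloj : ∀ y ∈ U, |F y - v| ^ β ≤ ζ * ‖gradient F y‖) (hr : RefinedStepSizes γ α ρ) (N : ℕ) :
    ∃ C : ℝ, 0 < C ∧ ∀ᶠ n in atTop,
      localError μ F θ U v N n ≤ C * partialSum γ n ^ (-(2 * localExponent α ρ β)) := by
  have hα := S.smooth.α_pos
  have hκ := S.oracle.κ_pos
  have hr0 := localExponent_pos hr hα S.smooth.α_le_one hβ
  set r := localExponent α ρ β with hrdef
  have hr1 : r ≤ 1 / (2 * β - 1) := min_le_left _ _
  have hr2 : r ≤ α * ρ - 1 := (min_le_right _ _).trans (min_le_left _ _)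
  have hr3 : r ≤ (ρ - 1) / 2 := (min_le_right _ _).trans (min_le_right _ _)
  obtain ⟨K, hK, hrec⟩ := S.exists_localError_succ_le hU hUb hζ (by linarith) hloj N
  obtain ⟨M, hM, hrate⟩ := exists_rate_le S.rates hr
  have hq : 2 * r ≤ 1 / (β + 1 / 2 - 1) := by
    have : 1 / (β + 1 / 2 - 1) = 2 * (1 / (2 * β - 1)) := by
      have : 2 * β - 1 ≠ 0 := by linarith
      have : β + 1 / 2 - 1 ≠ 0 := by linarith
      field_simp
      ring
    rw [this]; linarith
  -- Slope `(2r + 2) / T`, of which `1 / T` goes to `η`: the contraction `(2r + 1) / T` still beats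
  -- the decay `2r / T` of the target.
  obtain ⟨K₀, hK₀, hlin⟩ := exists_linear_le_rpow (Q := β + 1 / 2) (c := 2 * κ / ζ ^ 2)
    (b := 2 * r + 2) (q := 2 * r) (by linarith) (by positivity) (by positivity) hq
  refine eventually_le_partialSum_rpow S.rates hα (b := 2 * r + 1)
    (K := K₀ + (K * M ^ (2 * α) + K * M)) (by positivity) (by positivity) (by linarith) ?_
  filter_upwards [hrate, eventually_ge_atTop N,
    S.rates.diverges.eventually (eventually_ge_atTop 1)] with n h1 hn hT
  have hγ := S.rates.pos (n + 1) (by omega)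
  set s := γ (n + 1) with hs
  set T := partialSum γ n with hTdef
  set T' := partialSum γ (n + 1) with hT'def
  have hT0 : 0 < T := by linarith
  have hTT' : T ≤ T' := S.rates.monotone_partialSum (Nat.le_succ n)
  have hT'1 : 1 ≤ T' := hT.trans hTT'
  have hT'0 : 0 < T' := by linarith
  have h2 := hrec n hn ((2 * r + 2) / T) (K₀ * (T⁻¹ * T ^ (-(2 * r)))) (1 / T) (by positivity)
    (by positivity) (fun y _ => hlin T (y ^ 2) hT (sq_nonneg y))
  have e1 : (2 * r + 2) / T - 1 / T = (2 * r + 1) / T := by rw [← sub_div]; ring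
  rw [e1] at h2
  refine h2.trans ?_
  -- With `γ = O(T^(-ρ))`, this bound amounts to `r ≤ αρ - 1` and the next one to `r ≤ (ρ - 1) / 2`.
  -- The remaining condition `r ≤ 1 / (2β - 1)` was used for the tangent line.
  have h3 : s ^ (2 * α) * T * T ≤ M ^ (2 * α) * T' ^ (-(2 * r)) := by
    calc s ^ (2 * α) * T * T ≤ (M * T' ^ (-ρ)) ^ (2 * α) * T' * T' := by gcongr
      _ = M ^ (2 * α) * (T' ^ (-ρ * (2 * α)) * T' * T') := by
          rw [Real.mul_rpow hM.le (by positivity), ← Real.rpow_mul hT'0.le]; ring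
      _ = M ^ (2 * α) * T' ^ (-ρ * (2 * α) + 1 + 1) := by
          rw [Real.rpow_add hT'0, Real.rpow_add hT'0, Real.rpow_one]
      _ ≤ _ := by
          gcongr
          linarith
  have h4 : s * T ≤ M * T' ^ (-(2 * r)) := by
    calc s * T ≤ M * T' ^ (-ρ) * T' := by gcongr
      _ = M * T' ^ (-ρ + 1) := by rw [Real.rpow_add hT'0, Real.rpow_one]; ring
      _ ≤ _ := by
          gcongr
          linarith
  have h5 : K * s ^ (2 * α) / (1 / T) ≤ K * M ^ (2 * α) * (T⁻¹ * T' ^ (-(2 * r))) := by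
    have : K * s ^ (2 * α) / (1 / T) = K * T⁻¹ * (s ^ (2 * α) * T * T) := by field_simp
    rw [this]
    calc _ ≤ K * T⁻¹ * (M ^ (2 * α) * T' ^ (-(2 * r))) := by gcongr
      _ = _ := by ring
  have h6 : K * s ≤ K * M * (T⁻¹ * T' ^ (-(2 * r))) := by
    have : K * s = K * T⁻¹ * (s * T) := by field_simp
    rw [this]
    calc _ ≤ K * T⁻¹ * (M * T' ^ (-(2 * r))) := by gcongr
      _ = _ := by ring
  have h7 : s * (K₀ * (T⁻¹ * T ^ (-(2 * r))) + K * s ^ (2 * α) / (1 / T) + K * s) ≤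
      s * (K₀ * (T⁻¹ * T ^ (-(2 * r))) + K * M ^ (2 * α) * (T⁻¹ * T' ^ (-(2 * r)))
        + K * M * (T⁻¹ * T' ^ (-(2 * r)))) := by gcongr
  have h8 : 0 ≤ s * T⁻¹ * (K₀ * T' ^ (-(2 * r)) +
      (K * M ^ (2 * α) + K * M) * T ^ (-(2 * r))) := by positivity
  rw [div_eq_mul_inv s T]
  nlinarith

/-- Local bounds on the excess give a bound in probability on the last iterate. -/
theorem last_iterate_of_localError (S : IsSGD μ ℱ F X g L α C₀ κ c γ ξ θ) (hcoer : Coercive F)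
    (hreg : ∀ᵐ ω ∂μ, RegularPath F γ (fun n => θ n ω) (Fs ω)) {δ l β ζ : ℝ}
    (hl : ENNReal.ofReal (1 - δ) < μ {ω | Fs ω ≤ l}) (hβ : 0 < β)
    (hloj : LojasiewiczOn F (sublevel F l) β ζ) {w : ℕ → ℝ} (hw : ∀ n, 0 ≤ w n)
    (herr : ∀ (U : Set (EuclideanSpace ℝ (Fin m))) (v : ℝ), IsOpen U → Bornology.IsBounded U →
      (∀ y ∈ U, |F y - v| ^ β ≤ ζ * ‖gradient F y‖) → ∀ N, ∃ C : ℝ, ∀ᶠ n in atTop,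
        w n ^ 2 * localError μ F θ U v N n ≤ C) :
    ∃ C : ℝ, 0 < C ∧ ∀ n, WithProb μ δ fun ω => (F (θ n ω) - Fs ω) * w n ≤ C := by
  set V := F '' (sublevel F l ∩ {x | gradient F x = 0}) with hV
  have hVfin : V.Finite :=
    finite_critical_values S.smooth (isCompact_sublevel S.smooth hcoer l) hβ hloj
  have : Countable V := hVfin.countable
  have hVl : ∀ v ∈ V, v ≤ l := by
    rintro _ ⟨x, hx, rfl⟩
    exact hx.1
  choose! W hWo hWb hWc hWle using fun v (hv : v ∈ V) =>
    exists_isOpen_lojasiewicz S.smooth hcoer (hVl v hv) hloj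
  -- Pieces are indexed by the limiting critical value, the time from which the path stays in the
  -- neighbourhood of that level, and an integer bound on the whole path.
  have hcover : ∀ᵐ ω ∂μ, ω ∈ {ω | Fs ω ≤ l} → ∃ i : V × ℕ × ℕ,
      ω ∈ {ω | Fs ω = i.1 ∧ (∀ k, i.2.1 ≤ k → θ k ω ∈ W i.1) ∧
        ∀ n, F (θ n ω) - Fs ω ≤ i.2.2} := by
    filter_upwards [hreg] with ω hω hωl
    obtain ⟨x, hx, hxF⟩ := hω.exists_critical S.smooth hcoer
    have hmem : Fs ω ∈ V := ⟨x, ⟨hxF.le.trans hωl, hx⟩, hxF⟩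
    obtain ⟨N, hN⟩ := eventually_atTop.1
      (hω.eventually_mem S.smooth hcoer (hWo _ hmem) (hWc _ hmem))
    obtain ⟨B, hB⟩ := hω.tendsto.bddAbove_range
    obtain ⟨J, hJ⟩ := exists_nat_ge (B - Fs ω)
    refine ⟨⟨⟨Fs ω, hmem⟩, N, J⟩, rfl, hN, fun n => ?_⟩
    have := hB ⟨n, rfl⟩
    exact le_trans (by linarith) hJ
  refine exists_withProb_of_cover hl _ hcover (fun n ω => (F (θ n ω) - Fs ω) * w n) ?_
  rintro ⟨⟨v, hv⟩, N, J⟩ η hη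
  obtain ⟨C, hC⟩ := herr (W v) v (hWo v hv) (hWb v hv) (hWle v hv) N
  obtain ⟨N', hN'⟩ := eventually_atTop.1 hC
  obtain ⟨M, hM⟩ := ((Finset.range (max N N')).finite_toSet.image w).bddAbove
  obtain ⟨η', hη'0, hη'⟩ := ENNReal.lt_iff_exists_nnreal_btwn.1 hη
  have hη'pos : (0 : ℝ) < η' := by exact_mod_cast hη'0
  -- `J * M` settles the finitely many early indices surely, `|C| / η'` is the Markov threshold, and
  -- `A ≥ 1` gives `A ≤ A²` when the squared error is compared with `A`.
  set A := max 1 (max (J * M) (|C| / η')) with hA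
  have hA1 : 1 ≤ A := le_max_left _ _
  have hAJ : J * M ≤ A := (le_max_left _ _).trans (le_max_right _ _)
  have hAC : |C| / η' ≤ A := (le_max_right _ _).trans (le_max_right _ _)
  refine ⟨A, fun n => ?_⟩
  rcases lt_or_ge n (max N N') with hn | hn
  · refine (measure_mono_null (t := ∅) (fun ω hω => ?_) measure_empty).le.trans bot_le
    obtain ⟨⟨_, _, h3⟩, h4⟩ := hω
    refine absurd h4 (not_lt.2 (le_trans ?_ hAJ))
    have h5 : w n ≤ M := hM ⟨n, by simpa using hn, rfl⟩
    calc (F (θ n ω) - Fs ω) * w n ≤ J * w n := mul_le_mul_of_nonneg_right (h3 n) (hw n)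
      _ ≤ J * M := by gcongr
  · have hnN : N ≤ n := (le_max_left _ _).trans hn
    have hnN' : N' ≤ n := (le_max_right _ _).trans hn
    set f : Ω → ℝ := fun ω => w n ^ 2 * (stayInd θ (W v) N n ω * excess F v (θ n ω) ^ 2) with hf
    have hf0 : ∀ ω, 0 ≤ f ω := fun ω =>
      mul_nonneg (sq_nonneg _) (mul_nonneg (stayInd_nonneg _ _ _ _ _) (sq_nonneg _))
    have hfint : Integrable f μ := by
      obtain ⟨R, hR, hb⟩ := S.exists_bounds_on_bounded (hWb v hv) v
      have hm : Measurable fun ω => stayInd θ (W v) N n ω * excess F v (θ n ω) ^ 2 :=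
        ((S.measurable_stayInd (hWo v hv) N n).mono (ℱ.le n) le_rfl).mul
          (((S.measurable_excess v).comp (S.measurable n)).pow_const 2)
      refine Integrable.const_mul ?_ _
      refine (integrable_const (R ^ 2)).mono' hm.aestronglyMeasurable (ae_of_all _ fun ω => ?_)
      rw [Real.norm_of_nonneg (mul_nonneg (stayInd_nonneg _ _ _ _ _) (sq_nonneg _))]
      by_cases hω : ω ∈ stay θ (W v) N n
      · rw [stayInd, Set.indicator_of_mem hω, one_mul]
        exact pow_le_pow_left₀ (excess_nonneg _ _ _) (hb _ (hω n hnN le_rfl)).2.2.1 2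
      · rw [stayInd, Set.indicator_of_notMem hω, zero_mul]
        positivity
    have hfle : ∫ ω, f ω ∂μ ≤ C := by
      rw [hf, integral_const_mul]
      exact hN' n hnN'
    have h1 := mul_meas_ge_le_integral_of_nonneg (ae_of_all μ hf0) hfint A
    have h2 : μ.real {ω | A ≤ f ω} ≤ η' := by
      have h3 : A * μ.real {ω | A ≤ f ω} ≤ |C| := h1.trans (hfle.trans (le_abs_self C))
      have h4 : |C| ≤ A * η' := by rwa [div_le_iff₀ hη'pos] at hAC
      exact le_of_mul_le_mul_left (h3.trans h4) (by linarith)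
    have h3 : μ {ω | A ≤ f ω} ≤ η := by
      rw [← ofReal_measureReal]
      refine (ENNReal.ofReal_le_ofReal h2).trans ?_
      rw [ENNReal.ofReal_coe_nnreal]
      exact hη'.le
    refine (measure_mono fun ω hω => ?_).trans h3
    obtain ⟨⟨h4, h5, _⟩, h6⟩ := hω
    have hst : ω ∈ stay θ (W v) N n := fun k hk _ => h5 k hk
    change A < (F (θ n ω) - Fs ω) * w n at h6
    change A ≤ f ω
    simp only at h4
    rw [h4] at h6
    simp only [hf, stayInd, Set.indicator_of_mem hst, one_mul]
    have h7 : F (θ n ω) - v ≤ excess F v (θ n ω) := le_max_left _ _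
    have h8 : A ≤ excess F v (θ n ω) * w n := h6.le.trans (mul_le_mul_of_nonneg_right h7 (hw n))
    calc A ≤ A ^ 2 := by nlinarith
      _ ≤ (excess F v (θ n ω) * w n) ^ 2 := pow_le_pow_left₀ (by linarith) h8 2
      _ = _ := by ring

/-- The complexity of the last iterate under a local Łojasiewicz inequality. -/
theorem lastIterateCount (S : IsSGD μ ℱ F X g L α C₀ κ c γ ξ θ) (hcoer : Coercive F)
    (hreg : ∀ᵐ ω ∂μ, RegularPath F γ (fun n => θ n ω) (Fs ω)) {δ l β ζ ρ : ℝ}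
    (hl : ENNReal.ofReal (1 - δ) < μ {ω | Fs ω ≤ l}) (hβ : 0 < β) (hζ : 0 < ζ)
    (hloj : LojasiewiczOn F (sublevel F l) β ζ) (hr : RefinedStepSizes γ α ρ) :
    LastIterateCount μ F γ θ Fs α ρ κ δ β (ζ ^ (1 / β) * max α (1 / 2)) := by
  have hα := S.smooth.α_pos
  have hκ := S.oracle.κ_pos
  refine ⟨fun hβ2 hcrit => ?_, fun hβ2 => ⟨localExponent_pos hr hα S.smooth.α_le_one hβ2, ?_⟩⟩
  · obtain ⟨τ, hτ, hτκ, hdecay⟩ := exists_decay_rate S.rates hr hκ (by positivity) hcrit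
    set p := min 1 (2 * α) with hp
    have hp0 : 0 < p := lt_min one_pos (by positivity)
    -- Below `1/2`, the exponent is raised to `1/2` with a constant so small that the drift is twice
    -- the required speed. At `1/2` the constant is kept, and `ζ^(1/β) = ζ²` together with `p ≤ 2
    -- max α (1/2)` gives the condition.
    obtain ⟨ζ', hζ', hloj', hτκ'⟩ : ∃ ζ' : ℝ, 0 < ζ' ∧ LojasiewiczOn F (sublevel F l) (1 / 2) ζ' ∧
        p * τ < 2 * κ / ζ' ^ 2 := by
      rcases hβ2.lt_or_eq with h | h
      · refine ⟨Real.sqrt (κ / (p * τ)), by positivity,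
          hloj.of_lt S.continuous hβ hζ h (by positivity), ?_⟩
        rw [Real.sq_sqrt (by positivity)]
        have : 2 * κ / (κ / (p * τ)) = 2 * (p * τ) := by field_simp
        rw [this]
        have : 0 < p * τ := by positivity
        linarith
      · subst h
        refine ⟨ζ, hζ, hloj, ?_⟩
        rw [lt_div_iff₀ (by positivity)]
        norm_num at hτκ
        have hp2 : p ≤ 2 * max α (1 / 2) :=
          (min_le_right _ _).trans (by gcongr; exact le_max_left _ _)
        have h1 : p * τ * ζ ^ 2 ≤ 2 * max α (1 / 2) * τ * ζ ^ 2 := by gcongr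
        linarith
    obtain ⟨C, hC, hle⟩ := S.last_iterate_of_localError hcoer hreg hl one_half_pos hloj'
      -- The absolute value only matters at the unconstrained index `0`, where the weight must still
      -- be nonnegative.
      (w := fun n => |γ n| ^ (-(p / 2))) (fun n => by positivity) fun U v hU hUb hUle N => by
        obtain ⟨C, _, hC⟩ := S.localError_le_rate hU hUb hζ' hUle hτ hdecay hτκ' N
        refine ⟨C, ?_⟩
        filter_upwards [hC, eventually_ge_atTop 1] with n hn h1
        have hγ := S.rates.pos n h1
        rw [abs_of_pos hγ, ← Real.rpow_natCast, ← Real.rpow_mul hγ.le]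
        have e : -(p / 2) * ((2 : ℕ) : ℝ) = -p := by push_cast; ring
        rw [e, Real.rpow_neg hγ.le, inv_mul_le_iff₀ (by positivity), mul_comm]
        exact hn
    refine ⟨C, hC, fun ε hε n hn => (hle n).mono (ae_of_all _ fun ω hω => ?_)⟩
    obtain ⟨h1, h2⟩ := S.rates.rateCount_spec hα (by positivity) hn
    have hγ := S.rates.pos n h1
    simp only [abs_of_pos hγ] at hω
    have hmax : max 2 (1 / α) * (p / 2) = 1 := by
      rcases le_total 2 (1 / α) with h | h
      · have : 2 * α ≤ 1 := by rwa [le_div_iff₀ hα] at h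
        rw [max_eq_right h, hp, min_eq_right this]
        field_simp
      · have : 1 ≤ 2 * α := by rwa [div_le_iff₀ hα] at h
        rw [max_eq_left h, hp, min_eq_left this]
        norm_num
    have h3 : γ n ^ (p / 2) ≤ ε := by
      have := Real.rpow_le_rpow hγ.le h2 (by positivity : 0 ≤ p / 2)
      rwa [← Real.rpow_mul hε.le, hmax, Real.rpow_one] at this
    rw [Real.rpow_neg hγ.le, ← div_eq_mul_inv, div_le_iff₀ (by positivity)] at hω
    exact hω.trans (by gcongr)
  · have hr0 := localExponent_pos hr hα S.smooth.α_le_one hβ2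
    set r := localExponent α ρ β with hrdef
    obtain ⟨C, hC, hle⟩ := S.last_iterate_of_localError hcoer hreg hl hβ hloj
      (w := fun n => partialSum γ (n + 1) ^ r)
      (fun n => by have := S.rates.partialSum_pos n; positivity) fun U v hU hUb hUle N => by
        obtain ⟨C, hC0, hC⟩ := S.localError_le_partialSum hU hUb hζ hβ2 hUle hr N
        -- The error is bounded with the sum up to `n` and the count uses the sum up to `n + 1`; the
        -- two differ by at most a factor `2` eventually.
        refine ⟨C * 2 ^ (2 * r), ?_⟩
        filter_upwards [hC, eventually_partialSum_rpow_le S.rates hα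
          (by positivity : 0 < 2 * r)] with n hn h1
        have hT := S.rates.partialSum_pos n
        rw [← Real.rpow_natCast, ← Real.rpow_mul hT.le]
        have e : r * ((2 : ℕ) : ℝ) = 2 * r := by push_cast; ring
        rw [e]
        calc _ ≤ partialSum γ (n + 1) ^ (2 * r) *
              (C * (2 ^ (2 * r) * partialSum γ (n + 1) ^ (-(2 * r)))) := by
              gcongr
              exact hn.trans (by gcongr)
          _ = C * 2 ^ (2 * r) * (partialSum γ (n + 1) ^ (2 * r) *
              partialSum γ (n + 1) ^ (-(2 * r))) := by ring
          _ = C * 2 ^ (2 * r) := by rw [← Real.rpow_add hT]; simp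
    refine ⟨C, hC, fun ε hε n hn => (hle n).mono (ae_of_all _ fun ω hω => ?_)⟩
    have hT := S.rates.le_partialSum_of_sumInv_le hn
    have h1 := Real.rpow_le_rpow (by positivity) hT hr0.le
    rw [← Real.rpow_mul hε.le, neg_mul, one_div_mul_cancel hr0.ne', Real.rpow_neg_one] at h1
    rcases le_or_gt (F (θ n ω) - Fs ω) 0 with h | h
    · exact h.trans (by positivity)
    · have h2 := (mul_le_mul_of_nonneg_left h1 h.le).trans hω
      rwa [← div_eq_mul_inv, div_le_iff₀ hε] at h2

/-! ### The last iterate in the globally Łojasiewicz case -/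

/-- No localisation or squaring: the Łojasiewicz inequality holds everywhere, the gap is
nonnegative, and its mean is bounded. -/
theorem exists_integral_gap_succ_le (S : IsSGD μ ℱ F X g L α C₀ κ c γ ξ θ) :
    ∃ K : ℝ, 0 < K ∧ ∀ (n : ℕ) (h e : ℝ),
      (∀ x, h * gap F x - e ≤ κ * ‖gradient F x‖ ^ 2) →
      ∫ ω, gap F (θ (n + 1) ω) ∂μ ≤ (1 - h * γ (n + 1)) * ∫ ω, gap F (θ n ω) ∂μ
        + γ (n + 1) * (e + K * γ (n + 1) ^ α) := by
  have hL := S.smooth.L_pos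
  have hα := S.smooth.α_pos
  have hC := S.oracle.C_pos
  obtain ⟨B, hB, hBle⟩ := S.exists_integral_gap_le
  refine ⟨L / (1 + α) * (1 + C₀) * B, by positivity, fun n h e hle => ?_⟩
  have hγ := S.rates.pos (n + 1) (by omega)
  have h1 := S.setIntegral_gap_succ_le (n := n) MeasurableSet.univ
  simp only [setIntegral_univ] at h1
  have h2 : L / (1 + α) * (1 + C₀) * γ (n + 1) ^ (1 + α) * ∫ ω, (gap F (θ n ω) + 1) ∂μ ≤
      L / (1 + α) * (1 + C₀) * γ (n + 1) ^ (1 + α) * B := by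
    gcongr
    exact hBle n
  have h3 : h * ∫ ω, gap F (θ n ω) ∂μ - e ≤ κ * ∫ ω, ‖gradient F (θ n ω)‖ ^ 2 ∂μ := by
    have h4 : ∫ ω, (h * gap F (θ n ω) - e) ∂μ ≤ ∫ ω, κ * ‖gradient F (θ n ω)‖ ^ 2 ∂μ :=
      integral_mono (((S.integrable_gap n).const_mul h).sub (integrable_const e))
        ((S.integrable_gradient_sq n).const_mul κ) fun ω => hle _
    rw [integral_sub ((S.integrable_gap n).const_mul h) (integrable_const e), integral_const_mul,
      integral_const_mul] at h4
    simpa using h4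
  have h5 := mul_le_mul_of_nonneg_left h3 hγ.le
  have h6 : γ (n + 1) ^ (1 + α) = γ (n + 1) * γ (n + 1) ^ α := by
    rw [Real.rpow_add hγ, Real.rpow_one]
  rw [h6] at h1 h2
  linarith

theorem last_iterate_global_rate (S : IsSGD μ ℱ F X g L α C₀ κ c γ ξ θ)
    (hFs : ∀ᵐ ω ∂μ, Fs ω = ⨅ x, F x) {ρ Z : ℝ} (hr : RefinedStepSizes γ α ρ) (hZ : 0 < Z)
    (hle : ∀ x, gap F x ≤ Z * ‖gradient F x‖ ^ 2) (hcrit : CriticalCondition γ κ (Z * α)) :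
    ∃ C : ℝ, 0 < C ∧ ∀ δ : ℝ, 0 < δ → δ < 1 → ∀ ε : ℝ, 0 < ε →
      ∀ n : ℕ, RateCount γ (ε ^ (1 / α)) n →
        WithProb μ δ fun ω => F (θ n ω) - Fs ω ≤ C / δ * ε := by
  have hα := S.smooth.α_pos
  have hκ := S.oracle.κ_pos
  obtain ⟨τ, hτ, hτκ, hdecay⟩ := exists_decay_rate S.rates hr hκ (by positivity) hcrit
  obtain ⟨K, hK, hrec⟩ := S.exists_integral_gap_succ_le
  have hev := eventually_le_rate_rpow S.rates hα (z := fun n => ∫ ω, gap F (θ n ω) ∂μ)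
    (h := κ / Z) (K := K) hα hτ hK.le (by rw [lt_div_iff₀ hZ]; linarith) hdecay
    (Eventually.of_forall fun n => by
      have h1 := hrec n (κ / Z) 0 fun x => by
        rw [sub_zero, div_mul_eq_mul_div, div_le_iff₀ hZ]
        have := mul_le_mul_of_nonneg_left (hle x) hκ.le
        linarith
      rw [zero_add] at h1
      linarith)
  obtain ⟨C, hC, hCle⟩ := exists_forall_le_of_eventually (n₀ := 1)
    (fun n hn => Real.rpow_pos_of_pos (S.rates.pos n hn) α) (hev.imp fun _ h => h.2)
  refine ⟨C, hC, fun δ hδ _ ε hε n hn => ?_⟩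
  obtain ⟨h1, h2⟩ := S.rates.rateCount_spec hα (by positivity) hn
  have hγ := S.rates.pos n h1
  have h3 : γ n ^ α ≤ ε := by
    have := Real.rpow_le_rpow hγ.le h2 hα.le
    rwa [← Real.rpow_mul hε.le, one_div_mul_cancel hα.ne', Real.rpow_one] at this
  have h4 : ∫ ω, gap F (θ n ω) ∂μ ≤ C * ε := (hCle n h1).trans (by gcongr)
  refine (withProb_of_integral_le (S.integrable_gap n) (fun ω => gap_nonneg S.smooth _)
    (by positivity) h4 hδ).mono ?_
  filter_upwards [hFs] with ω hω h5
  rw [hω, div_mul_eq_mul_div]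
  exact h5

theorem last_iterate_global_sum (S : IsSGD μ ℱ F X g L α C₀ κ c γ ξ θ)
    (hFs : ∀ᵐ ω ∂μ, Fs ω = ⨅ x, F x) {ρ β ζ : ℝ} (hr : RefinedStepSizes γ α ρ) (hβ : 1 / 2 < β)
    (hζ : 0 < ζ) (hloj : LojasiewiczInf F β ζ) :
    ∃ C : ℝ, 0 < C ∧ ∀ δ : ℝ, 0 < δ → δ < 1 → ∀ ε : ℝ, 0 < ε →
      ∀ n : ℕ, sumInv γ (ε ^ (-(1 / globalExponent α ρ β))) ≤ n →
        WithProb μ δ fun ω => F (θ n ω) - Fs ω ≤ C / δ * ε := by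
  have hα := S.smooth.α_pos
  have hκ := S.oracle.κ_pos
  have hr0 := globalExponent_pos hr hα hβ
  set r := globalExponent α ρ β with hrdef
  have hr1 : r ≤ 1 / (2 * β - 1) := min_le_left _ _
  have hr2 : r ≤ α * ρ - 1 := min_le_right _ _
  obtain ⟨K, hK, hrec⟩ := S.exists_integral_gap_succ_le
  obtain ⟨M, hM, hrate⟩ := exists_rate_le S.rates hr
  obtain ⟨K₀, hK₀, hlin⟩ := exists_linear_le_rpow (Q := 2 * β) (c := κ / ζ ^ 2)
    (b := r + 1) (q := r) (by linarith) (by positivity) (by positivity) hr1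
  have hgrad : ∀ x, κ / ζ ^ 2 * gap F x ^ (2 * β) ≤ κ * ‖gradient F x‖ ^ 2 := by
    intro x
    have h1 : gap F x ^ (2 * β) ≤ (ζ * ‖gradient F x‖) ^ 2 := by
      have h0 := gap_nonneg S.smooth x
      rw [mul_comm 2 β, Real.rpow_mul h0, Real.rpow_two]
      exact pow_le_pow_left₀ (by positivity) (hloj x) 2
    calc _ ≤ κ / ζ ^ 2 * (ζ * ‖gradient F x‖) ^ 2 := by gcongr
      _ = _ := by field_simp
  have hev := eventually_le_partialSum_rpow S.rates hα (z := fun n => ∫ ω, gap F (θ n ω) ∂μ)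
    (b := r + 1) (q := r) (K := K₀ + K * M ^ α) hr0 (by positivity) (by linarith) (by
      filter_upwards [hrate, S.rates.diverges.eventually (eventually_ge_atTop 1)] with n h1 hT
      have hγ := S.rates.pos (n + 1) (by omega)
      set s := γ (n + 1) with hs
      set T := partialSum γ n with hTdef
      set T' := partialSum γ (n + 1) with hT'def
      have hT0 : 0 < T := by linarith
      have hTT' : T ≤ T' := S.rates.monotone_partialSum (Nat.le_succ n)
      have hT'1 : 1 ≤ T' := hT.trans hTT'
      have hT'0 : 0 < T' := by linarith
      refine (hrec n ((r + 1) / T) (K₀ * (T⁻¹ * T ^ (-r))) fun x =>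
        (hlin T _ hT (gap_nonneg S.smooth x)).trans (hgrad x)).trans ?_
      -- Here only `γ^α` enters the source, so `r ≤ αρ - 1` is enough.
      have h3 : s ^ α * T ≤ M ^ α * T' ^ (-r) := by
        calc s ^ α * T ≤ (M * T' ^ (-ρ)) ^ α * T' := by gcongr
          _ = M ^ α * (T' ^ (-ρ * α) * T') := by
              rw [Real.mul_rpow hM.le (by positivity), ← Real.rpow_mul hT'0.le]; ring
          _ = M ^ α * T' ^ (-ρ * α + 1) := by
              rw [Real.rpow_add hT'0, Real.rpow_one]
          _ ≤ _ := by
              gcongr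
              linarith
      have h5 : K * s ^ α ≤ K * M ^ α * (T⁻¹ * T' ^ (-r)) := by
        have : K * s ^ α = K * T⁻¹ * (s ^ α * T) := by field_simp
        rw [this]
        calc _ ≤ K * T⁻¹ * (M ^ α * T' ^ (-r)) := by gcongr
          _ = _ := by ring
      have h7 : s * (K₀ * (T⁻¹ * T ^ (-r)) + K * s ^ α) ≤
          s * (K₀ * (T⁻¹ * T ^ (-r)) + K * M ^ α * (T⁻¹ * T' ^ (-r))) := by gcongr
      have h8 : 0 ≤ s * T⁻¹ * (K₀ * T' ^ (-r) + K * M ^ α * T ^ (-r)) := by positivity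
      rw [div_eq_mul_inv s T]
      nlinarith)
  obtain ⟨C, hC, hCle⟩ := exists_forall_le_of_eventually (n₀ := 0)
    (z := fun n => ∫ ω, gap F (θ n ω) ∂μ) (w := fun n => partialSum γ (n + 1) ^ (-r))
    (fun n _ => Real.rpow_pos_of_pos (S.rates.partialSum_pos n) _) (by
      obtain ⟨C, hC0, hC⟩ := hev
      refine ⟨C * 2 ^ r, ?_⟩
      filter_upwards [hC, eventually_partialSum_rpow_le S.rates hα hr0] with n h1 h2
      rw [mul_assoc]
      exact h1.trans (by gcongr))
  refine ⟨C, hC, fun δ hδ _ ε hε n hn => ?_⟩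
  have hT := S.rates.le_partialSum_of_sumInv_le hn
  have h1 := Real.rpow_le_rpow (by positivity) hT hr0.le
  rw [← Real.rpow_mul hε.le, neg_mul, one_div_mul_cancel hr0.ne', Real.rpow_neg_one] at h1
  have h3 : partialSum γ (n + 1) ^ (-r) ≤ ε := by
    rw [Real.rpow_neg (S.rates.partialSum_pos n).le]
    exact inv_le_of_inv_le₀ hε h1
  have h4 : ∫ ω, gap F (θ n ω) ∂μ ≤ C * ε := (hCle n (Nat.zero_le n)).trans (by gcongr)
  refine (withProb_of_integral_le (S.integrable_gap n) (fun ω => gap_nonneg S.smooth _)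
    (by positivity) h4 hδ).mono ?_
  filter_upwards [hFs] with ω hω h5
  rw [hω, div_mul_eq_mul_div]
  exact h5

end IsSGD

/-! ### Assembly of the theorem -/

theorem SGD.LojasiewiczInf.gap_le_of_eq_half {m : ℕ} {F : EuclideanSpace ℝ (Fin m) → ℝ}
    {L α ζ : ℝ} (hF : HolderSmooth F L α) (h : LojasiewiczInf F (1 / 2) ζ)
    (x : EuclideanSpace ℝ (Fin m)) :
    gap F x ≤ ζ ^ (2 + globalLambda α (1 / 2) * ((1 + α) / α)) *
      ((1 + α) * L ^ (1 / α) / α) ^ globalLambda α (1 / 2) * ‖gradient F x‖ ^ 2 := by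
  have h0 := gap_nonneg hF x
  have h1 : Real.sqrt (gap F x) ≤ ζ * ‖gradient F x‖ := by
    rw [Real.sqrt_eq_rpow]; exact h x
  have h2 : gap F x ≤ (ζ * ‖gradient F x‖) ^ 2 := by
    rw [← Real.sq_sqrt h0]
    exact pow_le_pow_left₀ (Real.sqrt_nonneg _) h1 2
  simpa [globalLambda, mul_pow] using h2

theorem integrable_gap_of_memLp {Ω : Type*} [MeasurableSpace Ω] {μ : Measure Ω}
    [IsProbabilityMeasure μ] {m : ℕ} {F : EuclideanSpace ℝ (Fin m) → ℝ} {L α : ℝ}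
    (hF : HolderSmooth F L α) {u : Ω → EuclideanSpace ℝ (Fin m)} (hu : Measurable u)
    (hu2 : MemLp u 2 μ) : Integrable (fun ω => gap F (u ω)) μ := by
  obtain ⟨A, hA⟩ := exists_gap_le_one_add_sq hF
  have hsq : Integrable (fun ω => ‖u ω‖ ^ 2) μ := hu2.integrable_norm_pow two_ne_zero
  have hcont : Continuous (gap F) := hF.differentiable.continuous.sub continuous_const
  refine (((integrable_const 1).add hsq).const_mul A).mono'
    (hcont.measurable.comp hu).aestronglyMeasurable (ae_of_all _ fun ω => ?_)
  rw [Real.norm_of_nonneg (gap_nonneg hF _)]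
  exact hA _

theorem measurable_iterates {Ω : Type*} [MeasurableSpace Ω] {m d : ℕ}
    {g : EuclideanSpace ℝ (Fin d) → EuclideanSpace ℝ (Fin m) → EuclideanSpace ℝ (Fin m)}
    {γ : ℕ → ℝ} {ξ : ℕ → Ω → EuclideanSpace ℝ (Fin d)} {θ : ℕ → Ω → EuclideanSpace ℝ (Fin m)}
    (hξ : ∀ n, Measurable (ξ (n + 1))) (hθ₀ : Measurable (θ 0))
    (hg : Measurable fun p : EuclideanSpace ℝ (Fin d) × EuclideanSpace ℝ (Fin m) => g p.1 p.2)
    (hθ : ∀ n ω, θ (n + 1) ω = θ n ω - γ (n + 1) • g (ξ (n + 1) ω) (θ n ω)) (n : ℕ) :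
    Measurable[historyFiltration hξ hθ₀ n] (θ n) := by
  induction n with
  | zero => exact measurable_fst.comp (comap_measurable (history ξ (θ 0) 0))
  | succ n ih =>
    have h1 : Measurable[historyFiltration hξ hθ₀ (n + 1)] (θ n) :=
      ih.mono ((historyFiltration hξ hθ₀).mono n.le_succ) le_rfl
    have h2 : Measurable[historyFiltration hξ hθ₀ (n + 1)] (ξ (n + 1)) := by
      have : ξ (n + 1) = fun ω => (history ξ (θ 0) (n + 1) ω).2 n := by
        ext1 ω; simp [history]
      rw [this]
      exact (measurable_pi_apply n).comp
        (measurable_snd.comp (comap_measurable (history ξ (θ 0) (n + 1))))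
    have h3 : θ (n + 1) = fun ω => θ n ω - γ (n + 1) • g (ξ (n + 1) ω) (θ n ω) := funext (hθ n)
    have h4 : Measurable[historyFiltration hξ hθ₀ (n + 1)] fun ω => g (ξ (n + 1) ω) (θ n ω) :=
      hg.comp (h2.prodMk h1)
    rw [h3]
    exact h1.sub (h4.const_smul (γ (n + 1)))

theorem mainTheorem6
    {Ω : Type*} [MeasurableSpace Ω] (μ : Measure Ω) [IsProbabilityMeasure μ]
    (m d : ℕ) (hm : 1 ≤ m) (hd : 1 ≤ d)
    -- the optimization problem
    (X : Ω → EuclideanSpace ℝ (Fin d)) (hX : Measurable X)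
    (f : EuclideanSpace ℝ (Fin d) → EuclideanSpace ℝ (Fin m) → ℝ)
    (hf : ∀ θ, Integrable (fun ω => f (X ω) θ) μ)
    (F : EuclideanSpace ℝ (Fin m) → ℝ) (hF : ∀ θ, F θ = ∫ ω, f (X ω) θ ∂μ)
    -- the oracle
    (g : EuclideanSpace ℝ (Fin d) → EuclideanSpace ℝ (Fin m) → EuclideanSpace ℝ (Fin m))
    (hg : Measurable fun p : EuclideanSpace ℝ (Fin d) × EuclideanSpace ℝ (Fin m) => g p.1 p.2)
    -- the standing assumptions
    (L α C₀ κ c : ℝ) (γ : ℕ → ℝ)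
    (hsmooth : HolderSmooth F L α)
    (horacle : OracleBounds μ F X g C₀ κ c)
    (hγ : StepSizes γ α)
    (hcoercive : Coercive F)
    (hloj : Lojasiewicz F)
    -- the innovations `ξ 1, ξ 2, …` and the iterates
    (ξ : ℕ → Ω → EuclideanSpace ℝ (Fin d)) (hξ : ∀ n, Measurable (ξ (n + 1)))
    (hξ_indep : iIndepFun (fun n => ξ (n + 1)) μ)
    (hξ_law : ∀ n, IdentDistrib (ξ (n + 1)) X μ μ)
    (θ : ℕ → Ω → EuclideanSpace ℝ (Fin m)) (hθ₀ : Measurable (θ 0))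
    (hθ₀_L2 : MemLp (θ 0) 2 μ)
    (hθ₀_indep : IndepFun (θ 0) (fun ω n => ξ (n + 1) ω) μ)
    (hθ : ∀ n ω, θ (n + 1) ω = θ n ω - γ (n + 1) • g (ξ (n + 1) ω) (θ n ω))
    -- the costs of the primitive operations
    (w : OpCosts) :
    -- the reciprocals `γ⁻¹` and `Σ⁻¹` are well defined
    (∀ t : ℝ, 0 < t → 1 ≤ rateInv γ t ∧ γ (rateInv γ t) ≤ t) ∧
    (∀ t : ℝ, 0 < t → 1 ≤ sumInv γ t ∧ t ≤ partialSum γ (sumInv γ t + 1)) ∧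
    -- computing the `n`-th iterate costs `O(n)`
    (∃ C : ℝ, 0 < C ∧ ∀ n : ℕ, 1 ≤ n → ∀ ω,
      (timedRun w g γ (fun k => ξ k ω) (θ 0 ω) n).val = θ n ω ∧
      ((timedRun w g γ (fun k => ξ k ω) (θ 0 ω) n).cost : ℝ) ≤ C * n) ∧
    -- the limit `Fs` of the function values
    ∃ Fs : Ω → ℝ, Integrable Fs μ ∧
      (∀ᵐ ω ∂μ, Tendsto (fun n => F (θ n ω)) atTop (𝓝 (Fs ω))) ∧
      -- (i) best iterate
      ( -- a.
        (∀ δ : ℝ, 0 < δ → δ < 1 → ∃ ℓ : ℝ, (⨅ x, F x) < ℓ ∧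
          WithProb μ δ (fun ω => accPoints (fun n => θ n ω) ⊆ sublevel F ℓ) ∧
          (∃ β ζ : ℝ, 0 < β ∧ β < 1 ∧ 0 < ζ ∧ LojasiewiczOn F (sublevel F ℓ) β ζ) ∧
          (∃ β : ℝ, 0 < β ∧ β < 1 ∧ LojasiewiczOn F (sublevel F ℓ) β 1) ∧
          (∀ β ζ : ℝ, 0 < β → β < 1 → 0 < ζ → LojasiewiczOn F (sublevel F ℓ) β ζ →
            ∃ C : ℝ, 0 < C ∧ ∀ ε : ℝ, 0 < ε →
              ∀ n : ℕ, sumInv γ (ε ^ (-(max 1 (2 * β)))) ≤ n →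
                WithProb μ δ fun ω => (⨅ k : Fin (n + 1), F (θ k ω)) - Fs ω ≤ C * ε)) ∧
        -- b.
        ((∃ β : ℝ, 0 < β ∧ β ≤ 1 ∧ LojasiewiczOn F Set.univ β 1) ∧
          (∀ β : ℝ, 0 < β → β ≤ 1 → LojasiewiczOn F Set.univ β 1 →
            ∀ δ : ℝ, 0 < δ → δ < 1 →
              ∃ C : ℝ, 0 < C ∧ ∀ ε : ℝ, 0 < ε →
                ∀ n : ℕ, sumInv γ (ε ^ (-(max 1 (2 * β)))) ≤ n →
                  WithProb μ δ fun ω => (⨅ k : Fin (n + 1), F (θ k ω)) - Fs ω ≤ C * ε)) ∧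
        -- c.
        (GloballyLojasiewicz F →
          (∀ᵐ ω ∂μ, Fs ω = ⨅ x, F x) ∧
          (∃ β ζ : ℝ, α / (1 + α) ≤ β ∧ β < 1 ∧ 0 < ζ ∧ LojasiewiczInf F β ζ) ∧
          (∀ β ζ : ℝ, α / (1 + α) ≤ β → β < 1 → 0 < ζ → LojasiewiczInf F β ζ →
            ∃ C : ℝ, 0 < C ∧ ∀ δ : ℝ, 0 < δ → δ < 1 → ∀ ε : ℝ, 0 < ε →
              ∀ n : ℕ, sumInv γ (ε ^ (-(2 * β))) ≤ n →
                WithProb μ δ fun ω =>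
                  (⨅ k : Fin (n + 1), F (θ k ω)) - (⨅ x, F x) ≤ C / δ ^ (1 / β) * ε))) ∧
      -- (ii) last iterate
      (∀ ρ : ℝ, RefinedStepSizes γ α ρ →
        -- a.
        (∀ δ : ℝ, 0 < δ → δ < 1 → ∃ ℓ : ℝ, (⨅ x, F x) < ℓ ∧
          WithProb μ δ (fun ω => accPoints (fun n => θ n ω) ⊆ sublevel F ℓ) ∧
          (∃ β ζ : ℝ, 0 < β ∧ β < 1 ∧ 0 < ζ ∧ LojasiewiczOn F (sublevel F ℓ) β ζ) ∧
          (∃ β : ℝ, 0 < β ∧ β < 1 ∧ LojasiewiczOn F (sublevel F ℓ) β 1) ∧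
          (∀ β ζ : ℝ, 0 < β → β < 1 → 0 < ζ → LojasiewiczOn F (sublevel F ℓ) β ζ →
            LastIterateCount μ F γ θ Fs α ρ κ δ β (ζ ^ (1 / β) * max α (1 / 2))) ∧
          (∀ β : ℝ, 0 < β → β < 1 → LojasiewiczOn F (sublevel F ℓ) β 1 →
            LastIterateCount μ F γ θ Fs α ρ κ δ β (max α (1 / 2)))) ∧
        -- b.
        (∀ β : ℝ, 0 < β → β ≤ 1 → LojasiewiczOn F Set.univ β 1 →
          ∀ δ : ℝ, 0 < δ → δ < 1 →
            LastIterateCount μ F γ θ Fs α ρ κ δ β (max α (1 / 2))) ∧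
        -- c.
        (GloballyLojasiewicz F →
          ∀ β ζ : ℝ, (α / (1 + α) < β ∧ β < 1) ∨ β = 1 / 2 → 0 < ζ → LojasiewiczInf F β ζ →
            (β ≤ 1 / 2 →
              CriticalCondition γ κ
                (ζ ^ (2 + globalLambda α β * ((1 + α) / α)) *
                  ((1 + α) * L ^ (1 / α) / α) ^ globalLambda α β * α) →
              ∃ C : ℝ, 0 < C ∧ ∀ δ : ℝ, 0 < δ → δ < 1 → ∀ ε : ℝ, 0 < ε →
                ∀ n : ℕ, RateCount γ (ε ^ (1 / α)) n →
                  WithProb μ δ fun ω => F (θ n ω) - Fs ω ≤ C / δ * ε) ∧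
            (1 / 2 < β →
              0 < globalExponent α ρ β ∧
              ∃ C : ℝ, 0 < C ∧ ∀ δ : ℝ, 0 < δ → δ < 1 → ∀ ε : ℝ, 0 < ε →
                ∀ n : ℕ, sumInv γ (ε ^ (-(1 / globalExponent α ρ β))) ≤ n →
                  WithProb μ δ fun ω => F (θ n ω) - Fs ω ≤ C / δ * ε))) := by
  have hα := hsmooth.α_pos
  have hL := hsmooth.L_pos
  have hadapt : ∀ n, Measurable[historyFiltration hξ hθ₀ n] (θ n) :=
    measurable_iterates hξ hθ₀ hg hθ
  have S : IsSGD μ (historyFiltration hξ hθ₀) F X g L α C₀ κ c γ ξ θ :=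
    { smooth := hsmooth
      oracle := horacle
      rates := hγ
      measurable_X := hX
      measurable_oracle := hg
      adapted := hadapt
      measurable_innov := hξ
      indep := fun n =>
        (IndepFun_iff_Indep _ _ _).1 (indepFun_history hξ hθ₀ hξ_indep hθ₀_indep n)
      law := fun n => (hξ_law n).map_eq
      step := hθ
      integrable_zero := integrable_gap_of_memLp hsmooth hθ₀ hθ₀_L2 }
  obtain ⟨Fs, -, hFs_int, hFs⟩ := S.exists_integrable_limit
  have hreg := S.ae_regularPath hFs
  have hlevel : ∀ ℓ, (∃ β ζ : ℝ, 0 < β ∧ β < 1 ∧ 0 < ζ ∧ LojasiewiczOn F (sublevel F ℓ) β ζ) ∧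
      (∃ β : ℝ, 0 < β ∧ β < 1 ∧ LojasiewiczOn F (sublevel F ℓ) β 1) := fun ℓ => by
    obtain ⟨β, hβ, hβ1, h⟩ :=
      exists_lojasiewiczOn_of_isCompact hsmooth hloj (isCompact_sublevel hsmooth hcoercive ℓ)
    exact ⟨⟨β, 1, hβ, hβ1, one_pos, h⟩, β, hβ, hβ1, h⟩
  -- The limit is a critical value, and under the global inequality the infimum is the only one.
  have hglob : GloballyLojasiewicz F → ∀ᵐ ω ∂μ, Fs ω = ⨅ x, F x := fun h =>
    hreg.mono fun ω hω => by
      obtain ⟨x, hx, hxF⟩ := hω.exists_critical hsmooth hcoercive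
      rw [← hxF, h.value_eq_iInf hsmooth hcoercive hx]
  have hcount : ∀ {ρ δ ℓ β : ℝ}, RefinedStepSizes γ α ρ →
      ENNReal.ofReal (1 - δ) < μ {ω | Fs ω ≤ ℓ} → 0 < β → LojasiewiczOn F (sublevel F ℓ) β 1 →
      LastIterateCount μ F γ θ Fs α ρ κ δ β (max α (1 / 2)) := fun hr hℓ hβ h => by
    have := S.lastIterateCount hcoercive hreg hℓ hβ one_pos h hr
    rwa [Real.one_rpow, one_mul] at this
  refine ⟨fun t ht => hγ.rateInv_spec hα ht, fun t _ => hγ.sumInv_spec t,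
    exists_timedRun_cost_le w g γ ξ θ hθ, Fs, hFs_int, hFs,
    ⟨fun δ hδ _ => ?_, ⟨⟨1, one_pos, le_rfl, lojasiewiczOn_univ_one S.continuous hloj⟩,
      fun β hβ _ h δ hδ _ => ?_⟩, fun h => ⟨hglob h, h.exists_lojasiewiczInf hm hsmooth hcoercive,
      fun β ζ hβ _ hζ hinf => S.best_iterate_global (lt_of_lt_of_le (by positivity) hβ) hζ hinf⟩⟩,
    fun ρ hr => ⟨fun δ hδ _ => ?_, fun β hβ _ h δ hδ _ => ?_, fun h β ζ hβ hζ hinf => ⟨?_, ?_⟩⟩⟩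
  · obtain ⟨ℓ, hℓ, hℓμ⟩ := exists_level (μ := μ) Fs hδ (⨅ x, F x)
    exact ⟨ℓ, hℓ, S.withProb_accPoints hreg hℓμ, (hlevel ℓ).1, (hlevel ℓ).2,
      fun β ζ hβ _ _ h => S.best_iterate_local hcoercive hreg hℓμ hβ h⟩
  -- An inequality valid around all critical points restricts to any sublevel set, so the lower
  -- bound on the level is immaterial.
  · obtain ⟨ℓ, -, hℓμ⟩ := exists_level (μ := μ) Fs hδ 0
    exact S.best_iterate_local hcoercive hreg hℓμ hβ (h.mono_set (Set.subset_univ _))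
  · obtain ⟨ℓ, hℓ, hℓμ⟩ := exists_level (μ := μ) Fs hδ (⨅ x, F x)
    exact ⟨ℓ, hℓ, S.withProb_accPoints hreg hℓμ, (hlevel ℓ).1, (hlevel ℓ).2,
      fun β ζ hβ _ hζ h => S.lastIterateCount hcoercive hreg hℓμ hβ hζ h hr,
      fun β hβ _ h => hcount hr hℓμ hβ h⟩
  · obtain ⟨ℓ, -, hℓμ⟩ := exists_level (μ := μ) Fs hδ 0
    exact hcount hr hℓμ hβ (h.mono_set (Set.subset_univ _))
  · intro hβ2 hcrit
    refine S.last_iterate_global_rate (hglob h) hr (by positivity) (fun x => ?_) hcrit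
    rcases hβ2.lt_or_eq with hlt | rfl
    · exact hinf.gap_le_of_lt_half hsmooth
        (hβ.elim And.left fun h => absurd h hlt.ne) hlt hζ x
    · exact hinf.gap_le_of_eq_half hsmooth x
  · exact fun hβ2 => ⟨globalExponent_pos hr hα hβ2, S.last_iterate_global_sum (hglob h) hr hβ2 hζ hinf⟩
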